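/- Let $n\ge 2$. Let $E\in L^1_{\rm loc}(\mathbb R;\mathbb R^n)$ satisfy $E(t+1)=E(t)$ for almost every $t$, and put $E_0=\int_0^1E(t)\,dt$. Let $\delta\in\mathbb R$ satisfy $\delta>1$ if $E_0=0$; $\delta>\tfrac12$ if $E_0\neq0$ and $n\ge3$; $\delta>\tfrac34$ if $E_0\ne0$ and $n=2$. Let $V_1,V_2\in C^\infty(\mathbb R\times\mathbb R^n;\mathbb R)$ satisfy $V_j(t+1,x)=V_j(t,x)$ and, for all $k\in\mathbb N$ and $\alpha\in\mathbb N^n$, with some constant $C_{k,\alpha}$, $$|\partial_t^k\partial_x^\alpha V_j(t,x)|\le C_{k,\alpha}\,(1+|x|^2)^{-(\delta+|\alpha|)/2}\qquad\text{for all }(t,x)\in\mathbb R\times\mathbb R^n .$$ On $L^2(\mathbb R^n)$ consider $H_0(t)=-\tfrac12\Delta-E(t)\cdot x$ and $H_j(t)=H_0(t)+V_j(t,x)$, $j=1,2$. A propagator of a family $H(t)$ is a strongly continuous family $U(t,s)$, $(t,s)\in\mathbb R^2$, of unitary operators with $U(t,s)U(s,r)=U(t,r)$ such that for every Schwartz function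 $\psi$, every $f\in L^2(\mathbb R^n)$ and all real $s,t,s_0,s_1,t_0,t_1$ (with $\langle\cdot,\cdot\rangle$ linear in the second argument) $$\langle\psi,U(t_1,s)f\rangle-\langle\psi,U(t_0,s)f\rangle=-i\int_{t_0}^{t_1}\langle H(t)\psi,U(t,s)f\rangle\,dt,$$ $$\langle f,U(t,s_1)\psi\rangle-\langle f,U(t,s_0)\psi\rangle=i\int_{s_0}^{s_1}\langle f,U(t,s)H(s)\psi\rangle\,ds .$$ Then $H_0(t)$ and $H_j(t)$ have unique propagators $U_0(t,s)$ and $U_j(t,s)$, the wave operators $$W_j^\pm(s)\Phi=\lim_{t\to\pm\infty}U_j(s,t)\,U_0(t,s)\,\Phi,\qquad \Phi\in L^2(\mathbb R^n),$$ exist for every $s\in\mathbb R$, and the scattering operators $S_j(s)=W_j^+(s)^*\,W_j^-(s)$ satisfy $$S_1(s)=S_2(s)\ \text{ for all } s\in[0,1]\quad\Longleftrightarrow\quad V_1=V_2 .$$ -/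

import Mathlib

open MeasureTheory Filter Topology
open scoped SchwartzMap ContDiff

noncomputable section

namespace PeriodicField

/-- The configuration space `ℝⁿ` with its Euclidean structure. -/
abbrev Space (n : ℕ) : Type := EuclideanSpace ℝ (Fin n)

/-- The Hilbert space `L²(ℝⁿ; ℂ)`. -/
abbrev L2 (n : ℕ) : Type := Lp ℂ 2 (volume : Measure (Space n))

/-- The external field: `E ∈ L¹_loc(ℝ; ℝⁿ)` and `E(t+1) = E(t)` for almost every `t`. -/
structure IsPeriodicField {n : ℕ} (E : ℝ → Space n) : Prop where
  locallyIntegrable : LocallyIntegrable E volume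
  periodic : ∀ᵐ t : ℝ, E (t + 1) = E t

/-- The mean `E₀ = ∫₀¹ E(t) dt` of the external field. -/
def meanField {n : ℕ} (E : ℝ → Space n) : Space n :=
  ∫ t in (0 : ℝ)..1, E t

/-- `V ∈ C^∞(ℝ × ℝⁿ)` is real valued, 1-periodic in time, and
`|∂_t^k ∂_x^α V(t,x)| ≤ C_{k,α} (1 + |x|²)^(-(δ + |α|)/2)` for all `k` and `α`. The norm of the
`m`-th derivative in `x` controls, and is controlled by, the partial derivatives with `|α| = m`. -/
structure IsPeriodicPotential {n : ℕ} (δ : ℝ) (V : ℝ → Space n → ℝ) : Prop where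
  smooth : ContDiff ℝ ∞ (fun z : ℝ × Space n => V z.1 z.2)
  periodic : ∀ t x, V (t + 1) x = V t x
  decay : ∀ k m : ℕ, ∃ C : ℝ, ∀ (t : ℝ) (x : Space n),
    ‖iteratedFDeriv ℝ m (fun y => iteratedDeriv k (fun τ => V τ y) t) x‖
      ≤ C * (1 + ‖x‖ ^ 2) ^ (-(δ + m) / 2)

/-- The function `H(t)ψ = -½ Δψ - (E(t)·x) ψ + V(t,x) ψ`, for a Schwartz function `ψ`. -/
def hamiltonianFun {n : ℕ} (E : ℝ → Space n) (V : ℝ → Space n → ℝ) (t : ℝ)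
    (ψ : 𝓢(Space n, ℂ)) (x : Space n) : ℂ :=
  -(1 / 2 : ℂ) * (Laplacian.laplacian (ψ : Space n → ℂ)) x
    - ((inner ℝ (E t) x : ℝ) : ℂ) * ψ x + ((V t x : ℝ) : ℂ) * ψ x

/-- `H(t)ψ` is square integrable for every potential considered here. -/
theorem memLp_hamiltonianFun {n : ℕ} (E : ℝ → Space n) {V : ℝ → Space n → ℝ} {δ : ℝ}
    (hδ : 0 ≤ δ) (hV : IsPeriodicPotential δ V) (t : ℝ) (ψ : 𝓢(Space n, ℂ)) :
    MemLp (hamiltonianFun E V t ψ) 2 volume := by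
  have h1 : MemLp (fun x => (Laplacian.laplacian (ψ : Space n → ℂ)) x) 2 volume := by
    have := (Laplacian.laplacian ψ).memLp 2 (volume : Measure (Space n))
    refine this.ae_eq (Eventually.of_forall fun x => ?_)
    exact SchwartzMap.laplacian_apply ψ x
  have h2 : MemLp (fun x => ((inner ℝ (E t) x : ℝ) : ℂ) * ψ x) 2 volume := by
    have hg : (fun x : Space n => inner ℝ (E t) x).HasTemperateGrowth := by fun_prop
    have := (SchwartzMap.smulLeftCLM ℂ (fun x : Space n => inner ℝ (E t) x) ψ).memLp 2
      (volume : Measure (Space n))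
    refine this.ae_eq (Eventually.of_forall fun x => ?_)
    simp [SchwartzMap.smulLeftCLM_apply_apply hg]
  have h3 : MemLp (fun x => ((V t x : ℝ) : ℂ) * ψ x) 2 volume := by
    obtain ⟨C, hC⟩ := hV.decay 0 0
    have hC0 : 0 ≤ C := by
      have := (norm_nonneg _).trans (hC t 0)
      simpa using this
    have hcont : Continuous (fun x => V t x) :=
      hV.smooth.continuous.comp (Continuous.prodMk_right t)
    refine (ψ.memLp 2 (volume : Measure (Space n))).of_le_mul (c := C) ?_
      (Eventually.of_forall fun x => ?_)
    · exact ((Complex.continuous_ofReal.comp hcont).mul ψ.continuous).aestronglyMeasurable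
    · have h := hC t x
      simp only [iteratedDeriv_zero, norm_iteratedFDeriv_zero, Nat.cast_zero, add_zero] at h
      have hx : (1 + ‖x‖ ^ 2) ^ (-δ / 2) ≤ (1 : ℝ) :=
        Real.rpow_le_one_of_one_le_of_nonpos (by nlinarith [sq_nonneg ‖x‖]) (by linarith)
      rw [norm_mul, Complex.norm_real]
      exact mul_le_mul_of_nonneg_right (h.trans (mul_le_of_le_one_right hC0 hx)) (norm_nonneg _)
  exact ((h1.const_mul (-(1 / 2 : ℂ))).sub h2).add h3

open Classical in
/-- The element `H(t)ψ` of `L²(ℝⁿ)`, for a Schwartz function `ψ`. -/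
def hamiltonian {n : ℕ} (E : ℝ → Space n) (V : ℝ → Space n → ℝ) (t : ℝ)
    (ψ : 𝓢(Space n, ℂ)) : L2 n :=
  if h : MemLp (hamiltonianFun E V t ψ) 2 volume then h.toLp else 0

/-- `U(t,s)` is a propagator of the family `H(t) = ½ p² - E(t)·x + V(t,x)`: a strongly continuous
family of unitary operators with `U(t,s) U(s,r) = U(t,r)`, satisfying `i ∂_t U(t,s) = H(t) U(t,s)`
and `i ∂_s U(t,s) = -U(t,s) H(s)` tested against Schwartz functions. Since `E` is only locally
integrable in time, the two equations are required in integrated form. -/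
structure IsPropagator {n : ℕ} (E : ℝ → Space n) (V : ℝ → Space n → ℝ)
    (U : ℝ → ℝ → (L2 n ≃ₗᵢ[ℂ] L2 n)) : Prop where
  continuous : ∀ f : L2 n, Continuous (fun z : ℝ × ℝ => U z.1 z.2 f)
  comp : ∀ (t s r : ℝ) (f : L2 n), U t s (U s r f) = U t r f
  equation_left : ∀ (ψ : 𝓢(Space n, ℂ)) (f : L2 n) (s t₀ t₁ : ℝ),
    inner ℂ (ψ.toLp 2 volume) (U t₁ s f) - inner ℂ (ψ.toLp 2 volume) (U t₀ s f)
      = -Complex.I * ∫ t in t₀..t₁, inner ℂ (hamiltonian E V t ψ) (U t s f)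
  equation_right : ∀ (ψ : 𝓢(Space n, ℂ)) (f : L2 n) (t s₀ s₁ : ℝ),
    inner ℂ f (U t s₁ (ψ.toLp 2 volume)) - inner ℂ f (U t s₀ (ψ.toLp 2 volume))
      = Complex.I * ∫ s in s₀..s₁, inner ℂ f (U t s (hamiltonian E V s ψ))

open Classical in
/-- The propagator of the family `H(t) = ½ p² - E(t)·x + V(t,x)`
(the identity if there is none). -/
def propagator {n : ℕ} (E : ℝ → Space n) (V : ℝ → Space n → ℝ) :
    ℝ → ℝ → (L2 n ≃ₗᵢ[ℂ] L2 n) :=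
  if h : ∃ U, IsPropagator E V U then h.choose else fun _ _ => LinearIsometryEquiv.refl ℂ (L2 n)

/-- The propagator of the free Hamiltonian `H₀(t) = ½ p² - E(t)·x`. -/
def freePropagator {n : ℕ} (E : ℝ → Space n) : ℝ → ℝ → (L2 n ≃ₗᵢ[ℂ] L2 n) :=
  propagator E (fun _ _ => 0)

/-- `W Φ = lim U(s,t) U₀(t,s) Φ` for every `Φ ∈ L²(ℝⁿ)`, as `t` tends along `l`;
`l = atTop` for `W⁺(s)` and `l = atBot` for `W⁻(s)`. -/
def IsWaveOperator {n : ℕ} (E : ℝ → Space n) (V : ℝ → Space n → ℝ) (l : Filter ℝ) (s : ℝ)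
    (W : L2 n →L[ℂ] L2 n) : Prop :=
  ∀ Φ : L2 n, Tendsto (fun t => propagator E V s t (freePropagator E t s Φ)) l (𝓝 (W Φ))

open Classical in
/-- The wave operator at time `s` along `l` (zero if the limit does not exist). -/
def waveOperator {n : ℕ} (E : ℝ → Space n) (V : ℝ → Space n → ℝ) (l : Filter ℝ) (s : ℝ) :
    L2 n →L[ℂ] L2 n :=
  if h : ∃ W, IsWaveOperator E V l s W then h.choose else 0

/-- The scattering operator `S(s) = W⁺(s)* W⁻(s)`. -/
def scatteringOperator {n : ℕ} (E : ℝ → Space n) (V : ℝ → Space n → ℝ) (s : ℝ) :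
    L2 n →L[ℂ] L2 n :=
  ContinuousLinearMap.adjoint (waveOperator E V atTop s) ∘L waveOperator E V atBot s

/-- The scattering operators are well defined: the free and the full propagator exist and are
unique, and the wave operators `W^±(s)` exist for all `s`. -/
structure ScatteringDefined {n : ℕ} (E : ℝ → Space n) (V : ℝ → Space n → ℝ) : Prop where
  free : ∃! U, IsPropagator E (fun _ _ => 0) U
  full : ∃! U, IsPropagator E V U
  wave_pos : ∀ s, ∃ W, IsWaveOperator E V atTop s W
  wave_neg : ∀ s, ∃ W, IsWaveOperator E V atBot s W

end PeriodicField

end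

noncomputable section

namespace PeriodicField

open FourierTransform BoundedContinuousFunction LineDeriv Laplacian

/-! The proof is a time-dependent, high-velocity argument, in which the main effect of the potential
on a packet is first removed as a scalar phase.

Propagators. The free motion in the field is explicit (Avron–Herbst): `frame E t` is a Fourier
multiplier followed by the modulation e^{ib(t)·x}, b = ∫E. Conjugated by it, the potential becomes a
bounded, strongly continuous, symmetric family, so the full motion solves a linear ODE in L²
(`exists_unitary_evolution`). Conversely any propagator, tested against freely moved Schwartz
functions, solves the same ODE (`IsPropagator.interaction_sub`); this is uniqueness. Since E is only
locally integrable, every derivative in time is taken in integrated form, and the product rule is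
`diagonal_integral`.

Packets. Up to phases, a packet of momentum l w - β at time s evolves freely into e^{-i(t-s)p²/2} f
translated to the classical position `centre`. On it the potential differs from its value at the
centre by O((1 + l|t-s|)^{-γ}) with γ > 1 (`PacketEstimate`). For E₀ ≠ 0 the centre is about lτw +
τ²E₀/2, τ = t - s, and one derivative of V outweighs the spreading as soon as δ > 1/2. For E₀ = 0
the decay δ > 1 of V itself suffices, but the part of the packet that is slow along w must be
suppressed; this is the role of the factors `boost`, whose symbol vanishes where the velocity along
w does.

Scattering. The value at the centre is a scalar and contributes only a phase θ_l to the amplitude.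
Cook's method gives the wave operators on a dense set, and the first order expansion
(`norm_inner_wave_limits_sub_le`), rescaled by t = s + u/l, gives l (e^{iθ_l} ⟨W⁺ψ_l, W⁻φ_l⟩ - ⟨ψ_l,
φ_l⟩) → -i ∫ ⟨ψ, (V(s, · + uw) - V(s, uw)) φ⟩ du. If the two scattering operators agree at time s,
the pairings agree, while the phases may differ. The unknown phases can only add a multiple of ⟨ψ,
φ⟩ to the limit (`exists_limit_phase_ratio`), and this multiple is zero because the line oscillation
vanishes at x = 0.

Inversion. The integrals of V(s, x + uw) - V(s, uw) over u thus agree for almost every direction w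
of a pencil in a plane. For each d the function (V₂ - V₁)(x + d) - (V₂ - V₁)(x) decays integrably
along lines and has zero line integrals; integrated against `pencilKernel` these give Poisson
integrals, so the function vanishes (`eq_zero_of_integral_lines`). Hence V₂ - V₁ is constant in x,
and zero by decay. Periodicity extends the equality from s in [0, 1] to all times. -/

/-- Strong continuity of a uniformly bounded family of operators is joint continuity. -/
theorem continuous_clm_apply_of_bounded {T H K : Type*} [TopologicalSpace T]
    [NormedAddCommGroup H] [NormedSpace ℂ H] [NormedAddCommGroup K] [NormedSpace ℂ K]
    {A : T → H →L[ℂ] K} {C : ℝ} (hC : ∀ t, ‖A t‖ ≤ C)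
    (hA : ∀ f, Continuous fun t => A t f) {f : T → H} (hf : Continuous f) :
    Continuous fun t => A t (f t) := by
  rw [continuous_iff_continuousAt]
  intro t₀
  have h1 : Tendsto (fun t => A t (f t - f t₀)) (𝓝 t₀) (𝓝 0) := by
    have : Tendsto (fun t => C * ‖f t - f t₀‖) (𝓝 t₀) (𝓝 0) := by
      have h := ((hf.tendsto t₀).sub_const (f t₀)).norm.const_mul C
      simpa using h
    refine squeeze_zero_norm (fun t => ?_) this
    exact ((A t).le_opNorm _).trans (mul_le_mul_of_nonneg_right (hC t) (norm_nonneg _))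
  have h2 := h1.add ((hA (f t₀)).tendsto t₀)
  have h3 : (fun t => A t (f t - f t₀) + A t (f t₀)) = fun t => A t (f t) := by
    ext t; rw [← map_add]; congr 1; abel
  rw [h3, zero_add] at h2
  exact h2

theorem continuous_isometry_apply {T H K : Type*} [TopologicalSpace T]
    [NormedAddCommGroup H] [NormedSpace ℂ H] [NormedAddCommGroup K] [NormedSpace ℂ K]
    {A : T → H ≃ₗᵢ[ℂ] K} (hA : ∀ f, Continuous fun t => A t f) {f : T → H} (hf : Continuous f) :
    Continuous fun t => A t (f t) :=
  continuous_clm_apply_of_bounded (A := fun t => ((A t).toContinuousLinearEquiv : H →L[ℂ] K))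
    (C := 1) (fun t => ContinuousLinearMap.opNorm_le_bound _ zero_le_one fun x => by simp) hA hf

/-! ### Multiplication operators, phases and Fourier multipliers on L². -/

section Multiplication

variable {n : ℕ}

theorem memLp_boundedMul (m : Space n →ᵇ ℂ) (f : L2 n) :
    MemLp (fun x => m x * f x) 2 volume :=
  (Lp.memLp f).of_le_mul (c := ‖m‖)
    (m.continuous.aestronglyMeasurable.mul (Lp.aestronglyMeasurable f))
    (Eventually.of_forall fun x => by
      rw [norm_mul]; exact mul_le_mul_of_nonneg_right (m.norm_coe_le_norm x) (norm_nonneg _))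

/-- Multiplication by a bounded continuous function, as an operator on `L²`. -/
def boundedMul (m : Space n →ᵇ ℂ) : L2 n →L[ℂ] L2 n :=
  LinearMap.mkContinuous
    { toFun := fun f => (memLp_boundedMul m f).toLp
      map_add' := fun f g => by
        rw [← MemLp.toLp_add]
        apply MemLp.toLp_congr
        filter_upwards [Lp.coeFn_add f g] with x hx
        simp only [Pi.add_apply, hx, mul_add]
      map_smul' := fun c f => by
        rw [RingHom.id_apply, ← MemLp.toLp_const_smul]
        apply MemLp.toLp_congr
        filter_upwards [Lp.coeFn_smul c f] with x hx
        simp only [Pi.smul_apply, hx, smul_eq_mul, mul_left_comm] } ‖m‖ fun f => by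
      apply Lp.norm_le_mul_norm_of_ae_le_mul
      simp only [LinearMap.coe_mk, AddHom.coe_mk]
      filter_upwards [MemLp.coeFn_toLp (memLp_boundedMul m f)] with x hx
      rw [hx, norm_mul]
      exact mul_le_mul_of_nonneg_right (m.norm_coe_le_norm x) (norm_nonneg _)

theorem boundedMul_coeFn (m : Space n →ᵇ ℂ) (f : L2 n) :
    boundedMul m f =ᵐ[volume] fun x => m x * f x :=
  MemLp.coeFn_toLp (memLp_boundedMul m f)

theorem norm_boundedMul_le (m : Space n →ᵇ ℂ) : ‖boundedMul m‖ ≤ ‖m‖ :=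
  LinearMap.mkContinuous_norm_le _ (norm_nonneg _) _

theorem boundedMul_boundedMul (m m' : Space n →ᵇ ℂ) (f : L2 n) :
    boundedMul m (boundedMul m' f) = boundedMul (m * m') f := by
  apply Lp.ext
  filter_upwards [boundedMul_coeFn m (boundedMul m' f), boundedMul_coeFn m' f,
    boundedMul_coeFn (m * m') f] with x h1 h2 h3
  rw [h1, h2, h3]; simp [mul_assoc]

theorem norm_sq_L2 (f : L2 n) : ‖f‖ ^ 2 = ∫ x, ‖f x‖ ^ 2 := by
  have h : (inner ℂ f f : ℂ) = ((‖f‖ ^ 2 : ℝ) : ℂ) := by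
    rw [inner_self_eq_norm_sq_to_K]; norm_cast
  rw [L2.inner_def] at h
  have h2 : (∫ x, (inner ℂ (f x) (f x) : ℂ)) = ((∫ x, ‖f x‖ ^ 2 : ℝ) : ℂ) := by
    refine Eq.trans (integral_congr_ae (Eventually.of_forall fun x => ?_)) integral_ofReal
    simp only
    rw [inner_self_eq_norm_sq_to_K]; norm_cast
  rw [h2] at h
  exact_mod_cast h.symm

theorem integrable_norm_sq_L2 (f : L2 n) : Integrable (fun x => ‖f x‖ ^ 2) :=
  (Lp.memLp f).integrable_norm_pow (by norm_num)

/-- Dominated convergence with majorant (2C)²|f|² turns pointwise continuity in t into strong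
continuity. For phases such as e^{ib(t)·x} norm continuity fails in general, so the whole
development works with strong continuity. -/
theorem continuous_boundedMul {T : Type*} [TopologicalSpace T] [FirstCountableTopology T]
    {m : T → Space n →ᵇ ℂ} {C : ℝ} (hC : ∀ t, ‖m t‖ ≤ C)
    (hm : ∀ x, Continuous fun t => m t x) (f : L2 n) :
    Continuous fun t => boundedMul (m t) f := by
  rw [continuous_iff_continuousAt]
  intro t₀
  rw [ContinuousAt, tendsto_iff_norm_sub_tendsto_zero]
  have key : Tendsto (fun t => ‖boundedMul (m t) f - boundedMul (m t₀) f‖ ^ 2) (𝓝 t₀) (𝓝 0) := by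
    have h1 : ∀ t, ‖boundedMul (m t) f - boundedMul (m t₀) f‖ ^ 2
        = ∫ x, ‖(m t x - m t₀ x) * f x‖ ^ 2 := by
      intro t
      rw [norm_sq_L2]
      apply integral_congr_ae
      filter_upwards [Lp.coeFn_sub (boundedMul (m t) f) (boundedMul (m t₀) f),
        boundedMul_coeFn (m t) f, boundedMul_coeFn (m t₀) f] with x h1 h2 h3
      rw [h1, Pi.sub_apply, h2, h3, sub_mul]
    simp_rw [h1]
    have h0 : (0 : ℝ) = ∫ x : Space n, (0 : ℝ) := by simp
    rw [h0]
    refine tendsto_integral_filter_of_dominated_convergence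
      (fun x => (2 * C) ^ 2 * ‖f x‖ ^ 2) (Eventually.of_forall fun t => ?_)
      (Eventually.of_forall fun t => Eventually.of_forall fun x => ?_)
      ((integrable_norm_sq_L2 f).const_mul _) (Eventually.of_forall fun x => ?_)
    · exact (((m t).continuous.sub (m t₀).continuous).aestronglyMeasurable.mul
        (Lp.aestronglyMeasurable f)).norm.pow 2
    · have hC0 : 0 ≤ C := (norm_nonneg _).trans (hC t)
      rw [Real.norm_of_nonneg (by positivity), norm_mul, mul_pow]
      gcongr
      calc ‖m t x - m t₀ x‖ ≤ ‖m t x‖ + ‖m t₀ x‖ := norm_sub_le _ _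
        _ ≤ C + C := add_le_add (((m t).norm_coe_le_norm x).trans (hC t))
            (((m t₀).norm_coe_le_norm x).trans (hC t₀))
        _ = 2 * C := by ring
    · have : Tendsto (fun t => ‖(m t x - m t₀ x) * f x‖ ^ 2) (𝓝 t₀)
          (𝓝 (‖(m t₀ x - m t₀ x) * f x‖ ^ 2)) :=
        ((((hm x).tendsto t₀).sub_const _).mul_const _).norm.pow 2
      simpa using this
  have := key.sqrt
  simpa [Real.sqrt_sq] using this

/-- The bounded function `e^{iθ}`. -/
def phaseFun (θ : C(Space n, ℝ)) : Space n →ᵇ ℂ :=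
  BoundedContinuousFunction.ofNormedAddCommGroup (fun x => Complex.exp (Complex.I * θ x))
    (by fun_prop) 1 fun x => by rw [mul_comm, Complex.norm_exp_ofReal_mul_I]

@[simp] theorem phaseFun_apply (θ : C(Space n, ℝ)) (x : Space n) :
    phaseFun θ x = Complex.exp (Complex.I * θ x) := rfl

theorem norm_phaseFun_apply (θ : C(Space n, ℝ)) (x : Space n) : ‖phaseFun θ x‖ = 1 := by
  rw [phaseFun_apply, mul_comm, Complex.norm_exp_ofReal_mul_I]

theorem norm_phaseFun_le (θ : C(Space n, ℝ)) : ‖phaseFun θ‖ ≤ 1 :=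
  (BoundedContinuousFunction.norm_le zero_le_one).2 fun x => (norm_phaseFun_apply θ x).le

theorem phaseFun_mul (θ θ' : C(Space n, ℝ)) : phaseFun θ * phaseFun θ' = phaseFun (θ + θ') := by
  ext x
  simp [← Complex.exp_add, mul_add]

theorem boundedMul_one (f : L2 n) : boundedMul (1 : Space n →ᵇ ℂ) f = f := by
  apply Lp.ext
  filter_upwards [boundedMul_coeFn 1 f] with x h
  simp [h]

theorem phaseFun_zero : phaseFun (0 : C(Space n, ℝ)) = 1 := by
  ext x; simp

/-- Multiplication by `e^{iθ}`, as a unitary operator on `L²`. -/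
def phase (θ : C(Space n, ℝ)) : L2 n ≃ₗᵢ[ℂ] L2 n where
  toLinearEquiv := LinearEquiv.ofLinearMap (boundedMul (phaseFun θ)).toLinearMap
    (boundedMul (phaseFun (-θ))).toLinearMap
    (by ext1 f; simp [boundedMul_boundedMul, phaseFun_mul, phaseFun_zero, boundedMul_one])
    (by ext1 f; simp [boundedMul_boundedMul, phaseFun_mul, phaseFun_zero, boundedMul_one])
  norm_map' f := by
    have : ‖boundedMul (phaseFun θ) f‖ = ‖f‖ := by
      rw [Lp.norm_def, Lp.norm_def]
      congr 1
      apply eLpNorm_congr_norm_ae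
      filter_upwards [boundedMul_coeFn (phaseFun θ) f] with x h
      rw [h, norm_mul, norm_phaseFun_apply, one_mul]
    exact this

theorem phase_apply (θ : C(Space n, ℝ)) (f : L2 n) : phase θ f = boundedMul (phaseFun θ) f := rfl

theorem phase_coeFn (θ : C(Space n, ℝ)) (f : L2 n) :
    phase θ f =ᵐ[volume] fun x => Complex.exp (Complex.I * θ x) * f x :=
  boundedMul_coeFn _ _

theorem phase_phase (θ θ' : C(Space n, ℝ)) (f : L2 n) :
    phase θ (phase θ' f) = phase (θ + θ') f := by
  simp [phase_apply, boundedMul_boundedMul, phaseFun_mul]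

theorem phase_zero (f : L2 n) : phase 0 f = f := by
  rw [phase_apply, phaseFun_zero, boundedMul_one]

theorem continuous_phase {T : Type*} [TopologicalSpace T] [FirstCountableTopology T]
    {θ : T → C(Space n, ℝ)} (hθ : ∀ x, Continuous fun t => θ t x) (f : L2 n) :
    Continuous fun t => phase (θ t) f :=
  continuous_boundedMul (fun t => norm_phaseFun_le (θ t)) (fun x => by
    have := hθ x
    simp only [phaseFun_apply]; fun_prop) f

/-- The unitary operator `e^{iθ(p)}`, where `p` is the frequency. -/
def multiplier (θ : C(Space n, ℝ)) : L2 n ≃ₗᵢ[ℂ] L2 n :=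
  ((Lp.fourierTransformₗᵢ (Space n) ℂ).trans (phase θ)).trans
    (Lp.fourierTransformₗᵢ (Space n) ℂ).symm

theorem multiplier_apply (θ : C(Space n, ℝ)) (f : L2 n) : multiplier θ f = 𝓕⁻ (phase θ (𝓕 f)) :=
  rfl

theorem fourier_multiplier (θ : C(Space n, ℝ)) (f : L2 n) :
    𝓕 (multiplier θ f) = phase θ (𝓕 f) := by
  rw [multiplier_apply, FourierTransform.fourier_fourierInv_eq]

theorem multiplier_multiplier (θ θ' : C(Space n, ℝ)) (f : L2 n) :
    multiplier θ (multiplier θ' f) = multiplier (θ + θ') f := by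
  rw [multiplier_apply, fourier_multiplier, phase_phase, ← multiplier_apply]

theorem multiplier_zero (f : L2 n) : multiplier 0 f = f := by
  rw [multiplier_apply, phase_zero, FourierTransform.fourierInv_fourier_eq]

theorem continuous_multiplier {T : Type*} [TopologicalSpace T] [FirstCountableTopology T]
    {θ : T → C(Space n, ℝ)} (hθ : ∀ x, Continuous fun t => θ t x) (f : L2 n) :
    Continuous fun t => multiplier (θ t) f :=
  (Lp.fourierTransformₗᵢ (Space n) ℂ).symm.continuous.comp (continuous_phase hθ (𝓕 f))

end Multiplication

/-! ### The same operators on Schwartz functions. -/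

section SchwartzLevel

variable {n : ℕ}

/-- All derivatives are unimodular, so exponent 0 and constant 1 serve at every order. By
composition e^{iθ} acts on Schwartz functions whenever θ has temperate growth. -/
theorem hasTemperateGrowth_exp_I_mul : (fun r : ℝ => Complex.exp (Complex.I * r)).HasTemperateGrowth := by
  refine ⟨?_, fun m => ⟨0, 1, fun r => ?_⟩⟩
  · exact (contDiff_const.mul Complex.ofRealCLM.contDiff).cexp
  · rw [norm_iteratedFDeriv_eq_norm_iteratedDeriv]
    have h : ∀ k : ℕ, iteratedDeriv k (fun r : ℝ => Complex.exp (Complex.I * r))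
        = fun r : ℝ => Complex.I ^ k * Complex.exp (Complex.I * r) := by
      intro k
      induction k with
      | zero => simp
      | succ k ih =>
        rw [iteratedDeriv_succ, ih]
        ext r
        have h1 : HasDerivAt (fun r : ℝ => Complex.exp (Complex.I * r))
            (Complex.exp (Complex.I * r) * Complex.I) r := by
          have := ((Complex.ofRealCLM.hasDerivAt (x := r)).const_mul Complex.I).cexp
          simpa using this
        rw [(h1.const_mul _).deriv]
        ring
    rw [h, norm_mul, norm_pow, Complex.norm_I, mul_comm Complex.I, Complex.norm_exp_ofReal_mul_I]
    simp

theorem hasTemperateGrowth_phaseFun {θ : C(Space n, ℝ)} (hθ : (θ : Space n → ℝ).HasTemperateGrowth) :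
    (phaseFun θ : Space n → ℂ).HasTemperateGrowth :=
  hasTemperateGrowth_exp_I_mul.comp hθ

/-- Multiplication of a Schwartz function by `e^{iθ}`. -/
def schwartzPhase (θ : C(Space n, ℝ)) : 𝓢(Space n, ℂ) →L[ℂ] 𝓢(Space n, ℂ) :=
  SchwartzMap.smulLeftCLM ℂ (phaseFun θ)

theorem schwartzPhase_apply {θ : C(Space n, ℝ)} (hθ : (θ : Space n → ℝ).HasTemperateGrowth)
    (f : 𝓢(Space n, ℂ)) (x : Space n) :
    schwartzPhase θ f x = Complex.exp (Complex.I * θ x) * f x := by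
  rw [schwartzPhase, SchwartzMap.smulLeftCLM_apply_apply (hasTemperateGrowth_phaseFun hθ)]
  simp

theorem toLp_schwartzPhase {θ : C(Space n, ℝ)} (hθ : (θ : Space n → ℝ).HasTemperateGrowth)
    (f : 𝓢(Space n, ℂ)) : (schwartzPhase θ f).toLp 2 volume = phase θ (f.toLp 2 volume) := by
  apply Lp.ext
  filter_upwards [SchwartzMap.coeFn_toLp (schwartzPhase θ f) 2 volume, SchwartzMap.coeFn_toLp f 2 volume,
    phase_coeFn θ (f.toLp 2 volume)] with x h1 h2 h3
  rw [h1, h3, h2, schwartzPhase_apply hθ]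

/-- The operator `e^{iθ(p)}` on Schwartz functions. -/
def schwartzMultiplier (θ : C(Space n, ℝ)) : 𝓢(Space n, ℂ) →L[ℂ] 𝓢(Space n, ℂ) :=
  SchwartzMap.fourierMultiplierCLM ℂ (phaseFun θ)

theorem schwartzMultiplier_apply (θ : C(Space n, ℝ)) (f : 𝓢(Space n, ℂ)) :
    schwartzMultiplier θ f = 𝓕⁻ (schwartzPhase θ (𝓕 f)) := rfl

theorem fourier_schwartzMultiplier (θ : C(Space n, ℝ)) (f : 𝓢(Space n, ℂ)) :
    𝓕 (schwartzMultiplier θ f) = schwartzPhase θ (𝓕 f) := by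
  rw [schwartzMultiplier_apply, FourierTransform.fourier_fourierInv_eq]

theorem toLp_schwartzMultiplier {θ : C(Space n, ℝ)} (hθ : (θ : Space n → ℝ).HasTemperateGrowth)
    (f : 𝓢(Space n, ℂ)) :
    (schwartzMultiplier θ f).toLp 2 volume = multiplier θ (f.toLp 2 volume) := by
  rw [schwartzMultiplier_apply, ← SchwartzMap.toLp_fourierInv_eq, toLp_schwartzPhase hθ,
    ← SchwartzMap.toLp_fourier_eq, multiplier_apply]

theorem dense_range_toLp : DenseRange (fun f : 𝓢(Space n, ℂ) => f.toLp 2 (volume : Measure (Space n))) :=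
  SchwartzMap.denseRange_toLpCLM (by norm_num)

end SchwartzLevel

attribute [irreducible] boundedMul phase multiplier schwartzPhase schwartzMultiplier

/-! ### Product and chain rules for absolutely continuous functions of time. -/

section AbsolutelyContinuousCalculus

theorem intervalIntegrable_of_locallyIntegrable {E : Type*} [NormedAddCommGroup E] {f : ℝ → E}
    (hf : LocallyIntegrable f volume) (a b : ℝ) : IntervalIntegrable f volume a b :=
  (hf.integrableOn_isCompact isCompact_uIcc).intervalIntegrable


/-- A function whose increments are locally `ε`-small relative to an integrable density vanishes
in increments. -/
theorem eq_of_forall_increment_le {E : Type*} [NormedAddCommGroup E] {D : ℝ → E} {m : ℝ → ℝ}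
    (hm : LocallyIntegrable m volume)
    {a b : ℝ} (hab : a ≤ b)
    (h : ∀ ε > 0, ∃ η > 0, ∀ s t, a ≤ s → s ≤ t → t ≤ b → t - s < η →
      ‖D t - D s‖ ≤ ε * ∫ τ in s..t, m τ) : D b = D a := by
  have hint : ∀ s t, IntervalIntegrable m volume s t := intervalIntegrable_of_locallyIntegrable hm
  have main : ∀ ε > 0, ‖D b - D a‖ ≤ ε * ∫ τ in a..b, m τ := by
    intro ε hε
    obtain ⟨η, hη, H⟩ := h ε hε
    -- N equal steps are shorter than η, and the bounds on the steps add up to ε ∫ m over [a, b].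
    obtain ⟨N, hN⟩ := exists_nat_gt ((b - a) / η)
    have hN0 : (0 : ℝ) < N := lt_of_le_of_lt (div_nonneg (by linarith) hη.le) hN
    set x : ℕ → ℝ := fun k => a + k * ((b - a) / N) with hx
    have hstep : ∀ k, x (k + 1) - x k = (b - a) / N := fun k => by simp [hx]; ring
    have hd : 0 ≤ (b - a) / N := div_nonneg (by linarith) hN0.le
    have hx0 : x 0 = a := by simp [hx]
    have hxN : x N = b := by simp only [hx]; field_simp; ring
    have hmono : Monotone x := monotone_nat_of_le_succ fun k => by linarith [hstep k]
    have hle : ∀ k ∈ Finset.range N, dist (D (x k)) (D (x (k + 1)))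
        ≤ ε * ∫ τ in (x k)..(x (k + 1)), m τ := by
      intro k hk
      have hk' := Finset.mem_range.1 hk
      rw [dist_comm, dist_eq_norm]
      refine H _ _ (hx0 ▸ hmono (Nat.zero_le k)) (hmono (Nat.le_succ k))
        (hxN ▸ hmono hk') ?_
      rw [hstep, div_lt_iff₀ hN0]
      rw [div_lt_iff₀ hη] at hN
      linarith
    have h1 := dist_le_range_sum_of_dist_le (f := fun k => D (x k)) N
      (d := fun k => ε * ∫ τ in (x k)..(x (k + 1)), m τ)
      (fun {k} hk => hle k (Finset.mem_range.2 hk))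
    rw [hx0, hxN, ← Finset.mul_sum,
      intervalIntegral.sum_integral_adjacent_intervals fun k _ => hint _ _, hx0, hxN, dist_comm,
      dist_eq_norm] at h1
    exact h1
  have h0 : ‖D b - D a‖ ≤ 0 := by
    refine ge_of_tendsto (f := fun ε : ℝ => ε * ∫ τ in a..b, m τ) (x := 𝓝[>] 0) ?_ ?_
    · have : Tendsto (fun ε : ℝ => ε * ∫ τ in a..b, m τ) (𝓝 0) (𝓝 (0 * ∫ τ in a..b, m τ)) :=
        tendsto_id.mul_const _
      rw [zero_mul] at this
      exact this.mono_left nhdsWithin_le_nhds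
    · filter_upwards [self_mem_nhdsWithin] with ε hε using main ε hε
  exact sub_eq_zero.1 (norm_le_zero_iff.1 h0)

theorem intervalIntegrable_sum_mul {ι : Type*} [Fintype ι] {e : ι → ℝ → ℝ}
    (he : ∀ k, LocallyIntegrable (e k) volume) {A : ι → ℝ → ℂ} (hA : ∀ k, Continuous (A k))
    (a b : ℝ) : IntervalIntegrable (fun t => ∑ k, (e k t : ℂ) * A k t) volume a b := by
  have : ∀ k, IntervalIntegrable (fun t => (e k t : ℂ) * A k t) volume a b := fun k => by
    have h1 : IntervalIntegrable (fun t => (e k t : ℂ)) volume a b :=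
      ⟨(intervalIntegrable_of_locallyIntegrable (he k) a b).1.ofReal,
        (intervalIntegrable_of_locallyIntegrable (he k) a b).2.ofReal⟩
    exact h1.mul_continuousOn (hA k).continuousOn
  have := IntervalIntegrable.sum (Finset.univ) (f := fun k t => (e k t : ℂ) * A k t)
    (fun k _ => this k)
  simpa [Finset.sum_fn] using this

/-- The chain rule along the diagonal for a function which is absolutely continuous in each
variable, with densities that are products of integrable and of continuous functions. -/
theorem diagonal_integral {ι : Type*} [Fintype ι] {e : ι → ℝ → ℝ}
    (he : ∀ k, LocallyIntegrable (e k) volume) {F : ℝ → ℝ → ℂ} {A B : ι → ℝ → ℝ → ℂ}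
    (hA : ∀ k, Continuous (Function.uncurry (A k))) (hB : ∀ k, Continuous (Function.uncurry (B k)))
    (h1 : ∀ t τ₀ τ₁, F t τ₁ - F t τ₀ = ∫ τ in τ₀..τ₁, ∑ k, (e k τ : ℂ) * A k t τ)
    (h2 : ∀ τ t₀ t₁, F t₁ τ - F t₀ τ = ∫ t in t₀..t₁, ∑ k, (e k t : ℂ) * B k t τ) (t₀ t₁ : ℝ) :
    F t₁ t₁ - F t₀ t₀ = ∫ t in t₀..t₁, ∑ k, (e k t : ℂ) * (A k t t + B k t t) := by
  have hA1 : ∀ t k, Continuous (A k t) := fun t k => (hA k).comp (Continuous.prodMk_right t)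
  have hB1 : ∀ τ k, Continuous fun t => B k t τ := fun τ k => (hB k).comp (Continuous.prodMk_left τ)
  have hAB : ∀ k, Continuous fun t => A k t t + B k t t := fun k =>
    ((hA k).comp (continuous_id.prodMk continuous_id)).add
      ((hB k).comp (continuous_id.prodMk continuous_id))
  wlog hle : t₀ ≤ t₁ generalizing t₀ t₁
  · rw [intervalIntegral.integral_symm, ← this t₁ t₀ (le_of_not_ge hle)]; ring
  set m : ℝ → ℝ := fun t => ∑ k, |e k t| with hm
  have hmint : LocallyIntegrable m volume := by
    have : LocallyIntegrable (∑ k, fun t => |e k t|) volume :=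
      locallyIntegrable_finsetSum' Finset.univ fun k _ x => (he k x).norm
    simpa [hm, Finset.sum_fn] using this
  -- The difference of the two sides, as a function of the upper endpoint, will be shown to have
  -- increments at most ε ∫ Σ|e k|, and is therefore constant.
  have key := eq_of_forall_increment_le
    (D := fun t => F t t - ∫ τ in t₀..t, ∑ k, (e k τ : ℂ) * (A k τ τ + B k τ τ)) hmint hle ?_
  · simp only [intervalIntegral.integral_same, sub_zero] at key
    rw [← key]; ring
  intro ε hε
  have unif : ∀ G : ℝ → ℝ → ℂ, Continuous (Function.uncurry G) → ∃ η > 0, ∀ p q : ℝ × ℝ,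
      p ∈ Set.Icc t₀ t₁ ×ˢ Set.Icc t₀ t₁ → q ∈ Set.Icc t₀ t₁ ×ˢ Set.Icc t₀ t₁ → dist p q < η →
      ‖G p.1 p.2 - G q.1 q.2‖ ≤ ε / 2 := by
    intro G hG
    have := (isCompact_Icc.prod isCompact_Icc).uniformContinuousOn_of_continuous
      (s := Set.Icc t₀ t₁ ×ˢ Set.Icc t₀ t₁) hG.continuousOn
    rw [Metric.uniformContinuousOn_iff] at this
    obtain ⟨η, hη, H⟩ := this (ε / 2) (by positivity)
    exact ⟨η, hη, fun p q hp hq hpq => by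
      have := H p hp q hq hpq
      rw [dist_eq_norm] at this
      exact this.le⟩
  choose ηA hηA HA using fun k => unif (A k) (hA k)
  choose ηB hηB HB using fun k => unif (B k) (hB k)
  obtain ⟨η, hη, hη'⟩ : ∃ η > 0, ∀ k, η ≤ ηA k ∧ η ≤ ηB k := by
    rcases isEmpty_or_nonempty ι with hι | hι
    · exact ⟨1, one_pos, fun k => (hι.false k).elim⟩
    · refine ⟨Finset.univ.inf' Finset.univ_nonempty (fun k => min (ηA k) (ηB k)), ?_, fun k => ?_⟩
      · simp [Finset.lt_inf'_iff, hηA, hηB]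
      · exact le_min_iff.1 (Finset.inf'_le _ (Finset.mem_univ k))
  refine ⟨η, hη, fun s t hs hst ht hlt => ?_⟩
  -- Going from (s, s) to (t, t) through the corner (t, s) gives exact integrals with A frozen at
  -- first variable t and B at second variable s. Only their distance from the diagonal values
  -- remains, and it is small by uniform continuity on the square.
  have e1 : F t t - (∫ τ in t₀..t, ∑ k, (e k τ : ℂ) * (A k τ τ + B k τ τ))
      - (F s s - ∫ τ in t₀..s, ∑ k, (e k τ : ℂ) * (A k τ τ + B k τ τ))
      = ∫ τ in s..t, ∑ k, (e k τ : ℂ) * ((A k t τ - A k τ τ) + (B k τ s - B k τ τ)) := by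
    have i1 := intervalIntegral.integral_interval_sub_left
      (intervalIntegrable_sum_mul he hAB t₀ t) (intervalIntegrable_sum_mul he hAB t₀ s)
    have i2 : (∫ τ in s..t, ∑ k, (e k τ : ℂ) * ((A k t τ - A k τ τ) + (B k τ s - B k τ τ)))
        = (∫ τ in s..t, ∑ k, (e k τ : ℂ) * A k t τ) + (∫ τ in s..t, ∑ k, (e k τ : ℂ) * B k τ s)
          - ∫ τ in s..t, ∑ k, (e k τ : ℂ) * (A k τ τ + B k τ τ) := by
      rw [← intervalIntegral.integral_add (intervalIntegrable_sum_mul he (hA1 t) s t)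
        (intervalIntegrable_sum_mul he (hB1 s) s t),
        ← intervalIntegral.integral_sub ((intervalIntegrable_sum_mul he (hA1 t) s t).add
        (intervalIntegrable_sum_mul he (hB1 s) s t)) (intervalIntegrable_sum_mul he hAB s t)]
      congr 1; ext τ
      rw [← Finset.sum_add_distrib, ← Finset.sum_sub_distrib]
      exact Finset.sum_congr rfl fun k _ => by ring
    rw [i2, ← i1, ← h1 t s t, ← h2 s s t]; ring
  have hb := intervalIntegral.norm_integral_le_of_norm_le hst
    (g := fun τ => ε * m τ) (f := fun τ => ∑ k, (e k τ : ℂ) * ((A k t τ - A k τ τ) + (B k τ s - B k τ τ)))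
    (μ := volume) (Eventually.of_forall fun τ hτ => ?_) ((intervalIntegrable_of_locallyIntegrable hmint s t).const_mul ε)
  · rw [e1]
    refine hb.trans (le_of_eq ?_)
    rw [intervalIntegral.integral_const_mul]
  · have hτ1 : s ≤ τ := hτ.1.le
    have hτ2 := hτ.2
    rw [hm]
    simp only
    rw [Finset.mul_sum]
    refine (norm_sum_le _ _).trans (Finset.sum_le_sum fun k _ => ?_)
    rw [norm_mul, Complex.norm_real, Real.norm_eq_abs, mul_comm]
    refine mul_le_mul_of_nonneg_right ?_ (abs_nonneg _)
    have mt : t ∈ Set.Icc t₀ t₁ := ⟨hs.trans hst, ht⟩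
    have ms : s ∈ Set.Icc t₀ t₁ := ⟨hs, hst.trans ht⟩
    have mτ : τ ∈ Set.Icc t₀ t₁ := ⟨hs.trans hτ1, hτ2.trans ht⟩
    have d1 := HA k (t, τ) (τ, τ) ⟨mt, mτ⟩ ⟨mτ, mτ⟩ (by
      rw [Prod.dist_eq, dist_self, max_eq_left dist_nonneg, Real.dist_eq, abs_lt]
      have := (hη' k).1
      constructor <;> simp only <;> linarith)
    have d2 := HB k (τ, s) (τ, τ) ⟨mτ, ms⟩ ⟨mτ, mτ⟩ (by
      rw [Prod.dist_eq, dist_self, max_eq_right dist_nonneg, Real.dist_eq, abs_lt]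
      have := (hη' k).2
      constructor <;> simp only <;> linarith)
    refine (norm_add_le _ _).trans ?_
    simp only at d1 d2
    linarith

theorem norm_exp_I_mul_sub_le (x : ℝ) :
    ‖Complex.exp (Complex.I * x) - 1 - Complex.I * x‖ ≤ 2 * x ^ 2 := by
  rcases le_or_gt |x| 1 with h | h
  · have := Complex.norm_exp_sub_one_sub_id_le (x := Complex.I * x) (by simpa using h)
    simp only [norm_mul, Complex.norm_I, one_mul, Complex.norm_real, Real.norm_eq_abs, sq_abs] at this
    nlinarith [sq_nonneg x]
  · have h1 := Real.norm_exp_I_mul_ofReal_sub_one_le (x := x)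
    refine (norm_sub_le _ _).trans ?_
    rw [norm_mul, Complex.norm_I, one_mul, Complex.norm_real, Real.norm_eq_abs] at *
    nlinarith [sq_abs x]

/-- The chain rule for `e^{iθ}`, where `θ` is absolutely continuous. -/
theorem exp_I_mul_sub_eq_integral {θ g : ℝ → ℝ} (hg : LocallyIntegrable g volume)
    (hθ : ∀ t₀ t₁, θ t₁ - θ t₀ = ∫ t in t₀..t₁, g t) (t₀ t₁ : ℝ) :
    Complex.exp (Complex.I * θ t₁) - Complex.exp (Complex.I * θ t₀)
      = ∫ t in t₀..t₁, (g t : ℂ) * (Complex.I * Complex.exp (Complex.I * θ t)) := by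
  wlog hle : t₀ ≤ t₁ generalizing t₀ t₁
  · rw [intervalIntegral.integral_symm, ← this t₁ t₀ (le_of_not_ge hle)]; ring
  have hint := intervalIntegrable_of_locallyIntegrable hg
  have hθc : Continuous θ := by
    have h : θ = fun t => θ 0 + ∫ τ in (0 : ℝ)..t, g τ := by ext t; rw [← hθ]; ring
    rw [h]
    exact continuous_const.add (intervalIntegral.continuous_primitive hint 0)
  have hec : Continuous fun t => Complex.I * Complex.exp (Complex.I * θ t) := by fun_prop
  have hI : ∀ a b, IntervalIntegrable
      (fun t => (g t : ℂ) * (Complex.I * Complex.exp (Complex.I * θ t))) volume a b := fun a b => by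
    have := intervalIntegrable_sum_mul (ι := Unit) (e := fun _ => g) (fun _ => hg)
      (A := fun _ t => Complex.I * Complex.exp (Complex.I * θ t)) (fun _ => hec) a b
    simpa using this
  have hgC : ∀ a b, IntervalIntegrable (fun t => (g t : ℂ)) volume a b := fun a b =>
    ⟨(hint a b).1.ofReal, (hint a b).2.ofReal⟩
  have hmint : LocallyIntegrable (fun t => |g t|) volume := fun x => (hg x).norm
  have key := eq_of_forall_increment_le (D := fun t => Complex.exp (Complex.I * θ t)
    - ∫ τ in t₀..t, (g τ : ℂ) * (Complex.I * Complex.exp (Complex.I * θ τ))) hmint hle ?_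
  · simp only [intervalIntegral.integral_same, sub_zero] at key
    rw [← key]; ring
  intro ε hε
  have := (isCompact_Icc (a := t₀) (b := t₁)).uniformContinuousOn_of_continuous hθc.continuousOn
  rw [Metric.uniformContinuousOn_iff] at this
  -- With θ oscillating by at most ε/4 on a step, the quadratic Taylor remainder costs ε/2 and
  -- freezing the exponential at s costs ε/4, each times ∫ |g|.
  obtain ⟨η, hη, H⟩ := this (ε / 4) (by positivity)
  refine ⟨η, hη, fun s t hs hst ht hlt => ?_⟩
  have e1 : Complex.exp (Complex.I * θ t)
      - (∫ τ in t₀..t, (g τ : ℂ) * (Complex.I * Complex.exp (Complex.I * θ τ)))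
      - (Complex.exp (Complex.I * θ s)
        - ∫ τ in t₀..s, (g τ : ℂ) * (Complex.I * Complex.exp (Complex.I * θ τ)))
      = Complex.exp (Complex.I * θ s) * (Complex.exp (Complex.I * (θ t - θ s : ℝ)) - 1
          - Complex.I * (θ t - θ s : ℝ))
        + ∫ τ in s..t, (g τ : ℂ) * (Complex.I * (Complex.exp (Complex.I * θ s)
          - Complex.exp (Complex.I * θ τ))) := by
    have i1 := intervalIntegral.integral_interval_sub_left (hI t₀ t) (hI t₀ s)
    have i2 : (∫ τ in s..t, (g τ : ℂ) * (Complex.I * (Complex.exp (Complex.I * θ s)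
          - Complex.exp (Complex.I * θ τ))))
        = Complex.exp (Complex.I * θ s) * (Complex.I * (θ t - θ s : ℝ))
          - ∫ τ in s..t, (g τ : ℂ) * (Complex.I * Complex.exp (Complex.I * θ τ)) := by
      rw [hθ s t, ← intervalIntegral.integral_ofReal, ← intervalIntegral.integral_const_mul,
        ← intervalIntegral.integral_const_mul, ← intervalIntegral.integral_sub
          (((hgC s t).const_mul _).const_mul _) (hI s t)]
      congr 1; ext τ; ring
    have i3 : Complex.exp (Complex.I * θ t)
        = Complex.exp (Complex.I * θ s) * Complex.exp (Complex.I * (θ t - θ s : ℝ)) := by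
      rw [← Complex.exp_add]; congr 1; push_cast; ring
    rw [i2, ← i1, i3]; ring
  have hd : ∀ τ, s ≤ τ → τ ≤ t → |θ τ - θ s| ≤ ε / 4 := fun τ h1 h2 => by
    have := H τ ⟨hs.trans h1, h2.trans ht⟩ s ⟨hs, hst.trans ht⟩ (by
      rw [Real.dist_eq, abs_lt]; constructor <;> linarith)
    rw [Real.dist_eq] at this
    exact this.le
  have hΔ : |θ t - θ s| ≤ ∫ τ in s..t, |g τ| := by
    rw [hθ s t]
    exact intervalIntegral.abs_integral_le_integral_abs hst
  have b1 : ‖Complex.exp (Complex.I * θ s) * (Complex.exp (Complex.I * (θ t - θ s : ℝ)) - 1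
      - Complex.I * (θ t - θ s : ℝ))‖ ≤ ε / 2 * ∫ τ in s..t, |g τ| := by
    rw [norm_mul, mul_comm Complex.I (θ s : ℂ), Complex.norm_exp_ofReal_mul_I, one_mul]
    refine (norm_exp_I_mul_sub_le _).trans ?_
    have := hd t hst le_rfl
    rw [← sq_abs]
    nlinarith [abs_nonneg (θ t - θ s)]
  have b2 : ‖∫ τ in s..t, (g τ : ℂ) * (Complex.I * (Complex.exp (Complex.I * θ s)
      - Complex.exp (Complex.I * θ τ)))‖ ≤ ε / 4 * ∫ τ in s..t, |g τ| := by
    rw [← intervalIntegral.integral_const_mul]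
    refine intervalIntegral.norm_integral_le_of_norm_le hst (Eventually.of_forall fun τ hτ => ?_)
      ((intervalIntegrable_of_locallyIntegrable hmint s t).const_mul _)
    rw [norm_mul, Complex.norm_real, Real.norm_eq_abs, mul_comm]
    refine mul_le_mul_of_nonneg_right ?_ (abs_nonneg _)
    rw [norm_mul, Complex.norm_I, one_mul]
    have i3 : Complex.exp (Complex.I * θ s) - Complex.exp (Complex.I * θ τ)
        = -(Complex.exp (Complex.I * θ s) * (Complex.exp (Complex.I * (θ τ - θ s : ℝ)) - 1)) := by
      rw [mul_sub, ← Complex.exp_add, mul_one, neg_sub]; congr 2; push_cast; ring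
    rw [i3, norm_neg, norm_mul, mul_comm Complex.I (θ s : ℂ), Complex.norm_exp_ofReal_mul_I, one_mul]
    exact Real.norm_exp_I_mul_ofReal_sub_one_le.trans (hd τ hτ.1.le hτ.2)
  have b3 : 0 ≤ ∫ τ in s..t, |g τ| := (abs_nonneg _).trans hΔ
  rw [e1]
  refine (norm_add_le _ _).trans ?_
  nlinarith

end AbsolutelyContinuousCalculus

/-! ### Weak time derivative of a moving phase. -/

section PhaseDerivative

variable {n : ℕ} {ι : Type*} [Fintype ι]

/-- The weak derivative of `t ↦ e^{iθ(t,x)} f` in `L²`. -/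
theorem inner_phase_sub_eq_integral {e : ι → ℝ → ℝ} (he : ∀ k, LocallyIntegrable (e k) volume)
    {m : ι → Space n → ℝ} {θ : ℝ → C(Space n, ℝ)}
    (hθc : Continuous fun p : ℝ × Space n => θ p.1 p.2)
    (hθ : ∀ x t₀ t₁, θ t₁ x - θ t₀ x = ∫ t in t₀..t₁, ∑ k, e k t * m k x)
    (h f : L2 n) (fm : ι → L2 n) (hfm : ∀ k, fm k =ᵐ[volume] fun x => (m k x : ℂ) * f x)
    (t₀ t₁ : ℝ) :
    inner ℂ h (phase (θ t₁) f) - inner ℂ h (phase (θ t₀) f)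
      = ∫ t in t₀..t₁, ∑ k, (e k t : ℂ) * inner ℂ h (phase (θ t) (Complex.I • fm k)) := by
  have hloc : ∀ x, LocallyIntegrable (fun t => ∑ k, e k t * m k x) volume := fun x => by
    have : LocallyIntegrable (∑ k, fun t => m k x • e k t) volume :=
      locallyIntegrable_finsetSum' Finset.univ fun k _ => (he k).smul (m k x)
    simpa [Finset.sum_fn, mul_comm] using this
  have hθt : ∀ x, Continuous fun t => θ t x := fun x => hθc.comp (Continuous.prodMk_left x)
  have hcont : ∀ g, Continuous fun t => inner ℂ h (phase (θ t) g) := fun g =>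
    continuous_const.inner (continuous_phase hθt g)
  set μ := (volume : Measure ℝ).restrict (Set.uIoc t₀ t₁) with hμ
  -- Joint integrability for Fubini: an L¹ function of x, an L¹ function of t and a factor of
  -- modulus 1. After the exchange the scalar chain rule applies at each fixed x.
  have hprod : ∀ k, Integrable (fun p : Space n × ℝ => inner ℂ (h p.1) (fm k p.1) * ((e k p.2 : ℂ)
      * (Complex.I * Complex.exp (Complex.I * θ p.2 p.1)))) (volume.prod μ) := by
    intro k
    have h1 : Integrable (fun x => inner ℂ (h x) (fm k x)) volume := L2.integrable_inner h (fm k)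
    have h2 : Integrable (fun t => (e k t : ℂ)) μ := by
      have := intervalIntegrable_iff.1 (intervalIntegrable_of_locallyIntegrable (he k) t₀ t₁)
      exact Integrable.ofReal this
    have h3 := h1.mul_prod h2
    have h4 := h3.bdd_mul (c := 1) (f := fun p : Space n × ℝ => Complex.I * Complex.exp (Complex.I * θ p.2 p.1))
      ((by
        have : Continuous fun p : Space n × ℝ => θ p.2 p.1 := hθc.comp continuous_swap
        have : Continuous fun p : Space n × ℝ => Complex.I * Complex.exp (Complex.I * θ p.2 p.1) := by
          fun_prop
        exact this.aestronglyMeasurable)) (Eventually.of_forall fun p => by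
          rw [norm_mul, Complex.norm_I, one_mul, mul_comm, Complex.norm_exp_ofReal_mul_I])
    refine h4.congr (Eventually.of_forall fun p => ?_)
    simp only; ring
  have hk : ∀ k, (∫ t in t₀..t₁, (e k t : ℂ) * inner ℂ h (phase (θ t) (Complex.I • fm k)))
      = ∫ x, ∫ t in t₀..t₁, inner ℂ (h x) (fm k x) * ((e k t : ℂ)
      * (Complex.I * Complex.exp (Complex.I * θ t x))) := by
    intro k
    have sw := integral_integral_swap (f := fun (x : Space n) (t : ℝ) => inner ℂ (h x) (fm k x)
      * ((e k t : ℂ) * (Complex.I * Complex.exp (Complex.I * θ t x)))) (hprod k)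
    simp only [intervalIntegral.intervalIntegral_eq_integral_uIoc, ← hμ]
    rw [integral_smul, sw]
    congr 1
    refine integral_congr_ae (Eventually.of_forall fun t => ?_)
    simp only
    rw [L2.inner_def, ← integral_const_mul]
    apply integral_congr_ae
    filter_upwards [phase_coeFn (θ t) (Complex.I • fm k), Lp.coeFn_smul Complex.I (fm k)] with x h1 h2
    rw [h1, h2, Pi.smul_apply]
    simp only [RCLike.inner_apply, smul_eq_mul]
    ring
  rw [intervalIntegral.integral_finsetSum (fun k _ => by
    have := intervalIntegrable_sum_mul (ι := Unit) (e := fun _ => e k) (fun _ => he k)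
      (A := fun _ t => inner ℂ h (phase (θ t) (Complex.I • fm k))) (fun _ => hcont _) t₀ t₁
    simpa using this)]
  simp_rw [hk]
  rw [← integral_finsetSum Finset.univ (fun k _ => by
    have := (hprod k).integral_prod_left
    simp only [intervalIntegral.intervalIntegral_eq_integral_uIoc, ← hμ]
    exact this.smul (if t₀ ≤ t₁ then (1 : ℝ) else -1)), L2.inner_def, L2.inner_def,
    ← integral_sub (L2.integrable_inner h _) (L2.integrable_inner h _)]
  apply integral_congr_ae
  filter_upwards [phase_coeFn (θ t₁) f, phase_coeFn (θ t₀) f, ae_all_iff.2 hfm] with x h1 h2 h3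
  rw [← intervalIntegral.integral_finsetSum (fun k _ => by
    have := intervalIntegrable_sum_mul (ι := Unit) (e := fun _ => e k) (fun _ => he k)
      (A := fun _ t => inner ℂ (h x) (fm k x) * (Complex.I * Complex.exp (Complex.I * θ t x)))
      (fun _ => by have := hθt x; fun_prop) t₀ t₁
    simp only [Finset.univ_unique, Finset.sum_const, Finset.card_singleton, one_smul] at this
    refine this.congr fun t _ => ?_
    ring)]
  have h4 := exp_I_mul_sub_eq_integral (hloc x) (hθ x) t₀ t₁
  have h5 : inner ℂ (h x) (phase (θ t₁) f x) - inner ℂ (h x) (phase (θ t₀) f x)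
      = inner ℂ (h x) (f x)
        * (Complex.exp (Complex.I * θ t₁ x) - Complex.exp (Complex.I * θ t₀ x)) := by
    rw [h1, h2]; simp only [RCLike.inner_apply]; ring
  rw [h5, h4, ← intervalIntegral.integral_const_mul]
  congr 1; ext t
  push_cast
  rw [Finset.sum_mul, Finset.mul_sum]
  refine Finset.sum_congr rfl fun k _ => ?_
  rw [h3 k]
  simp only [RCLike.inner_apply]; ring

end PhaseDerivative

/-! ### Position, momentum, modulations and quadratic Fourier phases. -/

section SchwartzOperators

variable {n : ℕ}

/-- The embedding of the Schwartz functions into `L²`. -/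
def toL2 : 𝓢(Space n, ℂ) →L[ℂ] L2 n := SchwartzMap.toLpCLM ℂ ℂ 2 volume

theorem toL2_apply (f : 𝓢(Space n, ℂ)) : toL2 f = f.toLp 2 volume := rfl

theorem toL2_coeFn (f : 𝓢(Space n, ℂ)) : toL2 f =ᵐ[volume] f := SchwartzMap.coeFn_toLp f 2 volume

theorem denseRange_toL2 : DenseRange (toL2 : 𝓢(Space n, ℂ) → L2 n) := dense_range_toLp

theorem fourier_toL2 (f : 𝓢(Space n, ℂ)) : 𝓕 (toL2 f) = toL2 (𝓕 f) := SchwartzMap.toLp_fourier_eq f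

/-- Multiplication by the linear function `⟪v, x⟫`. -/
def coordMul (v : Space n) : 𝓢(Space n, ℂ) →L[ℂ] 𝓢(Space n, ℂ) :=
  SchwartzMap.smulLeftCLM ℂ fun x => ((inner ℝ x v : ℝ) : ℂ)

theorem coordMul_apply (v : Space n) (f : 𝓢(Space n, ℂ)) (x : Space n) :
    coordMul v f x = ((inner ℝ x v : ℝ) : ℂ) * f x := by
  have : (fun x : Space n => ((inner ℝ x v : ℝ) : ℂ)).HasTemperateGrowth :=
    Function.HasTemperateGrowth.comp Function.Complex.hasTemperateGrowth_ofReal (by fun_prop)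
  rw [coordMul, SchwartzMap.smulLeftCLM_apply_apply this]; simp

/-- The momentum operator `-i ∂_v`. -/
def momentum (v : Space n) (f : 𝓢(Space n, ℂ)) : 𝓢(Space n, ℂ) := (-Complex.I) • ∂_{v} f

/-- The function `x ↦ ⟪b, x⟫`. -/
def linPhase (b : Space n) : C(Space n, ℝ) := ⟨fun x => inner ℝ b x, by fun_prop⟩

@[simp] theorem linPhase_apply (b x : Space n) : linPhase b x = inner ℝ b x := rfl

theorem linPhase_hasTemperateGrowth (b : Space n) : (linPhase b : Space n → ℝ).HasTemperateGrowth := by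
  have : (fun x : Space n => inner ℝ b x).HasTemperateGrowth := by fun_prop
  exact this

theorem linPhase_add (b b' : Space n) : linPhase (b + b') = linPhase b + linPhase b' := by
  ext x; simp [inner_add_left]

theorem linPhase_neg (b : Space n) : linPhase (-b) = -linPhase b := by
  ext x; simp

/-- The symbol of `-(½ t p² + c·p + a)`, as a function of the frequency `ξ = p / 2π`. -/
def quadPhase (t : ℝ) (c : Space n) (a : ℝ) : C(Space n, ℝ) :=
  ⟨fun ξ => -(2 * Real.pi ^ 2 * t * ‖ξ‖ ^ 2 + 2 * Real.pi * inner ℝ c ξ + a), by fun_prop⟩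

theorem quadPhase_apply (t : ℝ) (c : Space n) (a : ℝ) (ξ : Space n) :
    quadPhase t c a ξ = -(2 * Real.pi ^ 2 * t * ‖ξ‖ ^ 2 + 2 * Real.pi * inner ℝ c ξ + a) := rfl

theorem quadPhase_hasTemperateGrowth (t : ℝ) (c : Space n) (a : ℝ) :
    (quadPhase t c a : Space n → ℝ).HasTemperateGrowth := by
  have h := Function.hasTemperateGrowth_norm_sq (Space n)
  have : (fun ξ : Space n => -(2 * Real.pi ^ 2 * t * ‖ξ‖ ^ 2 + 2 * Real.pi * inner ℝ c ξ + a)).HasTemperateGrowth := by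
    fun_prop
  exact this

theorem quadPhase_add (t t' : ℝ) (c c' : Space n) (a a' : ℝ) :
    quadPhase (t + t') (c + c') (a + a') = quadPhase t c a + quadPhase t' c' a' := by
  ext ξ; simp [quadPhase_apply, inner_add_left]; ring

theorem quadPhase_neg (t : ℝ) (c : Space n) (a : ℝ) :
    quadPhase (-t) (-c) (-a) = -quadPhase t c a := by
  ext ξ; simp [quadPhase_apply]; ring

theorem hasFDerivAt_phaseFun_quadPhase (t : ℝ) (c : Space n) (a : ℝ) (ξ v : Space n) :
    fderiv ℝ (fun ξ => Complex.exp (Complex.I * quadPhase t c a ξ)) ξ v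
      = -Complex.I * ((4 * Real.pi ^ 2 * t * inner ℝ ξ v + 2 * Real.pi * inner ℝ v c : ℝ) : ℂ)
        * Complex.exp (Complex.I * quadPhase t c a ξ) := by
  have h1 : HasFDerivAt (fun ξ => (quadPhase t c a ξ : ℝ))
      (-((2 * Real.pi ^ 2 * t) • (2 • innerSL ℝ ξ) + (2 * Real.pi) • innerSL ℝ c)) ξ := by
    have h2 := (hasStrictFDerivAt_norm_sq ξ).hasFDerivAt.const_mul (2 * Real.pi ^ 2 * t)
    have h3 := ((innerSL ℝ c).hasFDerivAt (x := ξ)).const_mul (2 * Real.pi)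
    exact ((h2.add h3).add_const a).neg
  have h4 := ((Complex.ofRealCLM.hasFDerivAt.comp ξ h1).const_mul Complex.I).cexp
  have h5 := h4.fderiv
  simp only [Function.comp_def, Complex.ofRealCLM_apply] at h5
  rw [h5]
  simp [real_inner_comm c v]
  ring

/-- This is the Heisenberg evolution x ↦ x + t p + c of the position. On the Fourier side position
is (i/2π) times a derivative, and differentiating the quadratic phase produces the terms t p and c.
-/
theorem coordMul_schwartzMultiplier (t : ℝ) (c : Space n) (a : ℝ) (v : Space n)
    (f : 𝓢(Space n, ℂ)) :
    coordMul v (schwartzMultiplier (quadPhase t c a) f)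
      = schwartzMultiplier (quadPhase t c a)
        (coordMul v f + (t : ℂ) • momentum v f + ((inner ℝ v c : ℝ) : ℂ) • f) := by
  have hF : ∀ g : 𝓢(Space n, ℂ), 𝓕 (coordMul v g) = (Complex.I / (2 * Real.pi)) • ∂_{v} (𝓕 g) := by
    intro g
    have h1 := SchwartzMap.lineDerivOp_fourier_eq g v
    have h2 : SchwartzMap.smulLeftCLM ℂ (fun x : Space n => (inner ℝ x v : ℝ)) g = coordMul v g := by
      ext x
      rw [SchwartzMap.smulLeftCLM_apply_apply (by fun_prop), coordMul_apply]
      simp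
    rw [h2] at h1
    rw [h1, ← FourierTransform.fourier_smul, smul_smul]
    have : Complex.I / (2 * Real.pi) * -(2 * Real.pi * Complex.I) = 1 := by
      have : (Real.pi : ℂ) ≠ 0 := by exact_mod_cast Real.pi_ne_zero
      field_simp
      rw [Complex.I_sq]; norm_num
    rw [this, one_smul]
  have hinj : ∀ g g' : 𝓢(Space n, ℂ), 𝓕 g = 𝓕 g' → g = g' := fun g g' h => by
    have h1 : 𝓕⁻ (𝓕 g : 𝓢(Space n, ℂ)) = g := FourierTransform.fourierInv_fourier_eq g
    rw [← h1, h]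
    exact FourierTransform.fourierInv_fourier_eq g'
  apply hinj
  have hθ := quadPhase_hasTemperateGrowth t c a
  rw [hF, fourier_schwartzMultiplier, fourier_schwartzMultiplier, FourierTransform.fourier_add,
    FourierTransform.fourier_add, FourierTransform.fourier_smul, FourierTransform.fourier_smul, hF,
    momentum, FourierTransform.fourier_smul, SchwartzMap.fourier_lineDerivOp_eq]
  generalize (𝓕 f : 𝓢(Space n, ℂ)) = f
  ext ξ
  have hs : SchwartzMap.smulLeftCLM ℂ (fun x : Space n => (inner ℝ x v : ℝ)) f
      = coordMul v f := by
    ext x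
    rw [SchwartzMap.smulLeftCLM_apply_apply (by fun_prop), coordMul_apply]
    simp
  rw [hs, schwartzPhase_apply hθ]
  simp only [_root_.smul_apply, _root_.add_apply, smul_eq_mul, coordMul_apply,
    SchwartzMap.lineDerivOp_apply_eq_fderiv]
  have h1 : (fun ξ => schwartzPhase (quadPhase t c a) f ξ)
      = fun ξ => Complex.exp (Complex.I * quadPhase t c a ξ) * f ξ := by
    ext ξ; rw [schwartzPhase_apply hθ]
  have h2 : fderiv ℝ (fun ξ => schwartzPhase (quadPhase t c a) f ξ) ξ v
      = Complex.exp (Complex.I * quadPhase t c a ξ) * fderiv ℝ f ξ v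
        + (-Complex.I * ((4 * Real.pi ^ 2 * t * inner ℝ ξ v + 2 * Real.pi * inner ℝ v c : ℝ) : ℂ)
        * Complex.exp (Complex.I * quadPhase t c a ξ)) * f ξ := by
    rw [h1, fderiv_fun_mul]
    · simp only [_root_.add_apply, _root_.smul_apply, smul_eq_mul]
      rw [hasFDerivAt_phaseFun_quadPhase]; ring
    · have := (hasTemperateGrowth_phaseFun hθ).1.differentiable (by simp)
      exact this.differentiableAt
    · exact f.differentiableAt
  have h2' : fderiv ℝ (⇑(schwartzPhase (quadPhase t c a) f)) ξ v = _ := h2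
  rw [h2']
  have : (Real.pi : ℂ) ≠ 0 := by exact_mod_cast Real.pi_ne_zero
  push_cast
  field_simp
  ring_nf
  simp only [Complex.I_sq]
  ring

theorem lineDeriv_schwartzMultiplier (θ : C(Space n, ℝ)) (hθ : (θ : Space n → ℝ).HasTemperateGrowth)
    (v : Space n) (f : 𝓢(Space n, ℂ)) :
    ∂_{v} (schwartzMultiplier θ f) = schwartzMultiplier θ (∂_{v} f) := by
  have h : ∀ g : 𝓢(Space n, ℂ), SchwartzMap.fourierMultiplierCLM ℂ (fun x : Space n => (inner ℝ x v : ℝ)) g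
      = SchwartzMap.fourierMultiplierCLM ℂ (fun x : Space n => ((inner ℝ x v : ℝ) : ℂ)) g := fun g =>
    (SchwartzMap.fourierMultiplierCLM_ofReal ℂ (by fun_prop) g).symm
  have hg : (fun x : Space n => ((inner ℝ x v : ℝ) : ℂ)).HasTemperateGrowth :=
    Function.HasTemperateGrowth.comp Function.Complex.hasTemperateGrowth_ofReal (by fun_prop)
  rw [SchwartzMap.lineDeriv_eq_fourierMultiplierCLM, SchwartzMap.lineDeriv_eq_fourierMultiplierCLM,
    h, h, schwartzMultiplier, map_smul,
    SchwartzMap.fourierMultiplierCLM_fourierMultiplierCLM_apply hg (hasTemperateGrowth_phaseFun hθ),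
    SchwartzMap.fourierMultiplierCLM_fourierMultiplierCLM_apply (hasTemperateGrowth_phaseFun hθ) hg,
    mul_comm (phaseFun θ : Space n → ℂ)]

theorem lineDeriv_schwartzPhase_linPhase (b v : Space n) (f : 𝓢(Space n, ℂ)) :
    ∂_{v} (schwartzPhase (linPhase b) f)
      = schwartzPhase (linPhase b) (∂_{v} f + (Complex.I * (inner ℝ b v : ℝ)) • f) := by
  have hθ := linPhase_hasTemperateGrowth b
  ext x
  rw [schwartzPhase_apply hθ, SchwartzMap.lineDerivOp_apply_eq_fderiv]
  have h1 : (⇑(schwartzPhase (linPhase b) f) : Space n → ℂ)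
      = fun x => Complex.exp (Complex.I * (inner ℝ b x : ℝ)) * f x := by
    ext x; rw [schwartzPhase_apply hθ]; rfl
  have h3 : HasFDerivAt (fun x : Space n => Complex.exp (Complex.I * (inner ℝ b x : ℝ)))
      (Complex.exp (Complex.I * (inner ℝ b x : ℝ)) • Complex.I • Complex.ofRealCLM.comp (innerSL ℝ b)) x :=
    ((Complex.ofRealCLM.hasFDerivAt.comp x ((innerSL ℝ b).hasFDerivAt (x := x))).const_mul
      Complex.I).cexp
  rw [h1, (h3.fun_mul f.differentiableAt.hasFDerivAt).fderiv]
  simp [SchwartzMap.lineDerivOp_apply_eq_fderiv]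
  ring

theorem coordMul_schwartzPhase (θ : C(Space n, ℝ)) (hθ : (θ : Space n → ℝ).HasTemperateGrowth)
    (v : Space n) (f : 𝓢(Space n, ℂ)) :
    coordMul v (schwartzPhase θ f) = schwartzPhase θ (coordMul v f) := by
  ext x
  rw [coordMul_apply, schwartzPhase_apply hθ, schwartzPhase_apply hθ, coordMul_apply]
  ring

/-- A modulation acts on the Fourier side as a translation. -/
theorem fourier_schwartzPhase_linPhase (b : Space n) (f : 𝓢(Space n, ℂ)) (ξ : Space n) :
    𝓕 (schwartzPhase (linPhase b) f) ξ = 𝓕 f (ξ - (2 * Real.pi)⁻¹ • b) := by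
  rw [SchwartzMap.fourier_coe, SchwartzMap.fourier_coe, Real.fourier_eq', Real.fourier_eq']
  congr 1; ext x
  rw [schwartzPhase_apply (linPhase_hasTemperateGrowth b), smul_eq_mul, smul_eq_mul, ← mul_assoc,
    ← Complex.exp_add]
  congr 2
  rw [inner_sub_right, inner_smul_right, linPhase_apply, real_inner_comm x b]
  push_cast
  have : (Real.pi : ℂ) ≠ 0 := by exact_mod_cast Real.pi_ne_zero
  field_simp
  ring

theorem fourier_laplacian (f : 𝓢(Space n, ℂ)) (ξ : Space n) :
    𝓕 (Δ f) ξ = -((2 * Real.pi) ^ 2 * ‖ξ‖ ^ 2 : ℝ) * 𝓕 f ξ := by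
  have hg : (fun x : Space n => ‖x‖ ^ 2).HasTemperateGrowth :=
    Function.hasTemperateGrowth_norm_sq (Space n)
  rw [SchwartzMap.laplacian_eq_fourierMultiplierCLM, FourierTransform.fourier_smul,
    SchwartzMap.fourierMultiplierCLM_apply, FourierTransform.fourier_fourierInv_eq]
  rw [_root_.smul_apply]
  have : SchwartzMap.smulLeftCLM ℂ (‖·‖ ^ 2 : Space n → ℝ) (𝓕 f) ξ = ‖ξ‖ ^ 2 • 𝓕 f ξ :=
    SchwartzMap.smulLeftCLM_apply_apply hg (𝓕 f) ξ
  rw [this]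
  simp; ring

end SchwartzOperators

attribute [irreducible] toL2 coordMul

/-! ### The explicit free motion in the field and its weak derivative. -/

section Frame

variable {n : ℕ}

/-- The momentum `∫₀ᵗ E` gained from the field. -/
def drift (E : ℝ → Space n) (t : ℝ) : Space n := ∫ τ in (0 : ℝ)..t, E τ

/-- The displacement caused by the field. -/
def displacement (E : ℝ → Space n) (t : ℝ) : Space n := ∫ τ in (0 : ℝ)..t, drift E τ

/-- The action accumulated in the field. -/
def action (E : ℝ → Space n) (t : ℝ) : ℝ := ∫ τ in (0 : ℝ)..t, ‖drift E τ‖ ^ 2 / 2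

theorem drift_sub {E : ℝ → Space n} (hE : LocallyIntegrable E volume) (s t : ℝ) :
    drift E t - drift E s = ∫ τ in s..t, E τ :=
  intervalIntegral.integral_interval_sub_left (intervalIntegrable_of_locallyIntegrable hE _ _)
    (intervalIntegrable_of_locallyIntegrable hE _ _)

theorem continuous_drift {E : ℝ → Space n} (hE : LocallyIntegrable E volume) :
    Continuous (drift E) :=
  intervalIntegral.continuous_primitive (intervalIntegrable_of_locallyIntegrable hE) 0

theorem displacement_sub {E : ℝ → Space n} (hE : LocallyIntegrable E volume) (s t : ℝ) :
    displacement E t - displacement E s = ∫ τ in s..t, drift E τ :=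
  intervalIntegral.integral_interval_sub_left ((continuous_drift hE).intervalIntegrable _ _)
    ((continuous_drift hE).intervalIntegrable _ _)

theorem continuous_displacement {E : ℝ → Space n} (hE : LocallyIntegrable E volume) :
    Continuous (displacement E) :=
  intervalIntegral.continuous_primitive (fun a b => (continuous_drift hE).intervalIntegrable a b) 0

theorem action_sub {E : ℝ → Space n} (hE : LocallyIntegrable E volume) (s t : ℝ) :
    action E t - action E s = ∫ τ in s..t, ‖drift E τ‖ ^ 2 / 2 :=
  have h : Continuous fun τ => ‖drift E τ‖ ^ 2 / 2 := ((continuous_drift hE).norm.pow 2).div_const 2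
  intervalIntegral.integral_interval_sub_left (h.intervalIntegrable _ _) (h.intervalIntegrable _ _)

theorem continuous_action {E : ℝ → Space n} (hE : LocallyIntegrable E volume) :
    Continuous (action E) :=
  have h : Continuous fun τ => ‖drift E τ‖ ^ 2 / 2 := ((continuous_drift hE).norm.pow 2).div_const 2
  intervalIntegral.continuous_primitive (fun a b => h.intervalIntegrable a b) 0

/-- The phase of the free motion in the field, as a function of the frequency. -/
def framePhase (E : ℝ → Space n) (t : ℝ) : C(Space n, ℝ) :=
  quadPhase t (displacement E t) (action E t)

theorem framePhase_hasTemperateGrowth (E : ℝ → Space n) (t : ℝ) :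
    (framePhase E t : Space n → ℝ).HasTemperateGrowth := quadPhase_hasTemperateGrowth _ _ _

theorem continuous_framePhase {E : ℝ → Space n} (hE : LocallyIntegrable E volume) :
    Continuous fun p : ℝ × Space n => framePhase E p.1 p.2 := by
  have h1 := (continuous_displacement hE).comp (continuous_fst (X := ℝ) (Y := Space n))
  have h2 := (continuous_action hE).comp (continuous_fst (X := ℝ) (Y := Space n))
  simp only [framePhase, quadPhase_apply]
  simp only [Function.comp_def] at h1 h2
  fun_prop

/-- The free evolution in the field, from time `0` to time `t` (Avron–Herbst formula). -/
def frame (E : ℝ → Space n) (t : ℝ) : L2 n ≃ₗᵢ[ℂ] L2 n :=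
  (multiplier (framePhase E t)).trans (phase (linPhase (drift E t)))

theorem frame_apply (E : ℝ → Space n) (t : ℝ) (f : L2 n) :
    frame E t f = phase (linPhase (drift E t)) (multiplier (framePhase E t) f) := rfl

/-- The free evolution in the field on Schwartz functions. -/
def schwartzFrame (E : ℝ → Space n) (t : ℝ) (f : 𝓢(Space n, ℂ)) : 𝓢(Space n, ℂ) :=
  schwartzPhase (linPhase (drift E t)) (schwartzMultiplier (framePhase E t) f)

theorem toL2_schwartzFrame (E : ℝ → Space n) (t : ℝ) (f : 𝓢(Space n, ℂ)) :
    toL2 (schwartzFrame E t f) = frame E t (toL2 f) := by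
  rw [frame_apply, toL2_apply, schwartzFrame, toLp_schwartzPhase (linPhase_hasTemperateGrowth _),
    toLp_schwartzMultiplier (framePhase_hasTemperateGrowth _ _), ← toL2_apply]

theorem continuous_linPhase_drift {E : ℝ → Space n} (hE : LocallyIntegrable E volume) :
    Continuous fun p : ℝ × Space n => linPhase (drift E p.1) p.2 := by
  have h1 := (continuous_drift hE).comp (continuous_fst (X := ℝ) (Y := Space n))
  simp only [Function.comp_def] at h1
  simp only [linPhase_apply]
  fun_prop

theorem continuous_frame {E : ℝ → Space n} (hE : LocallyIntegrable E volume) {f : ℝ → L2 n}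
    (hf : Continuous f) : Continuous fun t => frame E t (f t) := by
  have h1 : ∀ x, Continuous fun t => linPhase (drift E t) x := fun x => by
    simp only [linPhase_apply]
    exact (continuous_drift hE).inner continuous_const
  have h2 : ∀ x, Continuous fun t => framePhase E t x := fun x =>
    Continuous.comp (g := fun p : ℝ × Space n => framePhase E p.1 p.2)
      (continuous_framePhase hE) (Continuous.prodMk_left x)
  have h2' : ∀ g : L2 n, Continuous fun t => multiplier (framePhase E t) g := fun g =>
    continuous_multiplier (θ := fun t => framePhase E t) h2 g
  have h3 : Continuous fun t => multiplier (framePhase E t) (f t) :=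
    continuous_isometry_apply h2' hf
  simp only [frame_apply]
  exact continuous_isometry_apply (A := fun t => phase (linPhase (drift E t)))
    (fun g => continuous_phase (θ := fun t => linPhase (drift E t)) h1 g) h3

theorem continuous_isometry_symm {T H : Type*} [TopologicalSpace T]
    [NormedAddCommGroup H] [NormedSpace ℂ H] {A : T → H ≃ₗᵢ[ℂ] H}
    (hA : ∀ f, Continuous fun t => A t f) (f : H) : Continuous fun t => (A t).symm f := by
  rw [continuous_iff_continuousAt]
  intro t₀
  rw [ContinuousAt, tendsto_iff_norm_sub_tendsto_zero]
  have h1 : ∀ t, ‖(A t).symm f - (A t₀).symm f‖ = ‖f - A t ((A t₀).symm f)‖ := fun t => by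
    rw [← (A t).norm_map, map_sub, LinearIsometryEquiv.apply_symm_apply]
  simp_rw [h1]
  have h2 := (((hA ((A t₀).symm f)).tendsto t₀).const_sub f).norm
  simpa using h2

theorem continuous_frame_symm {E : ℝ → Space n} (hE : LocallyIntegrable E volume) {f : ℝ → L2 n}
    (hf : Continuous f) : Continuous fun t => (frame E t).symm (f t) :=
  continuous_isometry_apply (A := fun t => (frame E t).symm)
    (continuous_isometry_symm fun _ => continuous_frame hE continuous_const) hf

/-- The densities in time of the free Hamiltonian. -/
def fieldCoeff (E : ℝ → Space n) : Option (Fin n) → ℝ → ℝ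
  | none, _ => 1
  | some j, t => E t j

/-- The coefficients of the free Hamiltonian. -/
def hamCoeff : Option (Fin n) → 𝓢(Space n, ℂ) →L[ℂ] 𝓢(Space n, ℂ)
  | none => (-(1 / 2 : ℂ)) • laplacianCLM ℂ (Space n) 𝓢(Space n, ℂ)
  | some j => -coordMul (EuclideanSpace.single j 1)

theorem hamCoeff_none (f : 𝓢(Space n, ℂ)) : hamCoeff none f = (-(1 / 2 : ℂ)) • Δ f := by
  simp only [hamCoeff, _root_.smul_apply]
  rw [SchwartzMap.laplacianCLM_eq]

theorem hamCoeff_some (j : Fin n) (f : 𝓢(Space n, ℂ)) :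
    hamCoeff (some j) f = -coordMul (EuclideanSpace.single j 1) f := rfl

theorem inner_single_one (x : Space n) (j : Fin n) :
    inner ℝ x (EuclideanSpace.single j (1 : ℝ)) = x j := by
  rw [real_inner_comm]; simp [EuclideanSpace.inner_single_left]

theorem locallyIntegrable_coord {E : ℝ → Space n} (hE : LocallyIntegrable E volume) (j : Fin n) :
    LocallyIntegrable (fun t => E t j) volume := fun x => by
  obtain ⟨s, hs, hi⟩ := hE x
  exact ⟨s, hs, (EuclideanSpace.proj (𝕜 := ℝ) j : Space n →L[ℝ] ℝ).integrable_comp hi⟩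

theorem locallyIntegrable_fieldCoeff {E : ℝ → Space n} (hE : LocallyIntegrable E volume)
    (k : Option (Fin n)) : LocallyIntegrable (fieldCoeff E k) volume := by
  cases k with
  | none => exact continuous_const.locallyIntegrable
  | some j => exact locallyIntegrable_coord hE j

theorem inner_eq_sum (x y : Space n) : (inner ℝ x y : ℝ) = ∑ j, x j * y j := by
  rw [PiLp.inner_apply]; exact Finset.sum_congr rfl fun j _ => by simp [mul_comm]

theorem intervalIntegral_coord {f : ℝ → Space n} {a b : ℝ} (hf : IntervalIntegrable f volume a b)
    (j : Fin n) : (∫ t in a..b, f t) j = ∫ t in a..b, f t j :=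
  ((EuclideanSpace.proj (𝕜 := ℝ) j : Space n →L[ℝ] ℝ).intervalIntegral_comp_comm hf).symm

theorem phase_neg_inner (θ : C(Space n, ℝ)) (f g : L2 n) :
    inner ℂ (phase (-θ) f) g = inner ℂ f (phase θ g) := by
  rw [← (phase θ).inner_map_map, phase_phase, add_neg_cancel, phase_zero]

theorem inner_fourier (f g : L2 n) : inner ℂ (𝓕 f) (𝓕 g) = (inner ℂ f g : ℂ) :=
  Lp.inner_fourier_eq f g

theorem inner_toL2 (f g : 𝓢(Space n, ℂ)) :
    inner ℂ (toL2 f) (toL2 g) = ∫ x, (starRingEnd ℂ) (f x) * g x := by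
  have := SchwartzMap.inner_toL2_toL2_eq f g volume
  rw [toL2_apply, toL2_apply, this]
  simp only [RCLike.inner_apply, mul_comm]

/-- Conjugated form of `inner_phase_sub_eq_integral`. -/
theorem inner_phase_left_sub_eq_integral {ι : Type*} [Fintype ι] {e : ι → ℝ → ℝ}
    (he : ∀ k, LocallyIntegrable (e k) volume)
    {m : ι → Space n → ℝ} {θ : ℝ → C(Space n, ℝ)}
    (hθc : Continuous fun p : ℝ × Space n => θ p.1 p.2)
    (hθ : ∀ x t₀ t₁, θ t₁ x - θ t₀ x = ∫ t in t₀..t₁, ∑ k, e k t * m k x)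
    (h f : L2 n) (fm : ι → L2 n) (hfm : ∀ k, fm k =ᵐ[volume] fun x => (m k x : ℂ) * f x)
    (t₀ t₁ : ℝ) :
    inner ℂ (phase (θ t₁) f) h - inner ℂ (phase (θ t₀) f) h
      = ∫ t in t₀..t₁, ∑ k, (e k t : ℂ) * inner ℂ (phase (θ t) (Complex.I • fm k)) h := by
  have H := congrArg (starRingEnd ℂ) (inner_phase_sub_eq_integral he hθc hθ h f fm hfm t₀ t₁)
  rw [map_sub, inner_conj_symm, inner_conj_symm] at H
  rw [H, intervalIntegral.intervalIntegral_eq_integral_uIoc,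
    intervalIntegral.intervalIntegral_eq_integral_uIoc]
  rw [Complex.real_smul, Complex.real_smul, map_mul, Complex.conj_ofReal, ← integral_conj]
  congr 2; ext t
  rw [map_sum]
  refine Finset.sum_congr rfl fun k _ => ?_
  rw [map_mul, inner_conj_symm, Complex.conj_ofReal]

/-- The symbol `-½ (p + b)²` acting on the Fourier transform of a Schwartz function. -/
def kineticSymbol (b : Space n) (g : 𝓢(Space n, ℂ)) : 𝓢(Space n, ℂ) :=
  (1 / 2 : ℂ) • 𝓕 (Δ g) + (-((‖b‖ ^ 2 / 2 : ℝ) : ℂ)) • 𝓕 g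
    + ∑ j, (-((2 * Real.pi * b j : ℝ) : ℂ)) • coordMul (EuclideanSpace.single j 1) (𝓕 g)

/-- Completing the square with p = 2πξ. The form centred at -b/2π is the one that a modulation by
e^{-ib·x} turns into the symbol of -½p². -/
theorem kineticSymbol_apply (b : Space n) (g : 𝓢(Space n, ℂ)) (ξ : Space n) :
    kineticSymbol b g ξ = -((1 / 2 * ((2 * Real.pi) ^ 2 * ‖ξ + (2 * Real.pi)⁻¹ • b‖ ^ 2) : ℝ) : ℂ)
      * 𝓕 g ξ := by
  have h1 : (∑ j, (-((2 * Real.pi * b j : ℝ) : ℂ)) • coordMul (EuclideanSpace.single j 1) (𝓕 g)) ξ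
      = -((2 * Real.pi * inner ℝ ξ b : ℝ) : ℂ) * 𝓕 g ξ := by
    rw [_root_.sum_apply, inner_eq_sum, Finset.mul_sum, Complex.ofReal_sum,
      ← Finset.sum_neg_distrib, Finset.sum_mul]
    refine Finset.sum_congr rfl fun j _ => ?_
    rw [_root_.smul_apply, coordMul_apply, inner_single_one, smul_eq_mul]
    push_cast; ring
  rw [kineticSymbol, _root_.add_apply, _root_.add_apply, h1, _root_.smul_apply, _root_.smul_apply,
    fourier_laplacian, norm_add_sq_real, norm_smul, inner_smul_right,
    Real.norm_of_nonneg (by positivity)]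
  have hpi : (Real.pi : ℂ) ≠ 0 := by exact_mod_cast Real.pi_ne_zero
  simp only [smul_eq_mul]
  push_cast
  field_simp
  ring

theorem continuous_toL2_kineticSymbol (g : 𝓢(Space n, ℂ)) :
    Continuous fun b : Space n => toL2 (kineticSymbol b g) := by
  simp only [kineticSymbol, map_add, map_sum, map_smul]
  fun_prop

/-- The frame phase has time derivative -½|2πξ + b(t)|². It is expanded into quadratic, constant and
linear terms in ξ so that each is a function of t times a function of ξ, as
`inner_phase_sub_eq_integral` requires. -/
theorem inner_multiplier_framePhase_sub {E : ℝ → Space n} (hE : LocallyIntegrable E volume)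
    (g : 𝓢(Space n, ℂ)) (h : L2 n) (t₀ t₁ : ℝ) :
    inner ℂ h (multiplier (framePhase E t₁) (toL2 g))
        - inner ℂ h (multiplier (framePhase E t₀) (toL2 g))
      = ∫ t in t₀..t₁, inner ℂ (𝓕 h)
          (phase (framePhase E t) (Complex.I • toL2 (kineticSymbol (drift E t) g))) := by
  have hb := continuous_drift hE
  have hbj : ∀ j, Continuous fun t => drift E t j := fun j =>
    (EuclideanSpace.proj (𝕜 := ℝ) j : Space n →L[ℝ] ℝ).continuous.comp hb
  let e' : Option (Option (Fin n)) → ℝ → ℝ := fun k t => match k with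
    | none => 1
    | some none => ‖drift E t‖ ^ 2 / 2
    | some (some j) => drift E t j
  let m' : Option (Option (Fin n)) → Space n → ℝ := fun k ξ => match k with
    | none => -(2 * Real.pi ^ 2 * ‖ξ‖ ^ 2)
    | some none => -1
    | some (some j) => -(2 * Real.pi * ξ j)
  have he'c : ∀ k, Continuous (e' k) := by
    rintro (_ | _ | j)
    · exact continuous_const
    · exact (hb.norm.pow 2).div_const 2
    · exact hbj j
  let fm' : Option (Option (Fin n)) → 𝓢(Space n, ℂ) := fun k => match k with
    | none => (1 / 2 : ℂ) • 𝓕 (Δ g)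
    | some none => -𝓕 g
    | some (some j) => -(2 * Real.pi : ℂ) • coordMul (EuclideanSpace.single j 1) (𝓕 g)
  have hfm'x : ∀ k x, fm' k x = (m' k x : ℂ) * 𝓕 g x := by
    rintro (_ | _ | j) x
    · simp only [fm', m', _root_.smul_apply, fourier_laplacian, smul_eq_mul]
      push_cast; ring
    · simp [fm', m']
    · simp only [fm', m', _root_.smul_apply, coordMul_apply, smul_eq_mul, inner_single_one]
      push_cast; ring
  have hfm' : ∀ k, toL2 (fm' k) =ᵐ[volume] fun x => (m' k x : ℂ) * toL2 (𝓕 g) x := fun k => by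
    filter_upwards [toL2_coeFn (fm' k), toL2_coeFn (𝓕 g)] with x h1 h2
    rw [h1, h2, hfm'x]
  have hθ' : ∀ x t₀ t₁, framePhase E t₁ x - framePhase E t₀ x
      = ∫ t in t₀..t₁, ∑ k, e' k t * m' k x := by
    intro x t₀ t₁
    have hi : ∀ k ∈ Finset.univ, IntervalIntegrable (fun t => e' k t * m' k x) volume t₀ t₁ :=
      fun k _ => ((he'c k).mul continuous_const).intervalIntegrable _ _
    rw [intervalIntegral.integral_finsetSum hi]
    simp only [intervalIntegral.integral_mul_const, Fintype.sum_option]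
    have hc : ∀ j, (∫ t in t₀..t₁, drift E t j)
        = displacement E t₁ j - displacement E t₀ j := fun j => by
      rw [← intervalIntegral_coord (hb.intervalIntegrable _ _), ← displacement_sub hE]; rfl
    simp only [e', m', ← action_sub hE, hc, intervalIntegral.integral_const, framePhase,
      quadPhase_apply, inner_eq_sum, smul_eq_mul, mul_one]
    simp only [sub_mul, Finset.sum_sub_distrib, Finset.mul_sum, mul_neg, Finset.sum_neg_distrib]
    have : ∀ t, ∑ j, displacement E t j * (2 * Real.pi * x j)
        = ∑ j, 2 * Real.pi * (displacement E t j * x j) := fun t =>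
      Finset.sum_congr rfl fun j _ => by ring
    rw [this, this]; ring
  have := inner_phase_sub_eq_integral (fun k => (he'c k).locallyIntegrable)
      (continuous_framePhase hE) hθ' (𝓕 h) (toL2 (𝓕 g)) (fun i => toL2 (fm' i)) hfm' t₀ t₁
  simp only [← inner_fourier h, fourier_multiplier, fourier_toL2]
  rw [this]
  congr 1; ext t
  have hk : kineticSymbol (drift E t) g = ∑ k, (e' k t : ℂ) • fm' k := by
    simp only [kineticSymbol, Fintype.sum_option, e', fm']
    rw [add_assoc]
    congr 1
    · simp
    congr 1
    · simp
    · refine Finset.sum_congr rfl fun j _ => ?_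
      rw [smul_smul]; congr 1; push_cast; ring
  rw [hk, map_sum, Finset.smul_sum, map_sum, inner_sum]
  refine Finset.sum_congr rfl fun k _ => ?_
  simp only [map_smul, inner_smul_right]
  ring

theorem inner_phase_neg_drift_sub {E : ℝ → Space n} (hE : LocallyIntegrable E volume)
    (f : 𝓢(Space n, ℂ)) (h : L2 n) (t₀ t₁ : ℝ) :
    inner ℂ (phase (linPhase (-drift E t₁)) (toL2 f)) h
        - inner ℂ (phase (linPhase (-drift E t₀)) (toL2 f)) h
      = ∫ t in t₀..t₁, ∑ j, ((E t j : ℝ) : ℂ) * inner ℂ (phase (linPhase (-drift E t))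
          (Complex.I • toL2 (hamCoeff (some j) f))) h := by
  have hθ : ∀ x t₀ t₁, linPhase (-drift E t₁) x - linPhase (-drift E t₀) x
      = ∫ t in t₀..t₁, ∑ j, E t j * -x j := by
    intro x t₀ t₁
    have hi : ∀ j ∈ Finset.univ, IntervalIntegrable (fun t => E t j * -x j) volume t₀ t₁ :=
      fun j _ => (intervalIntegrable_of_locallyIntegrable (locallyIntegrable_coord hE j) _ _).mul_const _
    rw [intervalIntegral.integral_finsetSum hi]
    simp only [intervalIntegral.integral_mul_const]
    have hc : ∀ j, (∫ t in t₀..t₁, E t j) = drift E t₁ j - drift E t₀ j := fun j => by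
      rw [← intervalIntegral_coord (intervalIntegrable_of_locallyIntegrable hE _ _),
        ← drift_sub hE]; rfl
    simp only [hc, linPhase_apply, inner_neg_left, inner_eq_sum]
    rw [neg_sub_neg, ← Finset.sum_sub_distrib]
    exact Finset.sum_congr rfl fun j _ => by ring
  have hθc : Continuous fun p : ℝ × Space n => linPhase (-drift E p.1) p.2 := by
    have := (continuous_linPhase_drift hE).neg
    simp only [linPhase_neg, ContinuousMap.neg_apply]
    exact this
  refine inner_phase_left_sub_eq_integral (locallyIntegrable_coord hE) hθc hθ _ _ 
    (fun j => toL2 (hamCoeff (some j) f)) (fun j => ?_) t₀ t₁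
  filter_upwards [toL2_coeFn (hamCoeff (some j) f), toL2_coeFn f] with x h1 h2
  rw [h1, h2, hamCoeff_some, _root_.neg_apply, coordMul_apply, inner_single_one]
  push_cast; ring

/-- Conjugation by e^{ib·x} turns ½(p + b)² into ½p²: on the Fourier side the modulation is a
translation by b/2π, so the two integrands coincide pointwise. -/
theorem inner_kineticSymbol (E : ℝ → Space n) (t : ℝ) (f g : 𝓢(Space n, ℂ)) :
    inner ℂ (𝓕 (phase (linPhase (-drift E t)) (toL2 f)))
        (phase (framePhase E t) (Complex.I • toL2 (kineticSymbol (drift E t) g)))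
      = -Complex.I * inner ℂ (toL2 (hamCoeff none f)) (frame E t (toL2 g)) := by
  have hS : ∀ u : 𝓢(Space n, ℂ), 𝓕 (phase (linPhase (-drift E t)) (toL2 u))
      = toL2 (𝓕 (schwartzPhase (linPhase (-drift E t)) u)) := fun u => by
    rw [← fourier_toL2, toL2_apply, toL2_apply,
      toLp_schwartzPhase (linPhase_hasTemperateGrowth _)]
  have hP : ∀ u : 𝓢(Space n, ℂ), phase (framePhase E t) (toL2 u)
      = toL2 (schwartzPhase (framePhase E t) u) := fun u => by
    rw [toL2_apply, toL2_apply, toLp_schwartzPhase (framePhase_hasTemperateGrowth _ _)]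
  rw [frame_apply, ← phase_neg_inner (linPhase (drift E t)), ← linPhase_neg,
    ← inner_fourier (phase (linPhase (-drift E t)) (toL2 (hamCoeff none f))),
    fourier_multiplier, hS, hS, fourier_toL2, ← map_smul, hP, hP, inner_toL2, inner_toL2,
    ← integral_const_mul]
  congr 1; ext ξ
  rw [schwartzPhase_apply (framePhase_hasTemperateGrowth _ _),
    schwartzPhase_apply (framePhase_hasTemperateGrowth _ _), _root_.smul_apply,
    kineticSymbol_apply, fourier_schwartzPhase_linPhase, fourier_schwartzPhase_linPhase,
    hamCoeff_none, FourierTransform.fourier_smul, _root_.smul_apply, fourier_laplacian,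
    smul_neg, sub_neg_eq_add]
  simp only [smul_eq_mul, map_mul, map_neg, map_div₀, map_one, map_ofNat, Complex.conj_ofReal]
  push_cast
  ring

/-- The weak derivative of the free evolution between Schwartz functions. -/
theorem inner_schwartz_frame_sub {E : ℝ → Space n} (hE : LocallyIntegrable E volume)
    (f g : 𝓢(Space n, ℂ)) (t₀ t₁ : ℝ) :
    inner ℂ (toL2 f) (frame E t₁ (toL2 g)) - inner ℂ (toL2 f) (frame E t₀ (toL2 g))
      = ∫ t in t₀..t₁, ∑ k, (fieldCoeff E k t : ℂ) *
        (-Complex.I * inner ℂ (toL2 (hamCoeff k f)) (frame E t (toL2 g))) := by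
  have h1 : ∀ x, Continuous fun t => linPhase (-drift E t) x := fun x => by
    simp only [linPhase_apply]
    exact (continuous_drift hE).neg.inner continuous_const
  have h2 : ∀ x, Continuous fun t => framePhase E t x := fun x =>
    Continuous.comp (g := fun p : ℝ × Space n => framePhase E p.1 p.2)
      (continuous_framePhase hE) (Continuous.prodMk_left x)
  have hMc : ∀ u : L2 n, Continuous fun p : ℝ × ℝ => phase (linPhase (-drift E p.1)) u := fun u =>
    (continuous_phase (θ := fun t => linPhase (-drift E t)) h1 u).comp continuous_fst
  have hGc : ∀ u : L2 n, Continuous fun p : ℝ × ℝ => multiplier (framePhase E p.2) u := fun u =>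
    (continuous_multiplier (θ := fun t => framePhase E t) h2 u).comp continuous_snd
  have hFc : Continuous (𝓕 : L2 n → L2 n) := (Lp.fourierTransformₗᵢ (Space n) ℂ).continuous
  have hPc : Continuous fun p : ℝ × ℝ => phase (framePhase E p.2)
      (Complex.I • toL2 (kineticSymbol (drift E p.2) g)) :=
    (continuous_isometry_apply (A := fun t => phase (framePhase E t))
      (fun u => continuous_phase (θ := fun t => framePhase E t) h2 u)
      (((continuous_toL2_kineticSymbol g).comp (continuous_drift hE)).const_smul Complex.I)).comp
        continuous_snd
  let A : Option (Fin n) → ℝ → ℝ → ℂ := fun k t τ => match k with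
    | none => inner ℂ (𝓕 (phase (linPhase (-drift E t)) (toL2 f)))
        (phase (framePhase E τ) (Complex.I • toL2 (kineticSymbol (drift E τ) g)))
    | some _ => 0
  let B : Option (Fin n) → ℝ → ℝ → ℂ := fun k t τ => match k with
    | none => 0
    | some j => inner ℂ (phase (linPhase (-drift E t)) (Complex.I • toL2 (hamCoeff (some j) f)))
        (multiplier (framePhase E τ) (toL2 g))
  -- The modulation, moved to the test function, carries the time t and the multiplier carries τ.
  -- Each is absolutely continuous in its own variable, with density E in the first case and a
  -- continuous one in the second; on the diagonal they recombine into the frame.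
  have key := diagonal_integral (locallyIntegrable_fieldCoeff hE)
    (F := fun t τ => inner ℂ (phase (linPhase (-drift E t)) (toL2 f))
      (multiplier (framePhase E τ) (toL2 g))) (A := A) (B := B) ?_ ?_ ?_ ?_ t₀ t₁
  · simp only [linPhase_neg, phase_neg_inner, ← frame_apply] at key
    rw [key]
    congr 1; ext t
    refine Finset.sum_congr rfl fun k _ => ?_
    congr 1
    rcases k with _ | j
    · simp only [A, B, add_zero]
      exact inner_kineticSymbol E t f g
    · simp only [A, B, zero_add]
      rw [linPhase_neg, phase_neg_inner, ← frame_apply, inner_smul_left, Complex.conj_I]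
  · rintro (_ | j)
    · exact (hFc.comp (hMc _)).inner hPc
    · exact continuous_const
  · rintro (_ | j)
    · exact continuous_const
    · exact (hMc _).inner (hGc _)
  · intro t τ₀ τ₁
    rw [inner_multiplier_framePhase_sub hE]
    congr 1; ext τ
    simp [Fintype.sum_option, A, fieldCoeff]
  · intro τ t₀ t₁
    rw [inner_phase_neg_drift_sub hE]
    congr 1; ext t
    simp only [Fintype.sum_option, B, fieldCoeff]
    simp

end Frame

/-! ### Strong derivatives of the free motion and of its inverse. -/

section FrameDerivative

variable {n : ℕ}

theorem eq_of_inner_toL2 {x y : L2 n} (h : ∀ f, inner ℂ (toL2 f) x = (inner ℂ (toL2 f) y : ℂ)) :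
    x = y := by
  refine ext_inner_left ℂ fun v => ?_
  have := denseRange_toL2.equalizer (g := fun v : L2 n => (inner ℂ v x : ℂ))
    (h := fun v : L2 n => (inner ℂ v y : ℂ)) (by fun_prop) (by fun_prop) (by ext f; exact h f)
  exact congrFun this v

theorem intervalIntegrable_sum_smul {H : Type*} [NormedAddCommGroup H] [NormedSpace ℂ H]
    {ι : Type*} [Fintype ι] {e : ι → ℝ → ℝ}
    (he : ∀ k, LocallyIntegrable (e k) volume) {A : ι → ℝ → H} (hA : ∀ k, Continuous (A k))
    (a b : ℝ) : IntervalIntegrable (fun t => ∑ k, (e k t : ℂ) • A k t) volume a b := by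
  have : ∀ k, IntervalIntegrable (fun t => (e k t : ℂ) • A k t) volume a b := fun k => by
    have h1 : IntervalIntegrable (fun t => (e k t : ℂ)) volume a b :=
      ⟨(intervalIntegrable_of_locallyIntegrable (he k) a b).1.ofReal,
        (intervalIntegrable_of_locallyIntegrable (he k) a b).2.ofReal⟩
    exact h1.smul_continuousOn (hA k).continuousOn
  have := IntervalIntegrable.sum (Finset.univ) (f := fun k t => (e k t : ℂ) • A k t)
    (fun k _ => this k)
  simpa [Finset.sum_fn] using this

theorem inner_intervalIntegral {f : ℝ → L2 n} {a b : ℝ} (hf : IntervalIntegrable f volume a b)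
    (u : L2 n) :
    inner ℂ u (∫ t in a..b, f t) = ∫ t in a..b, (inner ℂ u (f t) : ℂ) :=
  ((innerSL ℂ u).intervalIntegral_comp_comm hf).symm

theorem hamCoeff_symmetric (k : Option (Fin n)) (f g : 𝓢(Space n, ℂ)) :
    inner ℂ (toL2 (hamCoeff k f)) (toL2 g) = (inner ℂ (toL2 f) (toL2 (hamCoeff k g)) : ℂ) := by
  rcases k with _ | j
  · rw [← inner_fourier, ← inner_fourier (toL2 f), fourier_toL2, fourier_toL2, fourier_toL2,
      fourier_toL2, inner_toL2, inner_toL2]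
    congr 1; ext ξ
    rw [hamCoeff_none, hamCoeff_none, FourierTransform.fourier_smul, FourierTransform.fourier_smul,
      _root_.smul_apply, _root_.smul_apply, fourier_laplacian, fourier_laplacian]
    simp only [smul_eq_mul, map_mul, map_neg, map_div₀, map_one, map_ofNat, Complex.conj_ofReal]
    ring
  · rw [inner_toL2, inner_toL2]
    congr 1; ext x
    simp only [hamCoeff_some, _root_.neg_apply, coordMul_apply, map_mul, map_neg,
      Complex.conj_ofReal]
    ring

theorem lineDeriv_schwartzFrame (E : ℝ → Space n) (t : ℝ) (v : Space n) (f : 𝓢(Space n, ℂ)) :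
    ∂_{v} (schwartzFrame E t f) = schwartzFrame E t (∂_{v} f)
      + (Complex.I * (inner ℝ (drift E t) v : ℝ)) • schwartzFrame E t f := by
  rw [schwartzFrame, lineDeriv_schwartzPhase_linPhase, map_add, map_smul,
    lineDeriv_schwartzMultiplier _ (framePhase_hasTemperateGrowth E t)]
  rfl

theorem coordMul_schwartzFrame (E : ℝ → Space n) (t : ℝ) (v : Space n) (f : 𝓢(Space n, ℂ)) :
    coordMul v (schwartzFrame E t f) = schwartzFrame E t
      (coordMul v f + (t : ℂ) • momentum v f + ((inner ℝ v (displacement E t) : ℝ) : ℂ) • f) := by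
  rw [schwartzFrame, coordMul_schwartzPhase _ (linPhase_hasTemperateGrowth _), framePhase,
    coordMul_schwartzMultiplier]
  rfl

theorem schwartzFrame_add (E : ℝ → Space n) (t : ℝ) (f g : 𝓢(Space n, ℂ)) :
    schwartzFrame E t (f + g) = schwartzFrame E t f + schwartzFrame E t g := by
  simp [schwartzFrame]

theorem schwartzFrame_smul (E : ℝ → Space n) (t : ℝ) (c : ℂ) (f : 𝓢(Space n, ℂ)) :
    schwartzFrame E t (c • f) = c • schwartzFrame E t f := by
  simp [schwartzFrame]

theorem continuous_toL2_schwartzFrame {E : ℝ → Space n} (hE : LocallyIntegrable E volume)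
    (f : 𝓢(Space n, ℂ)) : Continuous fun t => toL2 (schwartzFrame E t f) := by
  simp only [toL2_schwartzFrame]
  exact continuous_frame hE continuous_const

/-- Momentum and position commute through the frame up to the continuous scalars t, b(t), c(t). What
remains is a finite combination of fixed Schwartz functions moved by the strongly continuous frame.
This makes H₀ on a moving test function an admissible density for `diagonal_integral`. -/
theorem continuous_hamCoeff_schwartzFrame {E : ℝ → Space n} (hE : LocallyIntegrable E volume)
    (k : Option (Fin n)) (f : 𝓢(Space n, ℂ)) :
    Continuous fun t => toL2 (hamCoeff k (schwartzFrame E t f)) := by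
  have hd := continuous_drift hE
  have hc := continuous_displacement hE
  have hY := continuous_toL2_schwartzFrame hE
  rcases k with _ | j
  · have h : ∀ v : Space n, Continuous fun t => toL2 (∂_{v} (∂_{v} (schwartzFrame E t f))) := by
      intro v
      simp only [lineDeriv_schwartzFrame, LineDeriv.lineDerivOp_add, LineDeriv.lineDerivOp_smul,
        map_add, map_smul]
      have h1 := hY (∂_{v} (∂_{v} f))
      have h2 := hY (∂_{v} f)
      have h3 := hY f
      fun_prop
    simp only [hamCoeff_none, map_smul, SchwartzMap.laplacian_eq_sum (EuclideanSpace.basisFun (Fin n) ℝ),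
      map_sum]
    exact (continuous_finsetSum _ fun j _ => h _).const_smul (-(1 / 2 : ℂ))
  · simp only [hamCoeff_some, map_neg, coordMul_schwartzFrame, schwartzFrame_add, schwartzFrame_smul,
      map_add, map_smul]
    have h1 := hY (coordMul (EuclideanSpace.single j 1) f)
    have h2 := hY (momentum (EuclideanSpace.single j 1) f)
    have h3 := hY f
    fun_prop

/-- The conjugated weak identity determines an L²-valued integral because Schwartz functions are
dense. Pairing the result with an arbitrary vector then removes the regularity of the moved state in
`inner_frame_sub`. -/
theorem frame_symm_sub {E : ℝ → Space n} (hE : LocallyIntegrable E volume)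
    (f : 𝓢(Space n, ℂ)) (t₀ t₁ : ℝ) :
    (frame E t₁).symm (toL2 f) - (frame E t₀).symm (toL2 f)
      = ∫ t in t₀..t₁, ∑ k, (fieldCoeff E k t : ℂ) •
        (Complex.I • (frame E t).symm (toL2 (hamCoeff k f))) := by
  have hi : ∀ (t : ℝ) (x y : L2 n), inner ℂ x ((frame E t).symm y) = (inner ℂ (frame E t x) y : ℂ) :=
    fun t x y => by rw [← (frame E t).inner_map_map, LinearIsometryEquiv.apply_symm_apply]
  apply eq_of_inner_toL2
  intro g
  have hI := intervalIntegrable_sum_smul (locallyIntegrable_fieldCoeff hE)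
    (A := fun k t => Complex.I • (frame E t).symm (toL2 (hamCoeff k f)))
    (fun k => (continuous_frame_symm hE continuous_const).const_smul Complex.I) t₀ t₁
  rw [inner_intervalIntegral hI]
  have H := congrArg (starRingEnd ℂ) (inner_schwartz_frame_sub hE f g t₀ t₁)
  rw [map_sub, inner_conj_symm, inner_conj_symm] at H
  rw [inner_sub_right, hi, hi, H, intervalIntegral.intervalIntegral_eq_integral_uIoc,
    intervalIntegral.intervalIntegral_eq_integral_uIoc]
  rw [Complex.real_smul, Complex.real_smul, map_mul, Complex.conj_ofReal, ← integral_conj]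
  congr 2; ext t
  rw [map_sum, inner_sum]
  refine Finset.sum_congr rfl fun k _ => ?_
  rw [map_mul, map_mul, inner_conj_symm, Complex.conj_ofReal, inner_smul_right, inner_smul_right,
    hi, map_neg, Complex.conj_I, neg_neg]

/-- The weak derivative of the free evolution, tested against a Schwartz function. -/
theorem inner_frame_sub {E : ℝ → Space n} (hE : LocallyIntegrable E volume)
    (f : 𝓢(Space n, ℂ)) (g : L2 n) (t₀ t₁ : ℝ) :
    inner ℂ (toL2 f) (frame E t₁ g) - inner ℂ (toL2 f) (frame E t₀ g)
      = ∫ t in t₀..t₁, ∑ k, (fieldCoeff E k t : ℂ) *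
        (-Complex.I * inner ℂ (toL2 (hamCoeff k f)) (frame E t g)) := by
  have hi : ∀ (t : ℝ) (x y : L2 n), inner ℂ x ((frame E t).symm y) = (inner ℂ (frame E t x) y : ℂ) :=
    fun t x y => by rw [← (frame E t).inner_map_map, LinearIsometryEquiv.apply_symm_apply]
  have H : starRingEnd ℂ (inner ℂ g ((frame E t₁).symm (toL2 f) - (frame E t₀).symm (toL2 f)))
      = starRingEnd ℂ (inner ℂ g (∫ t in t₀..t₁, ∑ k, (fieldCoeff E k t : ℂ) •
        (Complex.I • (frame E t).symm (toL2 (hamCoeff k f))))) := by rw [frame_symm_sub hE]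
  have hI := intervalIntegrable_sum_smul (locallyIntegrable_fieldCoeff hE)
    (A := fun k t => Complex.I • (frame E t).symm (toL2 (hamCoeff k f)))
    (fun k => (continuous_frame_symm hE continuous_const).const_smul Complex.I) t₀ t₁
  rw [inner_intervalIntegral hI, inner_sub_right, hi,
    hi, map_sub, inner_conj_symm, inner_conj_symm] at H
  rw [H, intervalIntegral.intervalIntegral_eq_integral_uIoc,
    intervalIntegral.intervalIntegral_eq_integral_uIoc]
  rw [Complex.real_smul, Complex.real_smul, map_mul, Complex.conj_ofReal, ← integral_conj]
  congr 2; ext t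
  rw [inner_sum, map_sum]
  refine Finset.sum_congr rfl fun k _ => ?_
  rw [inner_smul_right, inner_smul_right, map_mul, map_mul, hi, inner_conj_symm, Complex.conj_ofReal,
    Complex.conj_I]

/-- The derivative of the free evolution of a Schwartz function. -/
theorem frame_toL2_sub {E : ℝ → Space n} (hE : LocallyIntegrable E volume)
    (f : 𝓢(Space n, ℂ)) (t₀ t₁ : ℝ) :
    frame E t₁ (toL2 f) - frame E t₀ (toL2 f)
      = ∫ t in t₀..t₁, ∑ k, (fieldCoeff E k t : ℂ) •
        (-Complex.I • toL2 (hamCoeff k (schwartzFrame E t f))) := by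
  apply eq_of_inner_toL2
  intro g
  have hI := intervalIntegrable_sum_smul (locallyIntegrable_fieldCoeff hE)
    (A := fun k t => -Complex.I • toL2 (hamCoeff k (schwartzFrame E t f)))
    (fun k => (continuous_hamCoeff_schwartzFrame hE k f).const_smul (-Complex.I)) t₀ t₁
  rw [inner_intervalIntegral hI, inner_sub_right,
    inner_schwartz_frame_sub hE]
  congr 1; ext t
  rw [inner_sum]
  refine Finset.sum_congr rfl fun k _ => ?_
  rw [inner_smul_right, inner_smul_right, ← hamCoeff_symmetric, toL2_schwartzFrame]

/-- The derivative of the free evolution of a Schwartz function, tested on the left. -/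
theorem inner_frame_toL2_sub {E : ℝ → Space n} (hE : LocallyIntegrable E volume)
    (f : 𝓢(Space n, ℂ)) (u : L2 n) (t₀ t₁ : ℝ) :
    inner ℂ (frame E t₁ (toL2 f)) u - inner ℂ (frame E t₀ (toL2 f)) u
      = ∫ t in t₀..t₁, ∑ k, (fieldCoeff E k t : ℂ) *
        (Complex.I * inner ℂ (toL2 (hamCoeff k (schwartzFrame E t f))) u) := by
  have H : starRingEnd ℂ (inner ℂ u (frame E t₁ (toL2 f) - frame E t₀ (toL2 f)))
      = starRingEnd ℂ (inner ℂ u (∫ t in t₀..t₁, ∑ k, (fieldCoeff E k t : ℂ) •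
        (-Complex.I • toL2 (hamCoeff k (schwartzFrame E t f))))) := by rw [frame_toL2_sub hE]
  have hI := intervalIntegrable_sum_smul (locallyIntegrable_fieldCoeff hE)
    (A := fun k t => -Complex.I • toL2 (hamCoeff k (schwartzFrame E t f)))
    (fun k => (continuous_hamCoeff_schwartzFrame hE k f).const_smul (-Complex.I)) t₀ t₁
  rw [inner_intervalIntegral hI, inner_sub_right,
    map_sub, inner_conj_symm, inner_conj_symm] at H
  rw [H, intervalIntegral.intervalIntegral_eq_integral_uIoc,
    intervalIntegral.intervalIntegral_eq_integral_uIoc]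
  rw [Complex.real_smul, Complex.real_smul, map_mul, Complex.conj_ofReal, ← integral_conj]
  congr 2; ext t
  rw [inner_sum, map_sum]
  refine Finset.sum_congr rfl fun k _ => ?_
  rw [inner_smul_right, inner_smul_right, map_mul, map_mul, inner_conj_symm, Complex.conj_ofReal,
    map_neg, Complex.conj_I, neg_neg]

end FrameDerivative

/-! ### Linear ODE with bounded, strongly continuous coefficients. -/

section LinearEvolution

set_option linter.unusedSectionVars false

variable {H : Type*} [NormedAddCommGroup H] [InnerProductSpace ℂ H] [NormedSpace ℝ H]
  [IsScalarTower ℝ ℂ H] [CompleteSpace H]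

/-- Integrating the weight e^{K|τ-s|} gains a factor 1/K. This gain makes the Picard map contract on
the whole line in the exponentially weighted norm. -/
theorem norm_integral_exp_smul_le {K M s : ℝ} (hK : 0 < K) {g : ℝ → H}
    (hg : ∀ t, ‖g t‖ ≤ M) (t : ℝ) :
    ‖∫ τ in s..t, Real.exp (K * |τ - s|) • g τ‖ ≤ Real.exp (K * |t - s|) * (M / K) := by
  have hM : 0 ≤ M := (norm_nonneg _).trans (hg 0)
  have hn : ∀ τ, ‖Real.exp (K * |τ - s|) • g τ‖ ≤ Real.exp (K * |τ - s|) * M := fun τ => by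
    rw [norm_smul, Real.norm_eq_abs, abs_of_pos (Real.exp_pos _)]
    exact mul_le_mul_of_nonneg_left (hg τ) (Real.exp_pos _).le
  have hi : ∀ a b, IntervalIntegrable (fun τ => Real.exp (K * |τ - s|) * M) volume a b :=
    fun a b => Continuous.intervalIntegrable (by fun_prop) a b
  rcases le_total s t with h | h
  · refine (intervalIntegral.norm_integral_le_of_norm_le h
      (Eventually.of_forall fun τ _ => hn τ) (hi s t)).trans ?_
    have h1 : ∫ τ in s..t, Real.exp (K * |τ - s|) * M
        = Real.exp (K * (t - s)) * (M / K) - Real.exp (K * (s - s)) * (M / K) := by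
      rw [← intervalIntegral.integral_eq_sub_of_hasDerivAt
        (f := fun τ => Real.exp (K * (τ - s)) * (M / K))
        (f' := fun τ => Real.exp (K * (τ - s)) * M) (fun τ _ => ?_)
        (Continuous.intervalIntegrable (by fun_prop) _ _)]
      · refine intervalIntegral.integral_congr fun τ hτ => ?_
        rw [Set.uIcc_of_le h] at hτ
        simp only [abs_of_nonneg (sub_nonneg.2 hτ.1)]
      · exact (((((hasDerivAt_id' τ).sub_const s).const_mul K).exp).mul_const (M / K)).congr_deriv
          (by field_simp)
    rw [h1, abs_of_nonneg (sub_nonneg.2 h)]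
    have : 0 ≤ Real.exp (K * (s - s)) * (M / K) := by positivity
    linarith
  · rw [intervalIntegral.integral_symm, norm_neg]
    refine (intervalIntegral.norm_integral_le_of_norm_le h
      (Eventually.of_forall fun τ _ => hn τ) (hi t s)).trans ?_
    have h1 : ∫ τ in t..s, Real.exp (K * |τ - s|) * M
        = -(Real.exp (K * (s - s)) * (M / K)) - -(Real.exp (K * (s - t)) * (M / K)) := by
      rw [← intervalIntegral.integral_eq_sub_of_hasDerivAt
        (f := fun τ => -(Real.exp (K * (s - τ)) * (M / K)))
        (f' := fun τ => Real.exp (K * (s - τ)) * M) (fun τ _ => ?_)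
        (Continuous.intervalIntegrable (by fun_prop) _ _)]
      · refine intervalIntegral.integral_congr fun τ hτ => ?_
        rw [Set.uIcc_of_le h] at hτ
        simp only [abs_of_nonpos (sub_nonpos.2 hτ.2), neg_sub]
      · exact (((((hasDerivAt_id' τ).const_sub s).const_mul K).exp).mul_const
          (M / K)).fun_neg.congr_deriv (by field_simp)
    rw [h1, abs_of_nonpos (sub_nonpos.2 h), neg_sub]
    have : 0 ≤ Real.exp (K * (s - s)) * (M / K) := by positivity
    linarith

/-- A linear equation with bounded, strongly continuous coefficients has global solutions. -/
theorem exists_hasDerivAt_clm {A : ℝ → H →L[ℂ] H} {C : ℝ} (hC : ∀ t, ‖A t‖ ≤ C)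
    (hA : ∀ f, Continuous fun t => A t f) (s : ℝ) (f : H) :
    ∃ u : ℝ → H, u s = f ∧ ∀ t, HasDerivAt u (A t (u t)) t := by
  have hC0 : 0 ≤ C := (norm_nonneg _).trans (hC 0)
  -- K ≥ 2C gives contraction constant C/K ≤ 1/2, and the added 1 keeps K positive when C = 0. The
  -- unknown is w = e^{-K|t-s|} u, a bounded continuous function.
  set K : ℝ := 2 * (C + 1) with hKdef
  have hK : 0 < K := by positivity
  have hcont : ∀ w : ℝ →ᵇ H, Continuous fun τ => A τ (w τ) := fun w =>
    continuous_clm_apply_of_bounded hC hA w.continuous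
  have hbd : ∀ (w : ℝ →ᵇ H) τ, ‖A τ (w τ)‖ ≤ C * ‖w‖ := fun w τ =>
    (A τ).le_of_opNorm_le_of_le (hC τ) (w.norm_coe_le_norm τ)
  have hwc : ∀ w : ℝ →ᵇ H, Continuous fun τ => Real.exp (K * |τ - s|) • A τ (w τ) := fun w => by
    have h1 : Continuous fun τ => Real.exp (K * |τ - s|) := by fun_prop
    exact h1.smul (hcont w)
  have hprim : ∀ w : ℝ →ᵇ H,
      Continuous fun t => ∫ τ in s..t, Real.exp (K * |τ - s|) • A τ (w τ) := fun w =>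
    intervalIntegral.continuous_primitive (fun a b => (hwc w).intervalIntegrable a b) s
  have hexp : ∀ t, Real.exp (-(K * |t - s|)) * Real.exp (K * |t - s|) = 1 := fun t => by
    rw [← Real.exp_add]; simp
  let T : (ℝ →ᵇ H) → (ℝ →ᵇ H) := fun w => BoundedContinuousFunction.ofNormedAddCommGroup
    (fun t => Real.exp (-(K * |t - s|)) • (f + ∫ τ in s..t, Real.exp (K * |τ - s|) • A τ (w τ)))
    (by have := hprim w; fun_prop) (‖f‖ + C * ‖w‖ / K) (fun t => by
      rw [norm_smul, Real.norm_eq_abs, abs_of_pos (Real.exp_pos _)]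
      have h1 := norm_integral_exp_smul_le (s := s) hK (hbd w) t
      have h2 : Real.exp (-(K * |t - s|)) ≤ 1 := Real.exp_le_one_iff.2 (by
        have := mul_nonneg hK.le (abs_nonneg (t - s)); linarith)
      calc _ ≤ Real.exp (-(K * |t - s|)) * (‖f‖ + Real.exp (K * |t - s|) * (C * ‖w‖ / K)) :=
            mul_le_mul_of_nonneg_left ((norm_add_le _ _).trans (add_le_add_right h1 _))
              (Real.exp_pos _).le
        _ = Real.exp (-(K * |t - s|)) * ‖f‖ + C * ‖w‖ / K := by
            rw [mul_add, ← mul_assoc, hexp, one_mul]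
        _ ≤ _ := add_le_add_left (mul_le_of_le_one_left (norm_nonneg _) h2) _)
  have hT : ∀ w t, T w t
      = Real.exp (-(K * |t - s|)) • (f + ∫ τ in s..t, Real.exp (K * |τ - s|) • A τ (w τ)) :=
    fun w t => rfl
  have hcontr : ContractingWith (1 / 2) T := by
    refine ⟨by norm_num, LipschitzWith.of_dist_le_mul fun w w' => ?_⟩
    rw [BoundedContinuousFunction.dist_le (by positivity)]
    intro t
    have hsub : T w t - T w' t = Real.exp (-(K * |t - s|)) •
        ∫ τ in s..t, Real.exp (K * |τ - s|) • A τ ((w - w') τ) := by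
      rw [hT, hT, ← smul_sub, add_sub_add_left_eq_sub, ← intervalIntegral.integral_sub
        ((hwc w).intervalIntegrable _ _) ((hwc w').intervalIntegrable _ _)]
      congr 2; ext τ
      rw [← smul_sub, ← map_sub]; rfl
    rw [dist_eq_norm, hsub, norm_smul, Real.norm_eq_abs, abs_of_pos (Real.exp_pos _)]
    have h1 := norm_integral_exp_smul_le (s := s) hK (hbd (w - w')) t
    calc _ ≤ Real.exp (-(K * |t - s|)) * (Real.exp (K * |t - s|) * (C * ‖w - w'‖ / K)) :=
          mul_le_mul_of_nonneg_left h1 (Real.exp_pos _).le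
      _ = C / K * ‖w - w'‖ := by rw [← mul_assoc, hexp]; ring
      _ ≤ 1 / 2 * ‖w - w'‖ := by
          refine mul_le_mul_of_nonneg_right ?_ (norm_nonneg _)
          rw [div_le_div_iff₀ hK two_pos]; linarith
      _ = _ := by rw [dist_eq_norm]; simp
  set w := hcontr.fixedPoint T with hw
  have hfix : T w = w := hcontr.fixedPoint_isFixedPt
  let u : ℝ → H := fun t => Real.exp (K * |t - s|) • w t
  have hu : ∀ t, u t = f + ∫ τ in s..t, A τ (u τ) := fun t => by
    have h1 : w t = Real.exp (-(K * |t - s|)) •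
        (f + ∫ τ in s..t, Real.exp (K * |τ - s|) • A τ (w τ)) := by rw [← hT, hfix]
    have h2 : ∀ τ, A τ (u τ) = Real.exp (K * |τ - s|) • A τ (w τ) := fun τ =>
      (A τ).map_smul_of_tower _ _
    simp only [h2]
    change Real.exp (K * |t - s|) • w t = _
    rw [h1, smul_smul, mul_comm, hexp, one_smul]
  have huc : Continuous fun τ => A τ (u τ) := by
    refine continuous_clm_apply_of_bounded hC hA ?_
    have := w.continuous
    fun_prop
  refine ⟨u, by simp [hu s], fun t => ?_⟩
  have h1 := (intervalIntegral.integral_hasDerivAt_right (huc.intervalIntegrable s t)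
    huc.stronglyMeasurable.stronglyMeasurableAtFilter huc.continuousAt).const_add f
  exact h1.congr_of_eventuallyEq (Eventually.of_forall hu)

theorem eq_of_hasDerivAt_clm {A : ℝ → H →L[ℂ] H} {C : ℝ} (hC : ∀ t, ‖A t‖ ≤ C) {s : ℝ}
    {u v : ℝ → H} (hu : ∀ t, HasDerivAt u (A t (u t)) t) (hv : ∀ t, HasDerivAt v (A t (v t)) t)
    (h : u s = v s) : u = v := by
  have hC0 : 0 ≤ C := (norm_nonneg _).trans (hC 0)
  refine ODE_solution_unique_univ (v := fun t x => A t x) (s := fun _ => Set.univ)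
    (K := C.toNNReal) (t₀ := s) (fun t => ?_) (fun t => ⟨hu t, trivial⟩) (fun t => ⟨hv t, trivial⟩) h
  refine ((A t).lipschitz.weaken ?_).lipschitzOnWith
  rw [← NNReal.coe_le_coe, Real.coe_toNNReal _ hC0]
  exact hC t

theorem norm_eq_of_hasDerivAt_skew {A : ℝ → H →L[ℂ] H}
    (hA : ∀ t f, (inner ℂ f (A t f) : ℂ).re = 0) {u : ℝ → H}
    (hu : ∀ t, HasDerivAt u (A t (u t)) t) (s t : ℝ) : ‖u t‖ = ‖u s‖ := by
  have h1 : ∀ t, HasDerivAt (fun t => (inner ℂ (u t) (u t) : ℂ)) 0 t := fun t => by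
    have := (hu t).inner ℂ (hu t)
    refine this.congr_deriv ?_
    rw [← inner_conj_symm (A t (u t)), Complex.add_conj, hA]
    simp
  have h2 := is_const_of_deriv_eq_zero (fun t => (h1 t).differentiableAt) (fun t => (h1 t).deriv) t s
  rw [inner_self_eq_norm_sq_to_K, inner_self_eq_norm_sq_to_K] at h2
  norm_cast at h2
  exact (sq_eq_sq₀ (norm_nonneg _) (norm_nonneg _)).1 h2

/-- The unitary evolution generated by a bounded, strongly continuous, symmetric family. -/
theorem exists_unitary_evolution {Q : ℝ → H →L[ℂ] H} {C : ℝ} (hC : ∀ t, ‖Q t‖ ≤ C)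
    (hQ : ∀ f, Continuous fun t => Q t f)
    (hs : ∀ t f g, (inner ℂ (Q t f) g : ℂ) = inner ℂ f (Q t g)) :
    ∃ D : ℝ → H ≃ₗᵢ[ℂ] H, (∀ f, D 0 f = f) ∧
      ∀ f t, HasDerivAt (fun t => D t f) (-Complex.I • Q t (D t f)) t := by
  let A : ℝ → H →L[ℂ] H := fun t => -Complex.I • Q t
  have hAC : ∀ t, ‖A t‖ ≤ C := fun t => by simpa [A, norm_smul] using hC t
  have hAc : ∀ f, Continuous fun t => A t f := fun f => (hQ f).const_smul (-Complex.I)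
  have hsk : ∀ t f, (inner ℂ f (A t f) : ℂ).re = 0 := fun t f => by
    have h := congrArg Complex.im (inner_conj_symm f (Q t f))
    rw [hs] at h
    simp only [Complex.conj_im] at h
    simp only [A, _root_.smul_apply, inner_smul_right, Complex.mul_re, Complex.neg_re, Complex.I_re,
      Complex.neg_im, Complex.I_im]
    linarith
  choose u hu0 hud using exists_hasDerivAt_clm hAC hAc
  have hnorm : ∀ s f t, ‖u s f t‖ = ‖f‖ := fun s f t => by
    rw [norm_eq_of_hasDerivAt_skew hsk (hud s f) s t, hu0]
  have huniq : ∀ {s f v}, (∀ t, HasDerivAt v (A t (v t)) t) → v s = f → v = u s f :=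
    fun hv h => eq_of_hasDerivAt_clm hAC hv (hud _ _) (h.trans (hu0 _ _).symm)
  have hadd : ∀ s f g, u s (f + g) = fun t => u s f t + u s g t := fun s f g =>
    (huniq (fun t => by
      have := (hud s f t).add (hud s g t)
      rwa [← map_add] at this) (by simp [hu0])).symm
  have hsmul : ∀ s (c : ℂ) f, u s (c • f) = fun t => c • u s f t := fun s c f =>
    (huniq (fun t => by
      have := (hud s f t).const_smul c
      rwa [← map_smul] at this) (by simp [hu0])).symm
  let L : ℝ → H →ₗᵢ[ℂ] H := fun t =>
    { toFun := fun f => u 0 f t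
      map_add' := fun f g => by rw [hadd]
      map_smul' := fun c f => by rw [hsmul]; rfl
      norm_map' := fun f => hnorm 0 f t }
  -- A preimage of g is found by solving from time t, with value g there, back to time 0.
  have hsurj : ∀ t, Function.Surjective (L t) := fun t g => by
    refine ⟨u t g 0, ?_⟩
    change u 0 (u t g 0) t = g
    rw [← huniq (hud t g) rfl, hu0]
  refine ⟨fun t => LinearIsometryEquiv.ofSurjective (L t) (hsurj t), fun f => ?_, fun f t => ?_⟩
  · exact hu0 0 f
  · exact hud 0 f t

end LinearEvolution

/-! ### Existence and uniqueness of the propagators in the interaction picture. -/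

section Propagators

variable {n : ℕ}

/-- The unbounded part is split into scalar functions of time times fixed vectors, as the integrated
product rule needs; all roughness in time sits in the scalars. The identity also supplies the square
integrability that selects the first branch in the definition of `hamiltonian`. -/
theorem hamiltonian_eq (E : ℝ → Space n) {V : ℝ → Space n → ℝ} {t : ℝ} {v : Space n →ᵇ ℂ}
    (hv : ∀ x, v x = (V t x : ℂ)) (ψ : 𝓢(Space n, ℂ)) :
    hamiltonian E V t ψ
      = ∑ k, (fieldCoeff E k t : ℂ) • toL2 (hamCoeff k ψ) + boundedMul v (toL2 ψ) := by
  set g := ∑ k, fieldCoeff E k t • hamCoeff k ψ with hg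
  have h1 : ∑ k, (fieldCoeff E k t : ℂ) • toL2 (hamCoeff k ψ) = toL2 g := by
    rw [hg, map_sum]
    refine Finset.sum_congr rfl fun k _ => ?_
    rw [← map_smul]; rfl
  have h2 : (toL2 g + boundedMul v (toL2 ψ) : L2 n) =ᵐ[volume] hamiltonianFun E V t ψ := by
    filter_upwards [Lp.coeFn_add (toL2 g) (boundedMul v (toL2 ψ)), toL2_coeFn g,
      boundedMul_coeFn v (toL2 ψ), toL2_coeFn ψ] with x e1 e2 e3 e4
    rw [e1, Pi.add_apply, e2, e3, e4, hg, _root_.sum_apply, Fintype.sum_option, hamiltonianFun,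
      hv, inner_eq_sum]
    simp only [fieldCoeff, one_smul, hamCoeff_none, hamCoeff_some, _root_.smul_apply,
      _root_.neg_apply, coordMul_apply, inner_single_one, SchwartzMap.laplacian_apply, smul_eq_mul,
      Complex.real_smul, Complex.ofReal_sum, Complex.ofReal_mul, Finset.sum_mul, smul_neg,
      Finset.sum_neg_distrib, mul_assoc, ← sub_eq_add_neg]
  have h3 : MemLp (hamiltonianFun E V t ψ) 2 volume := (Lp.memLp _).ae_eq h2
  rw [h1, hamiltonian, dif_pos h3]
  exact Lp.ext (h3.coeFn_toLp.trans h2.symm)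

theorem boundedMul_symmetric {m : Space n →ᵇ ℂ} (hm : ∀ x, starRingEnd ℂ (m x) = m x) (f g : L2 n) :
    inner ℂ (boundedMul m f) g = (inner ℂ f (boundedMul m g) : ℂ) := by
  rw [L2.inner_def, L2.inner_def]
  apply integral_congr_ae
  filter_upwards [boundedMul_coeFn m f, boundedMul_coeFn m g] with x h1 h2
  rw [h1, h2, RCLike.inner_apply, RCLike.inner_apply, map_mul, hm]
  ring

/-- The potential in the interaction picture. -/
def interaction (E : ℝ → Space n) (v : ℝ → Space n →ᵇ ℂ) (t : ℝ) : L2 n →L[ℂ] L2 n :=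
  ((frame E t).symm.toContinuousLinearEquiv : L2 n →L[ℂ] L2 n) ∘L boundedMul (v t) ∘L
    ((frame E t).toContinuousLinearEquiv : L2 n →L[ℂ] L2 n)

theorem interaction_apply (E : ℝ → Space n) (v : ℝ → Space n →ᵇ ℂ) (t : ℝ) (f : L2 n) :
    interaction E v t f = (frame E t).symm (boundedMul (v t) (frame E t f)) := rfl

theorem norm_interaction_apply (E : ℝ → Space n) (v : ℝ → Space n →ᵇ ℂ) (t : ℝ) (f : L2 n) :
    ‖interaction E v t f‖ = ‖boundedMul (v t) (frame E t f)‖ := by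
  rw [interaction_apply, LinearIsometryEquiv.norm_map]

theorem norm_interaction_le (E : ℝ → Space n) {v : ℝ → Space n →ᵇ ℂ} {C : ℝ} (hC : ∀ t, ‖v t‖ ≤ C)
    (t : ℝ) : ‖interaction E v t‖ ≤ C := by
  refine ContinuousLinearMap.opNorm_le_bound _ ((norm_nonneg _).trans (hC t)) fun f => ?_
  rw [norm_interaction_apply]
  refine ((boundedMul (v t)).le_of_opNorm_le ((norm_boundedMul_le _).trans (hC t)) _).trans ?_
  rw [LinearIsometryEquiv.norm_map]

theorem continuous_boundedMul_apply {v : ℝ → Space n →ᵇ ℂ} {C : ℝ} (hC : ∀ t, ‖v t‖ ≤ C)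
    (hv : ∀ x, Continuous fun t => v t x) {f : ℝ → L2 n} (hf : Continuous f) :
    Continuous fun t => boundedMul (v t) (f t) :=
  continuous_clm_apply_of_bounded (A := fun t => boundedMul (v t))
    (fun t => (norm_boundedMul_le _).trans (hC t)) (continuous_boundedMul hC hv) hf

theorem continuous_interaction {E : ℝ → Space n} (hE : LocallyIntegrable E volume)
    {v : ℝ → Space n →ᵇ ℂ} {C : ℝ} (hC : ∀ t, ‖v t‖ ≤ C) (hv : ∀ x, Continuous fun t => v t x)
    {f : ℝ → L2 n} (hf : Continuous f) : Continuous fun t => interaction E v t (f t) := by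
  simp only [interaction_apply]
  exact continuous_frame_symm hE (continuous_boundedMul_apply hC hv (continuous_frame hE hf))

theorem interaction_symmetric (E : ℝ → Space n) {v : ℝ → Space n →ᵇ ℂ}
    (hr : ∀ t x, starRingEnd ℂ (v t x) = v t x) (t : ℝ) (f g : L2 n) :
    inner ℂ (interaction E v t f) g = (inner ℂ f (interaction E v t g) : ℂ) := by
  rw [interaction_apply, interaction_apply, ← (frame E t).inner_map_map,
    ← (frame E t).inner_map_map f, LinearIsometryEquiv.apply_symm_apply,
    LinearIsometryEquiv.apply_symm_apply, boundedMul_symmetric (hr t)]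

/-- The time evolution obtained from its interaction picture. -/
def evolution (E : ℝ → Space n) (D : ℝ → (L2 n ≃ₗᵢ[ℂ] L2 n)) (t s : ℝ) : L2 n ≃ₗᵢ[ℂ] L2 n :=
  (((frame E s).symm.trans (D s).symm).trans (D t)).trans (frame E t)

theorem evolution_apply (E : ℝ → Space n) (D : ℝ → (L2 n ≃ₗᵢ[ℂ] L2 n)) (t s : ℝ) (f : L2 n) :
    evolution E D t s f = frame E t (D t ((D s).symm ((frame E s).symm f))) := rfl

theorem evolution_symm (E : ℝ → Space n) (D : ℝ → (L2 n ≃ₗᵢ[ℂ] L2 n)) (t s : ℝ) :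
    (evolution E D t s).symm = evolution E D s t := rfl

/-- `D` is the evolution generated by the interaction. -/
def IsInteractionEvolution (E : ℝ → Space n) (v : ℝ → Space n →ᵇ ℂ)
    (D : ℝ → (L2 n ≃ₗᵢ[ℂ] L2 n)) : Prop :=
  ∀ f t, HasDerivAt (fun t => D t f) (-Complex.I • interaction E v t (D t f)) t

theorem IsInteractionEvolution.continuous {E : ℝ → Space n} {v : ℝ → Space n →ᵇ ℂ}
    {D : ℝ → (L2 n ≃ₗᵢ[ℂ] L2 n)} (hD : IsInteractionEvolution E v D) (f : L2 n) :
    Continuous fun t => D t f :=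
  continuous_iff_continuousAt.2 fun t => (hD f t).continuousAt

theorem continuous_evolution {E : ℝ → Space n} (hE : LocallyIntegrable E volume)
    {D : ℝ → (L2 n ≃ₗᵢ[ℂ] L2 n)} (hD : ∀ f, Continuous fun t => D t f) (f : L2 n) :
    Continuous fun z : ℝ × ℝ => evolution E D z.1 z.2 f := by
  have h1 : ∀ f, Continuous fun t => frame E t f := fun f => continuous_frame hE continuous_const
  simp only [evolution_apply]
  refine continuous_isometry_apply (A := fun z : ℝ × ℝ => frame E z.1)
    (fun f => (h1 f).comp continuous_fst) ?_
  refine continuous_isometry_apply (A := fun z : ℝ × ℝ => D z.1)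
    (fun f => (hD f).comp continuous_fst) ?_
  refine continuous_isometry_apply (A := fun z : ℝ × ℝ => (D z.2).symm)
    (fun f => (continuous_isometry_symm hD f).comp continuous_snd) ?_
  exact (continuous_isometry_symm h1 f).comp continuous_snd

theorem inner_symm_apply (A : L2 n ≃ₗᵢ[ℂ] L2 n) (f g : L2 n) :
    inner ℂ f (A.symm g) = (inner ℂ (A f) g : ℂ) := by
  rw [← A.inner_map_map, LinearIsometryEquiv.apply_symm_apply]

section

variable {E : ℝ → Space n} (hE : LocallyIntegrable E volume) {V : ℝ → Space n → ℝ}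
  {v : ℝ → Space n →ᵇ ℂ} (hv : ∀ t x, v t x = (V t x : ℂ)) {C : ℝ} (hC : ∀ t, ‖v t‖ ≤ C)
  (hc : ∀ x, Continuous fun t => v t x)

include hE hv hC hc

/-- Product rule for frame E t (D τ h) on the diagonal t = τ. The outer `none` index carries the
interaction term, with time density 1; the inner indices carry H₀. -/
theorem evolution_equation_left {D : ℝ → (L2 n ≃ₗᵢ[ℂ] L2 n)} (hD : IsInteractionEvolution E v D)
    (ψ : 𝓢(Space n, ℂ)) (f : L2 n) (s t₀ t₁ : ℝ) :
    inner ℂ (toL2 ψ) (evolution E D t₁ s f) - inner ℂ (toL2 ψ) (evolution E D t₀ s f)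
      = -Complex.I * ∫ t in t₀..t₁, (inner ℂ (hamiltonian E V t ψ) (evolution E D t s f) : ℂ) := by
  have hr : ∀ t x, starRingEnd ℂ (v t x) = v t x := fun t x => by rw [hv, Complex.conj_ofReal]
  set h : L2 n := (D s).symm ((frame E s).symm f) with hh
  have hDc := hD.continuous h
  have hY : ∀ g : L2 n, Continuous fun p : ℝ × ℝ => frame E p.1 g := fun g =>
    (continuous_frame hE continuous_const).comp continuous_fst
  have hQ : Continuous fun t => -Complex.I • interaction E v t (D t h) :=
    (continuous_interaction hE hC hc hDc).const_smul (-Complex.I)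
  have hj : ∀ {g : ℝ → L2 n}, Continuous g → Continuous fun p : ℝ × ℝ => frame E p.1 (g p.2) :=
    fun {g} hg => continuous_isometry_apply (A := fun p : ℝ × ℝ => frame E p.1) hY
      (hg.comp continuous_snd)
  have H := diagonal_integral (ι := Option (Option (Fin n)))
    (e := fun k => k.elim (fun _ => 1) (fieldCoeff E))
    (F := fun t τ => inner ℂ (toL2 ψ) (frame E t (D τ h)))
    (A := fun k t τ => k.elim
      (inner ℂ (toL2 ψ) (frame E t (-Complex.I • interaction E v τ (D τ h)))) fun _ => 0)
    (B := fun k t τ => k.elim 0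
      fun k => -Complex.I * inner ℂ (toL2 (hamCoeff k ψ)) (frame E t (D τ h)))
    (by
      rintro (_ | k)
      · exact continuous_const.locallyIntegrable
      · exact locallyIntegrable_fieldCoeff hE k)
    (by
      rintro (_ | k)
      · exact continuous_const.inner (hj hQ)
      · exact continuous_const)
    (by
      rintro (_ | k)
      · exact continuous_const
      · exact continuous_const.mul (continuous_const.inner (hj hDc)))
    (by
      intro t τ₀ τ₁
      simp only [Fintype.sum_option, Option.elim, mul_zero, Finset.sum_const_zero, add_zero,
        Complex.ofReal_one, one_mul]
      have h1 := intervalIntegral.integral_eq_sub_of_hasDerivAt (a := τ₀) (b := τ₁)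
        (fun τ _ => hD h τ) (hQ.intervalIntegrable _ _)
      have h2 : ∀ g : L2 n, inner ℂ (toL2 ψ) (frame E t g)
          = (inner ℂ ((frame E t).symm (toL2 ψ)) g : ℂ) := fun g => by
        rw [← (frame E t).inner_map_map ((frame E t).symm _),
          LinearIsometryEquiv.apply_symm_apply]
      simp only [h2]
      rw [← inner_intervalIntegral (hQ.intervalIntegrable _ _), h1,
        inner_sub_right])
    (by
      intro τ t₀ t₁
      simp only [Fintype.sum_option, Option.elim, mul_zero, zero_add]
      rw [inner_frame_sub hE]
      simp only [Fintype.sum_option])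
    t₀ t₁
  simp only [evolution_apply, ← hh]
  rw [H, ← intervalIntegral.integral_const_mul]
  congr 1; ext t
  rw [hamiltonian_eq E (hv t), inner_add_left, sum_inner, Fintype.sum_option,
    boundedMul_symmetric (hr t)]
  simp only [Option.elim, add_zero, zero_add, map_smul, inner_smul_right, inner_smul_left,
    Complex.conj_ofReal, interaction_apply, LinearIsometryEquiv.apply_symm_apply, Complex.ofReal_one,
    one_mul, mul_add, Finset.mul_sum]
  rw [add_comm]
  congr 1
  refine Finset.sum_congr rfl fun k _ => by ring

theorem isPropagator_evolution {D : ℝ → (L2 n ≃ₗᵢ[ℂ] L2 n)} (hD : IsInteractionEvolution E v D) :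
    IsPropagator E V (evolution E D) where
  continuous := continuous_evolution hE hD.continuous
  comp t s r f := by simp [evolution_apply]
  equation_left ψ f s t₀ t₁ := by
    rw [← toL2_apply]; exact evolution_equation_left hE hv hC hc hD ψ f s t₀ t₁
  equation_right ψ f t s₀ s₁ := by
    -- Since the adjoint of U(t,s) is U(s,t), the equation in s is the complex conjugate of the
    -- equation in t.
    have hi : ∀ s (g h : L2 n), inner ℂ g (evolution E D t s h)
        = starRingEnd ℂ (inner ℂ h (evolution E D s t g)) := fun s g h => by
      rw [inner_conj_symm, ← evolution_symm E D s t, inner_symm_apply]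
    have H := congrArg (starRingEnd ℂ) (evolution_equation_left hE hv hC hc hD ψ f t s₀ s₁)
    rw [← toL2_apply, hi, hi, ← map_sub, H, map_mul, map_neg, Complex.conj_I, neg_neg]
    congr 1
    simp only [hi]
    rw [intervalIntegral.intervalIntegral_eq_integral_uIoc,
      intervalIntegral.intervalIntegral_eq_integral_uIoc,
      Complex.real_smul, Complex.real_smul, map_mul, Complex.conj_ofReal, ← integral_conj]

/-- The free motion keeps a test function Schwartz, so the defining equation may be tested against
the moving function `schwartzFrame E t ψ`. On the diagonal the two H₀ contributions cancel and only
the bounded potential survives. -/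
theorem IsPropagator.interaction_sub {U : ℝ → ℝ → (L2 n ≃ₗᵢ[ℂ] L2 n)} (hU : IsPropagator E V U)
    (s : ℝ) (f : L2 n) (t₀ t₁ : ℝ) :
    (frame E t₁).symm (U t₁ s f) - (frame E t₀).symm (U t₀ s f)
      = ∫ t in t₀..t₁, -Complex.I • interaction E v t ((frame E t).symm (U t s f)) := by
  have hr : ∀ t x, starRingEnd ℂ (v t x) = v t x := fun t x => by rw [hv, Complex.conj_ofReal]
  have hu : Continuous fun t => U t s f := (hU.continuous f).comp (Continuous.prodMk_left s)
  have hg : Continuous fun t => (frame E t).symm (U t s f) := continuous_frame_symm hE hu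
  have hQ : Continuous fun t => -Complex.I • interaction E v t ((frame E t).symm (U t s f)) :=
    (continuous_interaction hE hC hc hg).const_smul (-Complex.I)
  apply eq_of_inner_toL2
  intro ψ
  have hu2 : Continuous fun p : ℝ × ℝ => U p.2 s f := hu.comp continuous_snd
  have hk : ∀ k, Continuous fun p : ℝ × ℝ => toL2 (hamCoeff k (schwartzFrame E p.1 ψ)) :=
    fun k => (continuous_hamCoeff_schwartzFrame hE k ψ).comp continuous_fst
  have hvu : Continuous fun p : ℝ × ℝ => boundedMul (v p.2) (U p.2 s f) :=
    (continuous_boundedMul_apply hC hc hu).comp continuous_snd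
  have hψ : Continuous fun p : ℝ × ℝ => toL2 (schwartzFrame E p.1 ψ) :=
    (continuous_toL2_schwartzFrame hE ψ).comp continuous_fst
  have H := diagonal_integral (ι := Option (Option (Fin n)))
    (e := fun k => k.elim (fun _ => 1) (fieldCoeff E))
    (F := fun t τ => inner ℂ (toL2 (schwartzFrame E t ψ)) (U τ s f))
    (A := fun k t τ => k.elim
      (-Complex.I * inner ℂ (toL2 (schwartzFrame E t ψ)) (boundedMul (v τ) (U τ s f)))
      fun k => -Complex.I * inner ℂ (toL2 (hamCoeff k (schwartzFrame E t ψ))) (U τ s f))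
    (B := fun k t τ => k.elim 0
      fun k => Complex.I * inner ℂ (toL2 (hamCoeff k (schwartzFrame E t ψ))) (U τ s f))
    (by
      rintro (_ | k)
      · exact continuous_const.locallyIntegrable
      · exact locallyIntegrable_fieldCoeff hE k)
    (by
      rintro (_ | k)
      · exact continuous_const.mul (hψ.inner hvu)
      · exact continuous_const.mul ((hk k).inner hu2))
    (by
      rintro (_ | k)
      · exact continuous_const
      · exact continuous_const.mul ((hk k).inner hu2))
    (by
      intro t τ₀ τ₁
      rw [toL2_apply, hU.equation_left, ← intervalIntegral.integral_const_mul]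
      congr 1; ext τ
      rw [hamiltonian_eq E (hv τ), inner_add_left, sum_inner, Fintype.sum_option (f := fun k : Option (Option (Fin n)) => _),
        boundedMul_symmetric (hr τ)]
      simp only [Option.elim, inner_smul_left, Complex.conj_ofReal, Complex.ofReal_one,
        one_mul, mul_add, Finset.mul_sum]
      rw [add_comm, ← toL2_apply]
      congr 1
      exact Finset.sum_congr rfl fun k _ => by ring)
    (by
      intro τ t₀ t₁
      rw [toL2_schwartzFrame, toL2_schwartzFrame, inner_frame_toL2_sub hE]
      congr 1; ext t
      rw [Fintype.sum_option (f := fun k : Option (Option (Fin n)) => _)]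
      simp only [Option.elim, mul_zero, zero_add])
    t₀ t₁
  rw [inner_sub_right, inner_symm_apply, inner_symm_apply, ← toL2_schwartzFrame,
    ← toL2_schwartzFrame, H, inner_intervalIntegral (hQ.intervalIntegrable _ _)]
  congr 1; ext t
  rw [Fintype.sum_option, Finset.sum_eq_zero, inner_smul_right, interaction_apply,
    inner_symm_apply, LinearIsometryEquiv.apply_symm_apply, toL2_schwartzFrame]
  · simp
  · intro k _; simp

/-- The integral equation has a continuous integrand, so the pulled-back path is differentiable and
solves the bounded linear ODE; its solutions are determined by their value at s. The initial value
U(s,s) = 1 comes from the composition law and injectivity. -/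
theorem IsPropagator.eq_evolution {U : ℝ → ℝ → (L2 n ≃ₗᵢ[ℂ] L2 n)} (hU : IsPropagator E V U)
    {D : ℝ → (L2 n ≃ₗᵢ[ℂ] L2 n)} (hD : IsInteractionEvolution E v D) : U = evolution E D := by
  funext t s
  ext1 f
  have hid : U s s f = f := (U s s).injective (hU.comp s s s f)
  have hu : Continuous fun t => U t s f := (hU.continuous f).comp (Continuous.prodMk_left s)
  have hg : Continuous fun t => (frame E t).symm (U t s f) := continuous_frame_symm hE hu
  have hQ : Continuous fun t => -Complex.I • interaction E v t ((frame E t).symm (U t s f)) :=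
    (continuous_interaction hE hC hc hg).const_smul (-Complex.I)
  have hA : ∀ t, ‖-Complex.I • interaction E v t‖ ≤ C := fun t => by
    simpa [norm_smul] using norm_interaction_le E hC t
  have h1 : ∀ t, HasDerivAt (fun t => (frame E t).symm (U t s f))
      ((-Complex.I • interaction E v t) ((frame E t).symm (U t s f))) t := fun t => by
    have h := (intervalIntegral.integral_hasDerivAt_right (hQ.intervalIntegrable s t)
      hQ.stronglyMeasurable.stronglyMeasurableAtFilter hQ.continuousAt).const_add
        ((frame E s).symm (U s s f))
    refine h.congr_of_eventuallyEq (Eventually.of_forall fun t => ?_)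
    beta_reduce
    rw [← hU.interaction_sub hE hv hC hc s f s t, add_sub_cancel]
  have h2 := eq_of_hasDerivAt_clm (s := s) hA h1 (hD ((D s).symm ((frame E s).symm f)))
    (by rw [hid, LinearIsometryEquiv.apply_symm_apply])
  have h3 := congrFun h2 t
  rw [evolution_apply, ← h3, LinearIsometryEquiv.apply_symm_apply]

theorem exists_isInteractionEvolution : ∃ D, IsInteractionEvolution E v D := by
  obtain ⟨D, -, hD⟩ := exists_unitary_evolution (norm_interaction_le E hC)
    (fun f => continuous_interaction hE hC hc continuous_const)
    (interaction_symmetric E fun t x => by rw [hv, Complex.conj_ofReal])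
  exact ⟨D, hD⟩

theorem existsUnique_isPropagator : ∃! U, IsPropagator E V U := by
  obtain ⟨D, hD⟩ := exists_isInteractionEvolution hE hv hC hc
  exact ⟨_, isPropagator_evolution hE hv hC hc hD, fun U hU => hU.eq_evolution hE hv hC hc hD⟩

theorem propagator_eq_evolution {D : ℝ → (L2 n ≃ₗᵢ[ℂ] L2 n)} (hD : IsInteractionEvolution E v D) :
    propagator E V = evolution E D := by
  have h : ∃ U, IsPropagator E V U := ⟨_, isPropagator_evolution hE hv hC hc hD⟩
  rw [propagator, dif_pos h]
  exact h.choose_spec.eq_evolution hE hv hC hc hD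

end

theorem isInteractionEvolution_refl (E : ℝ → Space n) :
    IsInteractionEvolution E 0 fun _ => LinearIsometryEquiv.refl ℂ (L2 n) := by
  intro f t
  have h : boundedMul (0 : Space n →ᵇ ℂ) (frame E t f) = 0 := by
    apply Lp.ext
    filter_upwards [boundedMul_coeFn 0 (frame E t f), Lp.coeFn_zero ℂ 2 volume] with x h1 h2
    rw [h1, h2]; simp
  have h2 : interaction E 0 t f = 0 := by
    rw [interaction_apply]
    change (frame E t).symm (boundedMul 0 (frame E t f)) = 0
    rw [h, map_zero]
  simp only [LinearIsometryEquiv.coe_refl, id, h2, smul_zero]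
  exact hasDerivAt_const t f

theorem existsUnique_isPropagator_free {E : ℝ → Space n} (hE : LocallyIntegrable E volume) :
    ∃! U, IsPropagator E (fun _ _ => 0) U :=
  existsUnique_isPropagator hE (v := 0) (fun t x => by simp) (C := 0) (fun t => by simp)
    (fun x => continuous_const)

theorem freePropagator_apply {E : ℝ → Space n} (hE : LocallyIntegrable E volume) (t s : ℝ)
    (f : L2 n) : freePropagator E t s f = frame E t ((frame E s).symm f) := by
  rw [freePropagator, propagator_eq_evolution hE (v := 0) (fun t x => by simp) (C := 0)
    (fun t => by simp) (fun x => continuous_const) (isInteractionEvolution_refl E)]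
  rfl

end Propagators

/-! ### Galilei covariance and the classical centre of a packet. -/

section Galilei

variable {n : ℕ}

theorem schwartz_ext_fourier {f g : 𝓢(Space n, ℂ)} (h : 𝓕 f = 𝓕 g) : f = g := by
  have h1 : 𝓕⁻ (𝓕 f : 𝓢(Space n, ℂ)) = f := FourierTransform.fourierInv_fourier_eq f
  rw [← h1, h]
  exact FourierTransform.fourierInv_fourier_eq g

theorem toL2_schwartzPhase {θ : C(Space n, ℝ)} (hθ : (θ : Space n → ℝ).HasTemperateGrowth)
    (f : 𝓢(Space n, ℂ)) : toL2 (schwartzPhase θ f) = phase θ (toL2 f) := by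
  rw [toL2_apply, toLp_schwartzPhase hθ, toL2_apply]

theorem toL2_schwartzMultiplier {θ : C(Space n, ℝ)} (hθ : (θ : Space n → ℝ).HasTemperateGrowth)
    (f : 𝓢(Space n, ℂ)) : toL2 (schwartzMultiplier θ f) = multiplier θ (toL2 f) := by
  rw [toL2_apply, toLp_schwartzMultiplier hθ, toL2_apply]

/-- Commuting e^{ib·x} to the left replaces p by p + b in ½t p² + c·p + a; expanding gives the new
translation c + tb and the new scalar. -/
theorem schwartzMultiplier_quadPhase_linPhase (t : ℝ) (c : Space n) (a : ℝ) (b : Space n)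
    (f : 𝓢(Space n, ℂ)) :
    schwartzMultiplier (quadPhase t c a) (schwartzPhase (linPhase b) f)
      = schwartzPhase (linPhase b)
        (schwartzMultiplier (quadPhase t (c + t • b) (a + inner ℝ c b + t * ‖b‖ ^ 2 / 2)) f) := by
  apply schwartz_ext_fourier
  ext ξ
  rw [fourier_schwartzMultiplier, schwartzPhase_apply (quadPhase_hasTemperateGrowth _ _ _),
    fourier_schwartzPhase_linPhase, fourier_schwartzPhase_linPhase, fourier_schwartzMultiplier,
    schwartzPhase_apply (quadPhase_hasTemperateGrowth _ _ _)]
  congr 4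
  rw [quadPhase_apply, quadPhase_apply, norm_sub_sq_real, norm_smul, inner_sub_right,
    inner_smul_right, inner_smul_right, inner_add_left, inner_add_left, inner_smul_left,
    inner_smul_left, real_inner_self_eq_norm_sq, real_inner_comm ξ b, Real.norm_eq_abs, mul_pow,
    sq_abs]
  have := Real.pi_ne_zero
  simp
  field_simp
  ring

theorem multiplier_quadPhase_linPhase (t : ℝ) (c : Space n) (a : ℝ) (b : Space n) (f : L2 n) :
    multiplier (quadPhase t c a) (phase (linPhase b) f)
      = phase (linPhase b)
        (multiplier (quadPhase t (c + t • b) (a + inner ℝ c b + t * ‖b‖ ^ 2 / 2)) f) := by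
  have := denseRange_toL2.equalizer
    (g := fun f : L2 n => multiplier (quadPhase t c a) (phase (linPhase b) f))
    (h := fun f : L2 n => phase (linPhase b)
      (multiplier (quadPhase t (c + t • b) (a + inner ℝ c b + t * ‖b‖ ^ 2 / 2)) f))
    (by fun_prop) (by fun_prop) (by
      ext1 f
      simp only [Function.comp_apply]
      rw [← toL2_schwartzPhase (linPhase_hasTemperateGrowth _),
        ← toL2_schwartzMultiplier (quadPhase_hasTemperateGrowth _ _ _),
        ← toL2_schwartzMultiplier (quadPhase_hasTemperateGrowth _ _ _),
        ← toL2_schwartzPhase (linPhase_hasTemperateGrowth _), schwartzMultiplier_quadPhase_linPhase])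
  exact congrFun this f

theorem multiplier_quadPhase_action (t : ℝ) (c : Space n) (a : ℝ) (f : L2 n) :
    multiplier (quadPhase t c a) f
      = Complex.exp (-Complex.I * a) • multiplier (quadPhase t c 0) f := by
  have h : ∀ g : L2 n, phase (quadPhase t c a) g
      = Complex.exp (-Complex.I * a) • phase (quadPhase t c 0) g := fun g => by
    apply Lp.ext
    filter_upwards [phase_coeFn (quadPhase t c a) g, phase_coeFn (quadPhase t c 0) g,
      Lp.coeFn_smul (Complex.exp (-Complex.I * a)) (phase (quadPhase t c 0) g)] with x h1 h2 h3
    rw [h1, h3, Pi.smul_apply, h2, smul_eq_mul, ← mul_assoc, ← Complex.exp_add, quadPhase_apply,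
      quadPhase_apply]
    congr 2
    push_cast; ring
  rw [multiplier_apply, h, FourierTransform.fourierInv_smul, ← multiplier_apply]

/-- The centre, at time `t`, of a wave packet of momentum `w` starting at the origin at time
`s`. -/
def centre (E : ℝ → Space n) (s : ℝ) (w : Space n) (t : ℝ) : Space n :=
  displacement E t - displacement E s + (t - s) • (w - drift E s)

theorem continuous_centre {E : ℝ → Space n} (hE : LocallyIntegrable E volume) (s : ℝ)
    (w : Space n) : Continuous (centre E s w) := by
  have := continuous_displacement hE
  unfold centre
  fun_prop

/-- Boosting by w - b(s) turns the translation part of the free motion into `centre`. The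
accumulated action a enters only as a scalar of modulus 1, independent of f, so its value need not
be recorded. -/
theorem exists_free_evolution_eq (E : ℝ → Space n) (s : ℝ) (w : Space n) (t : ℝ) :
    ∃ a : ℝ, ∀ f : L2 n, frame E t ((frame E s).symm (phase (linPhase w) f))
      = phase (linPhase (drift E t + (w - drift E s)))
        (multiplier (quadPhase (t - s) (centre E s w t) a) f) := by
  refine ⟨action E t - action E s + inner ℝ (displacement E t - displacement E s) (w - drift E s)
    + (t - s) * ‖w - drift E s‖ ^ 2 / 2, fun f => ?_⟩
  have h1 : ∀ g : L2 n, (frame E s).symm g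
      = multiplier (-framePhase E s) (phase (-linPhase (drift E s)) g) := fun g => by
    rw [LinearIsometryEquiv.symm_apply_eq, frame_apply, multiplier_multiplier, add_neg_cancel,
      multiplier_zero, phase_phase, add_neg_cancel, phase_zero]
  have h2 : framePhase E t + -framePhase E s = quadPhase (t - s)
      (displacement E t - displacement E s) (action E t - action E s) := by
    rw [framePhase, framePhase, ← quadPhase_neg, ← quadPhase_add]
    simp only [sub_eq_add_neg]
  rw [h1, frame_apply, multiplier_multiplier, phase_phase, h2, ← linPhase_neg, ← linPhase_add,
    neg_add_eq_sub, multiplier_quadPhase_linPhase, phase_phase, ← linPhase_add, ← centre]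

theorem schwartzMultiplier_quadPhase_zero_apply (c : Space n) (f : 𝓢(Space n, ℂ)) (x : Space n) :
    schwartzMultiplier (quadPhase 0 c 0) f x = f (x - c) := by
  have h : ∀ y, f y = 𝓕⁻ (𝓕 f : 𝓢(Space n, ℂ)) y := fun y => by
    rw [FourierTransform.fourierInv_fourier_eq]
  rw [h (x - c), schwartzMultiplier_apply, SchwartzMap.fourierInv_coe, SchwartzMap.fourierInv_coe,
    Real.fourierInv_eq', Real.fourierInv_eq']
  congr 1; ext ξ
  rw [schwartzPhase_apply (quadPhase_hasTemperateGrowth _ _ _), smul_eq_mul, smul_eq_mul,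
    ← mul_assoc, ← Complex.exp_add, quadPhase_apply, inner_sub_right, real_inner_comm ξ c]
  congr 2
  push_cast; ring

theorem boundedMul_phase (m : Space n →ᵇ ℂ) (θ : C(Space n, ℝ)) (f : L2 n) :
    boundedMul m (phase θ f) = phase θ (boundedMul m f) := by
  apply Lp.ext
  filter_upwards [boundedMul_coeFn m (phase θ f), boundedMul_coeFn m f, phase_coeFn θ f,
    phase_coeFn θ (boundedMul m f)] with x h1 h2 h3 h4
  rw [h1, h3, h4, h2]; ring

theorem boundedMul_sub (m m' : Space n →ᵇ ℂ) (f : L2 n) :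
    boundedMul (m - m') f = boundedMul m f - boundedMul m' f := by
  apply Lp.ext
  filter_upwards [boundedMul_coeFn m f, boundedMul_coeFn m' f, boundedMul_coeFn (m - m') f,
    Lp.coeFn_sub (boundedMul m f) (boundedMul m' f)] with x h1 h2 h3 h4
  rw [h3, h4, Pi.sub_apply, h1, h2]; simp [sub_mul]

theorem boundedMul_const (z : ℂ) (f : L2 n) :
    boundedMul (BoundedContinuousFunction.const (Space n) z) f = z • f := by
  apply Lp.ext
  filter_upwards [boundedMul_coeFn (BoundedContinuousFunction.const (Space n) z) f,
    Lp.coeFn_smul z f] with x h1 h2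
  rw [h1, h2]; simp

end Galilei

/-! ### Weighted bounds on freely moving packets. -/

section Moments

variable {n : ℕ}

/-- A pointwise bound by a combination of `L²` functions gives a bound of norms. -/
theorem norm_le_sum_of_ae_le {ι : Type*} (s : Finset ι) (f : L2 n) {a : ι → ℝ} (ha : ∀ i, 0 ≤ a i)
    (g : ι → L2 n) (h : ∀ᵐ x, ‖f x‖ ≤ ∑ i ∈ s, a i * ‖g i x‖) : ‖f‖ ≤ ∑ i ∈ s, a i * ‖g i‖ := by
  let G : ι → Lp ℝ 2 (volume : Measure (Space n)) := fun i => (Lp.memLp (g i)).norm.toLp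
  have hG : ∀ i, G i =ᵐ[volume] fun x => ‖g i x‖ := fun i => MemLp.coeFn_toLp _
  have hGn : ∀ i, ‖G i‖ = ‖g i‖ := fun i => by
    rw [Lp.norm_toLp, Lp.norm_def, eLpNorm_norm]
  have h1 : ‖f‖ ≤ ‖∑ i ∈ s, a i • G i‖ := by
    apply Lp.norm_le_norm_of_ae_le
    have h2 : ∀ᵐ x, ∀ i ∈ s, (a i • G i : Lp ℝ 2 (volume : Measure (Space n))) x = a i * ‖g i x‖ :=
      (Finset.eventually_all s).2 fun i _ => by
        filter_upwards [Lp.coeFn_smul (a i) (G i), hG i] with x e1 e2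
        rw [e1, Pi.smul_apply, e2, smul_eq_mul]
    filter_upwards [h, h2, Lp.coeFn_finsetSum s fun i => a i • G i] with x e1 e2 e3
    rw [e3, Finset.sum_apply, Finset.sum_congr rfl e2]
    exact e1.trans (le_abs_self _)
  refine h1.trans ((norm_sum_le _ _).trans (Finset.sum_le_sum fun i _ => ?_))
  rw [norm_smul, hGn, Real.norm_eq_abs, abs_of_nonneg (ha i)]

/-- A pointwise bound of a product by a combination of Schwartz functions. -/
theorem norm_boundedMul_le_sum {ι : Type*} (s : Finset ι) (m : Space n →ᵇ ℂ) (f : 𝓢(Space n, ℂ))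
    {a : ι → ℝ} (ha : ∀ i, 0 ≤ a i) (g : ι → 𝓢(Space n, ℂ))
    (h : ∀ x, ‖m x‖ * ‖f x‖ ≤ ∑ i ∈ s, a i * ‖g i x‖) :
    ‖boundedMul m (toL2 f)‖ ≤ ∑ i ∈ s, a i * ‖toL2 (g i)‖ := by
  apply norm_le_sum_of_ae_le s _ ha
  have h2 : ∀ᵐ x, ∀ i ∈ s, (toL2 (g i)) x = g i x :=
    (Finset.eventually_all s).2 fun i _ => toL2_coeFn (g i)
  filter_upwards [h2, boundedMul_coeFn m (toL2 f), toL2_coeFn f] with x e1 e2 e3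
  rw [e2, e3, norm_mul]
  refine (h x).trans (Finset.sum_le_sum fun i hi => ?_)
  rw [e1 i hi]

/-- The position operator `⟪w, x⟫` at time `τ` of the free motion, in the Heisenberg picture. -/
def movingCoord (w : Space n) (τ : ℝ) (f : 𝓢(Space n, ℂ)) : 𝓢(Space n, ℂ) :=
  coordMul w f + (τ : ℂ) • momentum w f

theorem momentum_smul (w : Space n) (c : ℂ) (f : 𝓢(Space n, ℂ)) :
    momentum w (c • f) = c • momentum w f := by
  rw [momentum, momentum, LineDeriv.lineDerivOp_smul, smul_comm]

theorem momentum_add (w : Space n) (f g : 𝓢(Space n, ℂ)) :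
    momentum w (f + g) = momentum w f + momentum w g := by
  rw [momentum, momentum, momentum, LineDeriv.lineDerivOp_add, smul_add]

theorem movingCoord_add (w : Space n) (τ : ℝ) (f g : 𝓢(Space n, ℂ)) :
    movingCoord w τ (f + g) = movingCoord w τ f + movingCoord w τ g := by
  simp only [movingCoord, map_add, momentum_add, smul_add]; abel

theorem movingCoord_smul (w : Space n) (τ : ℝ) (c : ℂ) (f : 𝓢(Space n, ℂ)) :
    movingCoord w τ (c • f) = c • movingCoord w τ f := by
  simp only [movingCoord, map_smul, momentum_smul, smul_add, smul_comm c]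

/-- Each application of x_w + τ p_w costs at most a factor 1 + |τ|. The innermost application is
peeled off, so the induction runs over all Schwartz functions. -/
theorem exists_norm_iterate_movingCoord_le (w : Space n) (k : ℕ) (f : 𝓢(Space n, ℂ)) :
    ∃ C, 0 ≤ C ∧ ∀ τ : ℝ, ‖toL2 ((movingCoord w τ)^[k] f)‖ ≤ C * (1 + |τ|) ^ k := by
  have hadd : ∀ k τ f g, (movingCoord w τ)^[k] (f + g)
      = (movingCoord w τ)^[k] f + (movingCoord w τ)^[k] g := fun k τ f g => by
    induction k with
    | zero => rfl
    | succ k ih => simp only [Function.iterate_succ_apply', ih, movingCoord_add]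
  have hsmul : ∀ k τ (c : ℂ) f, (movingCoord w τ)^[k] (c • f) = c • (movingCoord w τ)^[k] f :=
    fun k τ c f => by
    induction k with
    | zero => rfl
    | succ k ih => simp only [Function.iterate_succ_apply', ih, movingCoord_smul]
  induction k generalizing f with
  | zero => exact ⟨‖toL2 f‖, norm_nonneg _, fun τ => by simp⟩
  | succ k ih =>
    obtain ⟨C1, h1, H1⟩ := ih (coordMul w f)
    obtain ⟨C2, h2, H2⟩ := ih (momentum w f)
    refine ⟨C1 + C2, by positivity, fun τ => ?_⟩
    rw [Function.iterate_succ_apply, movingCoord, hadd, hsmul, map_add, map_smul]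
    refine (norm_add_le _ _).trans ?_
    rw [norm_smul, Complex.norm_real, Real.norm_eq_abs, pow_succ]
    have e1 := H1 τ
    have e2 := mul_le_mul_of_nonneg_left (H2 τ) (abs_nonneg τ)
    have e3 : 0 ≤ C1 * (1 + |τ|) ^ k * |τ| := by positivity
    have e4 : 0 ≤ C2 * (1 + |τ|) ^ k := by positivity
    nlinarith

theorem coordMul_sub_schwartzMultiplier (t : ℝ) (c : Space n) (a : ℝ) (w : Space n)
    (f : 𝓢(Space n, ℂ)) :
    coordMul w (schwartzMultiplier (quadPhase t c a) f)
        - ((inner ℝ w c : ℝ) : ℂ) • schwartzMultiplier (quadPhase t c a) f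
      = schwartzMultiplier (quadPhase t c a) (movingCoord w t f) := by
  rw [coordMul_schwartzMultiplier, map_add, map_smul, movingCoord, add_sub_cancel_right]

/-- Powers of the distance from the centre after the free motion become operators acting on the
packet before it. Polynomial weights on moving packets therefore reduce to norms of fixed Schwartz
functions. -/
theorem schwartzMultiplier_iterate_movingCoord_apply (t : ℝ) (c : Space n) (a : ℝ) (w : Space n)
    (f : 𝓢(Space n, ℂ)) (k : ℕ) (x : Space n) :
    schwartzMultiplier (quadPhase t c a) ((movingCoord w t)^[k] f) x
      = ((inner ℝ (x - c) w : ℝ) : ℂ) ^ k * schwartzMultiplier (quadPhase t c a) f x := by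
  induction k with
  | zero => simp
  | succ k ih =>
    rw [Function.iterate_succ_apply', ← coordMul_sub_schwartzMultiplier, _root_.sub_apply,
      _root_.smul_apply, coordMul_apply, ih, inner_sub_left, real_inner_comm w c, smul_eq_mul]
    push_cast; ring

end Moments

/-! ### Decay and oscillation of the potential on moving packets. -/

section PotentialBounds

variable {n : ℕ}

/-- The bounds on the potential, and on its oscillation around a point, used in the estimates. -/
structure PotentialBounds (δ C : ℝ) (V : ℝ → Space n → ℝ) : Prop where
  continuous : Continuous fun z : ℝ × Space n => V z.1 z.2
  nonneg : 0 ≤ C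
  decay : ∀ t x, |V t x| ≤ C * (1 + ‖x‖) ^ (-δ)
  oscillation : ∀ t x c, |V t x - V t c|
    ≤ C * (1 + ‖c‖) ^ (-(δ + 1)) * ‖x - c‖ + C * (1 + ‖c‖) ^ (-4 : ℝ) * ‖x - c‖ ^ 4

theorem rpow_neg_le_rpow_neg_of_le {a b s s' : ℝ} (ha : 1 ≤ a) (hab : a ≤ b) (h : s' ≤ s)
    (hs : 0 ≤ s) : b ^ (-s) ≤ a ^ (-s') := by
  refine (Real.rpow_le_rpow_of_nonpos (by linarith) hab (by linarith)).trans ?_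
  exact Real.rpow_le_rpow_of_exponent_le ha (by linarith)

theorem PotentialBounds.mono {δ δ' C : ℝ} {V : ℝ → Space n → ℝ} (h : PotentialBounds δ C V)
    (hδ : δ' ≤ δ) (h0 : 0 ≤ δ) : PotentialBounds δ' C V where
  continuous := h.continuous
  nonneg := h.nonneg
  decay t x := (h.decay t x).trans (mul_le_mul_of_nonneg_left
    (rpow_neg_le_rpow_neg_of_le (by linarith [norm_nonneg x]) le_rfl hδ h0) h.nonneg)
  oscillation t x c := (h.oscillation t x c).trans (by
    gcongr ?_ + _
    refine mul_le_mul_of_nonneg_right (mul_le_mul_of_nonneg_left ?_ h.nonneg) (norm_nonneg _)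
    exact rpow_neg_le_rpow_neg_of_le (by linarith [norm_nonneg c]) le_rfl (by linarith) (by linarith))

theorem one_add_sq_rpow_le {δ r : ℝ} (hδ : 0 ≤ δ) (hr : 0 ≤ r) :
    (1 + r ^ 2) ^ (-δ / 2) ≤ 2 ^ δ * (1 + r) ^ (-δ) := by
  have h1 : ((1 + r) / 2) ^ 2 ≤ 1 + r ^ 2 := by nlinarith [sq_nonneg (r - 1)]
  have h2 : (0 : ℝ) < (1 + r) / 2 := by linarith
  calc (1 + r ^ 2) ^ (-δ / 2) ≤ (((1 + r) / 2) ^ 2) ^ (-δ / 2) :=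
        Real.rpow_le_rpow_of_nonpos (by positivity) h1 (by linarith)
    _ = ((1 + r) / 2) ^ (-δ) := by
        rw [← Real.rpow_natCast, ← Real.rpow_mul h2.le]; congr 1; push_cast; ring
    _ = 2 ^ δ * (1 + r) ^ (-δ) := by
        rw [Real.div_rpow (by linarith) zero_le_two, Real.rpow_neg zero_le_two, div_inv_eq_mul,
          mul_comm]

/-- The oscillation bound joins a gradient estimate near c to plain boundedness far from it. The
power 4 is large enough that, after the spreading (1 + |τ|)^4 of the packet, the far term is no
worse than the gradient term. -/
theorem IsPeriodicPotential.exists_potentialBounds {δ : ℝ} {V : ℝ → Space n → ℝ} (hδ : 0 ≤ δ)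
    (hV : IsPeriodicPotential δ V) : ∃ C, PotentialBounds δ C V := by
  obtain ⟨C0, h0⟩ := hV.decay 0 0
  obtain ⟨C1, h1⟩ := hV.decay 0 1
  have hc : Continuous fun z : ℝ × Space n => V z.1 z.2 := hV.smooth.continuous
  have hd : ∀ t, Differentiable ℝ (V t) := fun t =>
    (hV.smooth.comp (contDiff_prodMk_right t)).differentiable (by simp)
  simp only [iteratedDeriv_zero, norm_iteratedFDeriv_zero, Nat.cast_zero, add_zero,
    norm_iteratedFDeriv_one, Nat.cast_one, Real.norm_eq_abs] at h0 h1
  have hC0 : 0 ≤ C0 := by simpa using (abs_nonneg _).trans (h0 0 0)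
  have hC1 : 0 ≤ C1 := by simpa using (norm_nonneg _).trans (h1 0 0)
  have h0' : ∀ t x, |V t x| ≤ C0 * 2 ^ δ * (1 + ‖x‖) ^ (-δ) := fun t x => (h0 t x).trans (by
    rw [mul_assoc]; exact mul_le_mul_of_nonneg_left (one_add_sq_rpow_le hδ (norm_nonneg _)) hC0)
  have h1' : ∀ t x, ‖fderiv ℝ (V t) x‖ ≤ C1 * 2 ^ (δ + 1) * (1 + ‖x‖) ^ (-(δ + 1)) :=
    fun t x => (h1 t x).trans (by
      rw [mul_assoc]
      exact mul_le_mul_of_nonneg_left (one_add_sq_rpow_le (by linarith) (norm_nonneg _)) hC1)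
  have hle : ∀ t x, |V t x| ≤ C0 * 2 ^ δ := fun t x => (h0' t x).trans
    (mul_le_of_le_one_right (by positivity)
      (Real.rpow_le_one_of_one_le_of_nonpos (by linarith [norm_nonneg x]) (by linarith)))
  set A : ℝ := C1 * 2 ^ (δ + 1) * 2 ^ (δ + 1) with hA
  set B : ℝ := 2 * (C0 * 2 ^ δ) * 2 ^ 4 with hB
  have hA0 : 0 ≤ A := by positivity
  have hB0 : 0 ≤ B := by positivity
  have hD0 : 0 ≤ C0 * 2 ^ δ := by positivity
  refine ⟨C0 * 2 ^ δ + A + B, hc, by positivity, fun t x => (h0' t x).trans ?_, fun t x c => ?_⟩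
  · exact mul_le_mul_of_nonneg_right (by linarith) (by positivity)
  have hN : 0 < 1 + ‖c‖ := by positivity
  have hp1 : 0 ≤ (1 + ‖c‖) ^ (-(δ + 1)) * ‖x - c‖ := by positivity
  have hp2 : 0 ≤ (1 + ‖c‖) ^ (-4 : ℝ) * ‖x - c‖ ^ 4 := by positivity
  suffices h : |V t x - V t c| ≤ A * ((1 + ‖c‖) ^ (-(δ + 1)) * ‖x - c‖)
      + B * ((1 + ‖c‖) ^ (-4 : ℝ) * ‖x - c‖ ^ 4) by
    rw [mul_assoc, mul_assoc]
    refine h.trans (add_le_add (mul_le_mul_of_nonneg_right (by linarith) hp1)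
      (mul_le_mul_of_nonneg_right (by linarith) hp2))
  -- Within this distance every point y of the ball has 1 + ‖y‖ ≥ (1 + ‖c‖)/2, so the gradient
  -- decays as it does at c. Beyond it (2‖x - c‖/(1 + ‖c‖))^4 ≥ 1 and the supremum of V is enough.
  rcases le_or_gt ‖x - c‖ ((1 + ‖c‖) / 2) with h | h
  · have hb : ∀ y ∈ Metric.closedBall c ‖x - c‖,
        ‖fderiv ℝ (V t) y‖ ≤ A * (1 + ‖c‖) ^ (-(δ + 1)) := fun y hy => by
      rw [Metric.mem_closedBall, dist_eq_norm] at hy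
      have h2 : (1 + ‖c‖) / 2 ≤ 1 + ‖y‖ := by
        have := norm_sub_norm_le c y
        rw [norm_sub_rev] at this
        linarith
      refine (h1' t y).trans ?_
      calc C1 * 2 ^ (δ + 1) * (1 + ‖y‖) ^ (-(δ + 1))
          ≤ C1 * 2 ^ (δ + 1) * ((1 + ‖c‖) / 2) ^ (-(δ + 1)) :=
            mul_le_mul_of_nonneg_left
              (Real.rpow_le_rpow_of_nonpos (by positivity) h2 (by linarith)) (by positivity)
        _ = A * (1 + ‖c‖) ^ (-(δ + 1)) := by
            rw [Real.div_rpow hN.le zero_le_two, Real.rpow_neg zero_le_two, div_inv_eq_mul, hA]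
            ring
    have h3 := (convex_closedBall c ‖x - c‖).norm_image_sub_le_of_norm_fderiv_le
      (fun y _ => (hd t) y) hb (x := c) (y := x) (Metric.mem_closedBall_self (norm_nonneg _))
      (by rw [Metric.mem_closedBall, dist_eq_norm])
    rw [Real.norm_eq_abs, mul_assoc] at h3
    have := mul_nonneg hB0 hp2
    linarith
  · have h4 : 1 ≤ 2 ^ 4 * ((1 + ‖c‖) ^ (-4 : ℝ) * ‖x - c‖ ^ 4) := by
      have e1 : (1 + ‖c‖) ^ (-4 : ℝ) = ((1 + ‖c‖) ^ 4)⁻¹ := by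
        rw [Real.rpow_neg hN.le]; norm_cast
      have e2 : (1 + ‖c‖) ^ 4 ≤ (2 * ‖x - c‖) ^ 4 := pow_le_pow_left₀ hN.le (by linarith) 4
      rw [e1, ← mul_assoc, mul_comm ((2 : ℝ) ^ 4), mul_assoc, ← mul_pow, inv_mul_eq_div,
        one_le_div (by positivity)]
      exact e2
    have h5 : |V t x - V t c| ≤ 2 * (C0 * 2 ^ δ) :=
      (abs_sub _ _).trans (by linarith [hle t x, hle t c])
    have h6 := mul_le_mul_of_nonneg_left h4 (by positivity : 0 ≤ 2 * (C0 * 2 ^ δ))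
    have := mul_nonneg hA0 hp1
    rw [mul_one, ← mul_assoc] at h6
    linarith

/-- The potential at fixed time, as a bounded function. -/
def PotentialBounds.toBCF {δ C : ℝ} {V : ℝ → Space n → ℝ} (h : PotentialBounds δ C V) (hδ : 0 ≤ δ)
    (t : ℝ) : Space n →ᵇ ℂ :=
  BoundedContinuousFunction.ofNormedAddCommGroup (fun x => (V t x : ℂ))
    (Complex.continuous_ofReal.comp (h.continuous.comp (Continuous.prodMk_right t))) C fun x => by
      rw [Complex.norm_real]
      exact (h.decay t x).trans (mul_le_of_le_one_right h.nonneg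
        (Real.rpow_le_one_of_one_le_of_nonpos (by linarith [norm_nonneg x]) (by linarith)))

section

variable {δ C : ℝ} {V : ℝ → Space n → ℝ} (h : PotentialBounds δ C V) (hδ : 0 ≤ δ)

@[simp] theorem PotentialBounds.toBCF_apply (t : ℝ) (x : Space n) :
    h.toBCF hδ t x = (V t x : ℂ) := rfl

theorem PotentialBounds.norm_toBCF_le (t : ℝ) : ‖h.toBCF hδ t‖ ≤ C :=
  (BoundedContinuousFunction.norm_le h.nonneg).2 fun x => by
    rw [h.toBCF_apply hδ, Complex.norm_real]
    exact (h.decay t x).trans (mul_le_of_le_one_right h.nonneg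
      (Real.rpow_le_one_of_one_le_of_nonpos (by linarith [norm_nonneg x]) (by linarith)))

theorem PotentialBounds.continuous_toBCF (x : Space n) : Continuous fun t => h.toBCF hδ t x :=
  Complex.continuous_ofReal.comp (h.continuous.comp (Continuous.prodMk_left x))

/-- The potential minus its value at the point `c`. -/
def PotentialBounds.centred (t : ℝ) (c : Space n) : Space n →ᵇ ℂ :=
  h.toBCF hδ t - BoundedContinuousFunction.const (Space n) (V t c : ℂ)

@[simp] theorem PotentialBounds.centred_apply (t : ℝ) (c x : Space n) :
    h.centred hδ t c x = ((V t x - V t c : ℝ) : ℂ) := by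
  simp [PotentialBounds.centred]

end

theorem norm_pow_four_le (x : Space n) : ‖x‖ ^ 4 ≤ n * ∑ j, |x j| ^ 4 := by
  have h1 : ‖x‖ ^ 2 = ∑ j, (x j) ^ 2 := by
    rw [EuclideanSpace.norm_sq_eq]; simp
  have h2 := sq_sum_le_card_mul_sum_sq (s := Finset.univ) (f := fun j : Fin n => (x j) ^ 2)
  calc ‖x‖ ^ 4 = (‖x‖ ^ 2) ^ 2 := by ring
    _ ≤ n * ∑ j, ((x j) ^ 2) ^ 2 := by rw [h1]; simpa using h2
    _ = n * ∑ j, |x j| ^ 4 := by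
        congr 1; refine Finset.sum_congr rfl fun j _ => ?_
        rw [← sq_abs, abs_pow, ← pow_mul]

theorem norm_le_sum_abs (x : Space n) : ‖x‖ ≤ ∑ j, |x j| := by
  conv_lhs => rw [← (EuclideanSpace.basisFun (Fin n) ℝ).sum_repr x]
  refine (norm_sum_le _ _).trans (Finset.sum_le_sum fun j _ => ?_)
  rw [norm_smul]
  simp

/-- The oscillation of the potential on a freely moving wave packet. -/
theorem PotentialBounds.exists_norm_centred_le {δ C : ℝ} {V : ℝ → Space n → ℝ}
    (h : PotentialBounds δ C V) (hδ : 0 ≤ δ) (f : 𝓢(Space n, ℂ)) :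
    ∃ K, 0 ≤ K ∧ ∀ (t τ : ℝ) (c : Space n) (a : ℝ),
      ‖boundedMul (h.centred hδ t c) (multiplier (quadPhase τ c a) (toL2 f))‖
        ≤ K * ((1 + ‖c‖) ^ (-(δ + 1)) * (1 + |τ|) + (1 + ‖c‖) ^ (-4 : ℝ) * (1 + |τ|) ^ 4) := by
  choose K1 hK1 H1 using fun j : Fin n =>
    exists_norm_iterate_movingCoord_le (EuclideanSpace.single j (1 : ℝ)) 1 f
  choose K4 hK4 H4 using fun j : Fin n =>
    exists_norm_iterate_movingCoord_le (EuclideanSpace.single j (1 : ℝ)) 4 f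
  have hs1 : 0 ≤ ∑ j, K1 j := Finset.sum_nonneg fun j _ => hK1 j
  have hs4 : 0 ≤ ∑ j, K4 j := Finset.sum_nonneg fun j _ => hK4 j
  have hC := h.nonneg
  refine ⟨C * ∑ j, K1 j + C * n * ∑ j, K4 j, by positivity, fun t τ c a => ?_⟩
  have hN : 0 < 1 + ‖c‖ := by positivity
  set p1 : ℝ := (1 + ‖c‖) ^ (-(δ + 1)) with hp1
  set p4 : ℝ := (1 + ‖c‖) ^ (-4 : ℝ) with hp4
  have hp1' : 0 ≤ p1 := by positivity
  have hp4' : 0 ≤ p4 := by positivity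
  set G := schwartzMultiplier (quadPhase τ c a) with hG
  have hθ := quadPhase_hasTemperateGrowth τ c a
  have hval : ∀ (j : Fin n) (k : ℕ) (x : Space n),
      ‖G ((movingCoord (EuclideanSpace.single j (1 : ℝ)) τ)^[k] f) x‖ = |(x - c) j| ^ k * ‖G f x‖ :=
    fun j k x => by
      rw [hG, schwartzMultiplier_iterate_movingCoord_apply, norm_mul, norm_pow, Complex.norm_real,
        inner_single_one, Real.norm_eq_abs]
  have hnorm : ∀ g, ‖toL2 (G g)‖ = ‖toL2 g‖ := fun g => by
    rw [hG, toL2_schwartzMultiplier hθ, LinearIsometryEquiv.norm_map]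
  -- The distances ‖x - c‖ and ‖x - c‖^4 are split into coordinates, and each coordinate power times
  -- the packet is a packet with `movingCoord` applied first.
  have key := norm_boundedMul_le_sum Finset.univ (h.centred hδ t c) (G f)
    (a := Sum.elim (fun _ : Fin n => C * p1) (fun _ : Fin n => C * p4 * n))
    (by rintro (j | j) <;> simp <;> positivity)
    (Sum.elim (fun j => G ((movingCoord (EuclideanSpace.single j (1 : ℝ)) τ)^[1] f))
      (fun j => G ((movingCoord (EuclideanSpace.single j (1 : ℝ)) τ)^[4] f)))
    (fun x => by
      rw [h.centred_apply, Complex.norm_real, Real.norm_eq_abs, Fintype.sum_sum_type]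
      simp only [Sum.elim_inl, Sum.elim_inr, hval, pow_one]
      rw [← Finset.mul_sum, ← Finset.mul_sum, ← Finset.sum_mul, ← Finset.sum_mul, ← mul_assoc,
        ← mul_assoc, ← add_mul]
      refine mul_le_mul_of_nonneg_right ((h.oscillation t x c).trans (add_le_add ?_ ?_))
        (norm_nonneg _)
      · exact mul_le_mul_of_nonneg_left (norm_le_sum_abs _) (by positivity)
      · rw [mul_assoc (C * p4)]
        exact mul_le_mul_of_nonneg_left (norm_pow_four_le _) (by positivity))
  rw [← toL2_schwartzMultiplier hθ, ← hG]
  refine key.trans ?_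
  rw [Fintype.sum_sum_type]
  simp only [Sum.elim_inl, Sum.elim_inr, hnorm]
  rw [← Finset.mul_sum, ← Finset.mul_sum]
  have e1 : ∑ j, ‖toL2 ((movingCoord (EuclideanSpace.single j (1 : ℝ)) τ)^[1] f)‖
      ≤ (∑ j, K1 j) * (1 + |τ|) := by
    rw [Finset.sum_mul]
    exact Finset.sum_le_sum fun j _ => by simpa using H1 j τ
  have e4 : ∑ j, ‖toL2 ((movingCoord (EuclideanSpace.single j (1 : ℝ)) τ)^[4] f)‖
      ≤ (∑ j, K4 j) * (1 + |τ|) ^ 4 := by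
    rw [Finset.sum_mul]
    exact Finset.sum_le_sum fun j _ => H4 j τ
  have q1 : 0 ≤ p1 * (1 + |τ|) := by positivity
  have q4 : 0 ≤ p4 * (1 + |τ|) ^ 4 := by positivity
  calc _ ≤ C * p1 * ((∑ j, K1 j) * (1 + |τ|)) + C * p4 * n * ((∑ j, K4 j) * (1 + |τ|) ^ 4) :=
        add_le_add (mul_le_mul_of_nonneg_left e1 (by positivity))
          (mul_le_mul_of_nonneg_left e4 (by positivity))
    _ = (C * ∑ j, K1 j) * (p1 * (1 + |τ|)) + (C * n * ∑ j, K4 j) * (p4 * (1 + |τ|) ^ 4) := by ring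
    _ ≤ _ := by
        have hA : 0 ≤ C * ∑ j, K1 j := by positivity
        have hB : 0 ≤ C * n * ∑ j, K4 j := by positivity
        generalize C * ∑ j, K1 j = A at *
        generalize C * n * ∑ j, K4 j = B at *
        nlinarith [mul_nonneg hA q4, mul_nonneg hB q1]

end PotentialBounds

/-! ### Suppression of the slow part of a packet. -/

section BoostedPackets

variable {n : ℕ}

/-- The operator `1 + ε p_w`. -/
def boost (w : Space n) (ε : ℝ) (f : 𝓢(Space n, ℂ)) : 𝓢(Space n, ℂ) :=
  f + (ε : ℂ) • momentum w f

theorem boost_add (w : Space n) (ε : ℝ) (f g : 𝓢(Space n, ℂ)) :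
    boost w ε (f + g) = boost w ε f + boost w ε g := by
  simp only [boost, momentum_add, smul_add]; abel

theorem boost_smul (w : Space n) (ε : ℝ) (c : ℂ) (f : 𝓢(Space n, ℂ)) :
    boost w ε (c • f) = c • boost w ε f := by
  simp only [boost, momentum_smul, smul_add, smul_comm c]

theorem iterate_boost_add (w : Space n) (ε : ℝ) (k : ℕ) (f g : 𝓢(Space n, ℂ)) :
    (boost w ε)^[k] (f + g) = (boost w ε)^[k] f + (boost w ε)^[k] g := by
  induction k with
  | zero => rfl
  | succ k ih => simp only [Function.iterate_succ_apply', ih, boost_add]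

theorem iterate_boost_smul (w : Space n) (ε : ℝ) (k : ℕ) (c : ℂ) (f : 𝓢(Space n, ℂ)) :
    (boost w ε)^[k] (c • f) = c • (boost w ε)^[k] f := by
  induction k with
  | zero => rfl
  | succ k ih => simp only [Function.iterate_succ_apply', ih, boost_smul]

theorem iterate_boost_succ (w : Space n) (ε : ℝ) (k : ℕ) (f : 𝓢(Space n, ℂ)) :
    (boost w ε)^[k + 1] f = (boost w ε)^[k] f + (ε : ℂ) • (boost w ε)^[k] (momentum w f) := by
  rw [Function.iterate_succ_apply, boost, iterate_boost_add, iterate_boost_smul]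

theorem continuous_toL2_iterate_boost (w : Space n) (k : ℕ) (f : 𝓢(Space n, ℂ)) :
    Continuous fun ε : ℝ => toL2 ((boost w ε)^[k] f) := by
  induction k generalizing f with
  | zero => exact (continuous_const : Continuous fun _ : ℝ => toL2 f)
  | succ k ih =>
    simp only [iterate_boost_succ, map_add, map_smul]
    have h1 := ih f
    have h2 := ih (momentum w f)
    fun_prop

theorem iterate_boost_zero (w : Space n) (k : ℕ) (f : 𝓢(Space n, ℂ)) :
    (boost w 0)^[k] f = f := by
  induction k with
  | zero => rfl
  | succ k ih => rw [Function.iterate_succ_apply', ih, boost]; simp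

/-- A bound valid for all Schwartz functions is uniform under small boosts. -/
theorem exists_norm_iterate_boost_le {I : Type*} {T : I → L2 n →L[ℂ] L2 n} {b : I → ℝ}
    (h : ∀ f : 𝓢(Space n, ℂ), ∃ K, 0 ≤ K ∧ ∀ i, ‖T i (toL2 f)‖ ≤ K * b i)
    (w : Space n) (k : ℕ) (f : 𝓢(Space n, ℂ)) :
    ∃ K, 0 ≤ K ∧ ∀ i (ε : ℝ), 0 ≤ ε → ε ≤ 1 → ‖T i (toL2 ((boost w ε)^[k] f))‖ ≤ K * b i := by
  induction k generalizing f with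
  | zero =>
    obtain ⟨K, hK, H⟩ := h f
    exact ⟨K, hK, fun i ε _ _ => H i⟩
  | succ k ih =>
    obtain ⟨K1, h1, H1⟩ := ih f
    obtain ⟨K2, h2, H2⟩ := ih (momentum w f)
    refine ⟨K1 + K2, by positivity, fun i ε e0 e1 => ?_⟩
    rw [iterate_boost_succ, map_add, map_smul, map_add, map_smul]
    refine (norm_add_le _ _).trans ?_
    rw [norm_smul, Complex.norm_real, Real.norm_eq_abs, abs_of_nonneg e0, add_mul]
    refine add_le_add (H1 i ε e0 e1) ?_
    calc _ ≤ 1 * (K2 * b i) := mul_le_mul e1 (H2 i ε e0 e1) (norm_nonneg _) zero_le_one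
      _ = _ := one_mul _

theorem exists_norm_toL2_iterate_boost_le (w : Space n) (k : ℕ) (f : 𝓢(Space n, ℂ)) :
    ∃ K, 0 ≤ K ∧ ∀ ε : ℝ, 0 ≤ ε → ε ≤ 1 → ‖toL2 ((boost w ε)^[k] f)‖ ≤ K := by
  obtain ⟨K, hK, H⟩ := exists_norm_iterate_boost_le (I := Unit)
    (T := fun _ => ContinuousLinearMap.id ℂ (L2 n)) (b := fun _ => 1)
    (fun f => ⟨‖toL2 f‖, norm_nonneg _, fun i => by simp⟩) w k f
  exact ⟨K, hK, fun ε h0 h1 => by simpa using H () ε h0 h1⟩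

theorem momentum_apply (w : Space n) (f : 𝓢(Space n, ℂ)) (x : Space n) :
    momentum w f x = -Complex.I * fderiv ℝ f x w := by
  rw [momentum, _root_.smul_apply, SchwartzMap.lineDerivOp_apply_eq_fderiv, smul_eq_mul]

theorem momentum_coordMul (w : Space n) (f : 𝓢(Space n, ℂ)) :
    momentum w (coordMul w f)
      = coordMul w (momentum w f) - (Complex.I * (‖w‖ ^ 2 : ℝ)) • f := by
  ext x
  have h1 : (⇑(coordMul w f) : Space n → ℂ) = fun x => ((inner ℝ x w : ℝ) : ℂ) * f x := by
    ext x; rw [coordMul_apply]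
  have h2 : HasFDerivAt (fun x : Space n => ((inner ℝ x w : ℝ) : ℂ))
      (Complex.ofRealCLM.comp (innerSL ℝ w)) x := by
    have := Complex.ofRealCLM.hasFDerivAt.comp x ((innerSL ℝ w).hasFDerivAt (x := x))
    simpa [Function.comp_def, real_inner_comm] using this
  rw [_root_.sub_apply, _root_.smul_apply, coordMul_apply, momentum_apply, momentum_apply, h1,
    (h2.fun_mul f.differentiableAt.hasFDerivAt).fderiv]
  simp
  ring

theorem coordMul_boost (w : Space n) (ε : ℝ) (f : 𝓢(Space n, ℂ)) :
    coordMul w (boost w ε f)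
      = boost w ε (coordMul w f) + (Complex.I * (ε * ‖w‖ ^ 2 : ℝ)) • f := by
  rw [boost, boost, momentum_coordMul, map_add, map_smul, smul_sub, smul_smul]
  push_cast
  rw [mul_left_comm]
  abel

/-- Since σ(1 + ε p_w) = σ + τ p_w, and τ p_w is the displacement ⟨x - c, w⟩ minus the initial
position, σ L(boost g) = r L(g) - L(Y g). Using this twice pays for σ². Moving Y past a boost loses
one factor and leaves κ; the third boost is there so that the commutator term multiplied by σ can be
converted once more. -/
theorem sq_mul_schwartzMultiplier_boost (w : Space n) {τ σ ε : ℝ} (hσ : σ * ε = τ) (c : Space n)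
    (a : ℝ) (f : 𝓢(Space n, ℂ)) (x : Space n) :
    let L := fun g => schwartzMultiplier (quadPhase τ c a) g x
    let Y := coordMul w
    let r : ℂ := ((inner ℝ (x - c) w + σ : ℝ) : ℂ)
    let κ : ℂ := Complex.I * (ε * ‖w‖ ^ 2 : ℝ)
    (σ : ℂ) ^ 2 * L ((boost w ε)^[3] f) = r ^ 2 * L (boost w ε f) - 2 * r * L (boost w ε (Y f))
      + L (boost w ε (Y (Y f))) - 3 * κ * r * L f + 3 * κ * L (Y f) := by
  intro L Y r κ
  have hadd : ∀ g h, L (g + h) = L g + L h := fun g h => by simp [L]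
  have hsmul : ∀ (z : ℂ) g, L (z • g) = z * L g := fun z g => by simp [L]
  have H : ∀ g, (σ : ℂ) * L (boost w ε g) = r * L g - L (Y g) := fun g => by
    have h1 := schwartzMultiplier_iterate_movingCoord_apply τ c a w g 1 x
    rw [Function.iterate_one, pow_one] at h1
    have h2 : L (movingCoord w τ g) = ((inner ℝ (x - c) w : ℝ) : ℂ) * L g := h1
    rw [movingCoord, hadd, hsmul] at h2
    rw [boost, hadd, hsmul]
    simp only [r, ← hσ] at h2 ⊢
    push_cast at h2 ⊢
    linear_combination h2
  have e1 : L ((boost w ε)^[3] f) = L (boost w ε (boost w ε (boost w ε f))) := rfl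
  have e2 : L (Y (boost w ε (boost w ε f)))
      = L (boost w ε (boost w ε (Y f))) + 2 * κ * L (boost w ε f) := by
    rw [coordMul_boost, coordMul_boost, boost_add, boost_smul, hadd, hadd, hsmul]
    simp only [κ, Y]
    ring
  have e3 : L (Y (boost w ε f)) = L (boost w ε (Y f)) + κ * L f := by
    rw [coordMul_boost, hadd, hsmul]
  have e4 : L (Y (boost w ε (Y f))) = L (boost w ε (Y (Y f))) + κ * L (Y f) := by
    rw [coordMul_boost, hadd, hsmul]
  have H1 := H (boost w ε (boost w ε f))
  have H2 := H (boost w ε f)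
  have H3 := H (boost w ε (Y f))
  have H4 := H f
  rw [e2] at H1
  rw [e3] at H2
  rw [e4] at H3
  rw [e1]
  linear_combination (σ : ℂ) * H1 + r * H2 - H3 - 2 * κ * H4

/-- Decay in the position N is traded for decay in the time scale S. Where N < S the loss is (S/N)^δ
≤ (S/N)², which uses δ ≤ 2 and matches the two powers of σ gained from the boosts. -/
theorem rpow_neg_le_mul_one_add {N S δ : ℝ} (hN : 1 ≤ N) (hS : 1 ≤ S) (h0 : 0 ≤ δ) (h2 : δ ≤ 2) :
    N ^ (-δ) ≤ S ^ (-δ) * (1 + S ^ 2 * (N ^ 2)⁻¹) := by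
  have hN0 : 0 < N := by linarith
  have hS0 : 0 < S := by linarith
  rcases le_total S N with h | h
  · refine (rpow_neg_le_rpow_neg_of_le hS h le_rfl h0).trans (le_mul_of_one_le_right (by positivity) ?_)
    have : 0 ≤ S ^ 2 * (N ^ 2)⁻¹ := by positivity
    linarith
  · have h3 : (S / N) ^ δ ≤ (S / N) ^ (2 : ℝ) :=
      Real.rpow_le_rpow_of_exponent_le ((one_le_div hN0).2 h) h2
    have h4 : N ^ (-δ) = S ^ (-δ) * (S / N) ^ δ := by
      rw [Real.div_rpow hS0.le hN0.le, Real.rpow_neg hN0.le, Real.rpow_neg hS0.le]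
      field_simp
    rw [h4]
    refine mul_le_mul_of_nonneg_left (h3.trans ?_) (by positivity)
    rw [Real.rpow_two, div_pow, div_eq_mul_inv]
    linarith

theorem one_add_sq_mul_inv_sq_mul_le {N σ F T : ℝ} (hN : 1 ≤ N) (hF : 0 ≤ F)
    (h : σ ^ 2 * F ≤ N ^ 2 * T) : (1 + |σ|) ^ 2 * (N ^ 2)⁻¹ * F ≤ 2 * F + 2 * T := by
  have hN2 : 0 < N ^ 2 := by positivity
  rw [mul_right_comm, ← div_eq_mul_inv, div_le_iff₀ hN2]
  have p1 : (1 + |σ|) ^ 2 ≤ 2 + 2 * σ ^ 2 := by nlinarith [sq_nonneg (|σ| - 1), sq_abs σ]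
  have p2 : 1 ≤ N ^ 2 := by nlinarith
  have p3 := mul_le_mul_of_nonneg_right p1 hF
  have p4 := mul_le_mul_of_nonneg_right p2 hF
  linarith

/-- The decay of the potential on a boosted wave packet. -/
theorem PotentialBounds.exists_norm_boost_le {δ C : ℝ} {V : ℝ → Space n → ℝ}
    (h : PotentialBounds δ C V) (hδ : 0 ≤ δ) (hδ2 : δ ≤ 2) (w : Space n) {R : ℝ} (hR : 0 ≤ R)
    (f : 𝓢(Space n, ℂ)) :
    ∃ K, 0 ≤ K ∧ ∀ (t τ σ ε : ℝ) (c : Space n) (a : ℝ), 0 ≤ ε → ε ≤ 1 → σ * ε = τ →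
      |σ - inner ℝ c w| ≤ R →
      ‖boundedMul (h.toBCF hδ t) (multiplier (quadPhase τ c a) (toL2 ((boost w ε)^[3] f)))‖
        ≤ K * (1 + |σ|) ^ (-δ) := by
  set Y := coordMul w with hY
  obtain ⟨K0, hK0, H0⟩ := exists_norm_toL2_iterate_boost_le w 3 f
  obtain ⟨K1, hK1, H1⟩ := exists_norm_toL2_iterate_boost_le w 1 f
  obtain ⟨K2, hK2, H2⟩ := exists_norm_toL2_iterate_boost_le w 1 (Y f)
  obtain ⟨K3, hK3, H3⟩ := exists_norm_toL2_iterate_boost_le w 1 (Y (Y f))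
  have hC := h.nonneg
  -- Chosen so that r = ⟨x, w⟩ + (σ - ⟨c, w⟩) satisfies |r| ≤ B(1 + ‖x‖).
  set B : ℝ := ‖w‖ + R with hB
  have hB0 : 0 ≤ B := by positivity
  refine ⟨C * (3 * K0 + 2 * B ^ 2 * K1 + 4 * B * K2 + 2 * K3 + 6 * ‖w‖ ^ 2 * B * ‖toL2 f‖
    + 6 * ‖w‖ ^ 2 * ‖toL2 (Y f)‖), by positivity, fun t τ σ ε c a e0 e1 hσ hc => ?_⟩
  have hθ := quadPhase_hasTemperateGrowth τ c a
  set G := schwartzMultiplier (quadPhase τ c a) with hG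
  have hnorm : ∀ g, ‖toL2 (G g)‖ = ‖toL2 g‖ := fun g => by
    rw [hG, toL2_schwartzMultiplier hθ, LinearIsometryEquiv.norm_map]
  set S : ℝ := (1 + |σ|) ^ (-δ) with hS
  have hS0 : 0 ≤ S := by positivity
  have key := norm_boundedMul_le_sum Finset.univ (h.toBCF hδ t) (G ((boost w ε)^[3] f))
    (a := ![C * S * 3, C * S * (2 * B ^ 2), C * S * (4 * B), C * S * 2,
      C * S * (6 * ‖w‖ ^ 2 * B), C * S * (6 * ‖w‖ ^ 2)])
    (by intro i; fin_cases i <;> simp <;> positivity)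
    ![G ((boost w ε)^[3] f), G (boost w ε f), G (boost w ε (Y f)), G (boost w ε (Y (Y f))), G f,
      G (Y f)]
    (fun x => by
      have hid := sq_mul_schwartzMultiplier_boost w hσ c a f x
      simp only [← hG, ← hY] at hid
      simp only [Fin.sum_univ_six, Matrix.cons_val]
      rw [h.toBCF_apply, Complex.norm_real, Real.norm_eq_abs]
      set N : ℝ := 1 + ‖x‖ with hN
      have hN1 : 1 ≤ N := by linarith [norm_nonneg x]
      set r : ℝ := inner ℝ (x - c) w + σ with hr
      have hr1 : |r| ≤ B * N := by
        have q1 : r = inner ℝ x w + (σ - inner ℝ c w) := by rw [hr, inner_sub_left]; ring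
        have q2 := abs_real_inner_le_norm x w
        rw [q1]
        refine (abs_add_le _ _).trans ?_
        nlinarith [norm_nonneg x, norm_nonneg w]
      generalize G ((boost w ε)^[3] f) x = F at *
      generalize G (boost w ε f) x = F1 at *
      generalize G (boost w ε (Y f)) x = F2 at *
      generalize G (boost w ε (Y (Y f))) x = F3 at *
      generalize G f x = F4 at *
      generalize G (Y f) x = F5 at *
      have hF : σ ^ 2 * ‖F‖ ≤ N ^ 2 * (B ^ 2 * ‖F1‖ + 2 * B * ‖F2‖ + ‖F3‖ + 3 * ‖w‖ ^ 2 * B * ‖F4‖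
          + 3 * ‖w‖ ^ 2 * ‖F5‖) := by
        have q0 : σ ^ 2 * ‖F‖ = ‖(σ : ℂ) ^ 2 * F‖ := by
          rw [norm_mul, norm_pow, Complex.norm_real, Real.norm_eq_abs, sq_abs]
        have q1 : ‖Complex.I * ((ε * ‖w‖ ^ 2 : ℝ) : ℂ)‖ ≤ ‖w‖ ^ 2 := by
          rw [norm_mul, Complex.norm_I, one_mul, Complex.norm_real, Real.norm_eq_abs,
            abs_of_nonneg (by positivity)]
          exact mul_le_of_le_one_left (by positivity) e1
        have q2 : ‖(r : ℂ)‖ ≤ B * N := by rwa [Complex.norm_real, Real.norm_eq_abs]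
        rw [q0, hid]
        generalize Complex.I * ((ε * ‖w‖ ^ 2 : ℝ) : ℂ) = κ at *
        have q3 : ‖(r : ℂ)‖ ^ 2 ≤ (B * N) ^ 2 := pow_le_pow_left₀ (norm_nonneg _) q2 2
        have q5 : N ≤ N ^ 2 := by nlinarith
        calc _ ≤ ‖(r : ℂ)‖ ^ 2 * ‖F1‖ + 2 * ‖(r : ℂ)‖ * ‖F2‖ + ‖F3‖ + 3 * ‖κ‖ * ‖(r : ℂ)‖ * ‖F4‖
              + 3 * ‖κ‖ * ‖F5‖ := by
              refine (norm_add_le _ _).trans (add_le_add ((norm_sub_le _ _).trans (add_le_add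
                ((norm_add_le _ _).trans (add_le_add ((norm_sub_le _ _).trans (add_le_add ?_ ?_))
                le_rfl)) ?_)) ?_) <;> simp
          _ ≤ (B * N) ^ 2 * ‖F1‖ + 2 * (B * N) * ‖F2‖ + ‖F3‖ + 3 * ‖w‖ ^ 2 * (B * N) * ‖F4‖
              + 3 * ‖w‖ ^ 2 * ‖F5‖ := by gcongr
          _ ≤ N ^ 2 * (B ^ 2 * ‖F1‖) + N ^ 2 * (2 * B * ‖F2‖) + N ^ 2 * ‖F3‖
              + N ^ 2 * (3 * ‖w‖ ^ 2 * B * ‖F4‖) + N ^ 2 * (3 * ‖w‖ ^ 2 * ‖F5‖) := by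
              have p2 : 0 ≤ 2 * B * ‖F2‖ := by positivity
              have p4 : 0 ≤ 3 * ‖w‖ ^ 2 * B * ‖F4‖ := by positivity
              have p5 : 0 ≤ 3 * ‖w‖ ^ 2 * ‖F5‖ := by positivity
              have p6 : 1 ≤ N ^ 2 := hN1.trans q5
              have z1 := mul_le_mul_of_nonneg_right q5 p2
              have z2 := mul_le_mul_of_nonneg_right q5 p4
              have z3 := mul_le_mul_of_nonneg_right p6 p5
              have z4 := mul_le_mul_of_nonneg_right p6 (norm_nonneg F3)
              have z5 : (B * N) ^ 2 * ‖F1‖ = N ^ 2 * (B ^ 2 * ‖F1‖) := by ring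
              have z6 : 2 * (B * N) * ‖F2‖ = N * (2 * B * ‖F2‖) := by ring
              have z7 : 3 * ‖w‖ ^ 2 * (B * N) * ‖F4‖ = N * (3 * ‖w‖ ^ 2 * B * ‖F4‖) := by ring
              rw [z5, z6, z7]
              clear_value B N r Y G S
              linarith
          _ = _ := by ring
      -- The weight (1 + |σ|)²/N² introduced here is compensated by the bound `hF` on σ²‖F‖.
      have hV : |V t x| ≤ C * (S * (1 + (1 + |σ|) ^ 2 * (N ^ 2)⁻¹)) := (h.decay t x).trans
        (mul_le_mul_of_nonneg_left (rpow_neg_le_mul_one_add hN1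
          (by linarith [abs_nonneg σ]) hδ hδ2) hC)
      refine (mul_le_mul_of_nonneg_right hV (norm_nonneg F)).trans ?_
      have hk := one_add_sq_mul_inv_sq_mul_le hN1 (norm_nonneg F) hF
      have := mul_le_mul_of_nonneg_left hk (by positivity : 0 ≤ C * S)
      rw [show C * (S * (1 + (1 + |σ|) ^ 2 * (N ^ 2)⁻¹)) * ‖F‖
        = C * S * ‖F‖ + C * S * ((1 + |σ|) ^ 2 * (N ^ 2)⁻¹ * ‖F‖) by ring]
      refine (add_le_add_right this _).trans (le_of_eq ?_)
      ring)
  rw [← toL2_schwartzMultiplier hθ, ← hG]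
  refine key.trans ?_
  simp only [Fin.sum_univ_six, Matrix.cons_val, hnorm]
  have b0 := H0 ε e0 e1
  have b1 : ‖toL2 (boost w ε f)‖ ≤ K1 := H1 ε e0 e1
  have b2 : ‖toL2 (boost w ε (Y f))‖ ≤ K2 := H2 ε e0 e1
  have b3 : ‖toL2 (boost w ε (Y (Y f)))‖ ≤ K3 := H3 ε e0 e1
  calc _ ≤ C * S * 3 * K0 + C * S * (2 * B ^ 2) * K1 + C * S * (4 * B) * K2 + C * S * 2 * K3
        + C * S * (6 * ‖w‖ ^ 2 * B) * ‖toL2 f‖ + C * S * (6 * ‖w‖ ^ 2) * ‖toL2 (Y f)‖ := by gcongr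
    _ = _ := by ring

theorem fourier_boost (w : Space n) (ε : ℝ) (f : 𝓢(Space n, ℂ)) (ξ : Space n) :
    𝓕 (boost w ε f) ξ = ((1 + 2 * Real.pi * ε * inner ℝ ξ w : ℝ) : ℂ) * 𝓕 f ξ := by
  rw [boost, FourierTransform.fourier_add, FourierTransform.fourier_smul, momentum,
    FourierTransform.fourier_smul, SchwartzMap.fourier_lineDerivOp_eq, _root_.add_apply,
    _root_.smul_apply, _root_.smul_apply, _root_.smul_apply,
    SchwartzMap.smulLeftCLM_apply_apply (by fun_prop)]
  simp only [smul_eq_mul, Complex.real_smul]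
  push_cast
  linear_combination (-(2 * Real.pi * ε * (inner ℝ ξ w : ℝ) * 𝓕 f ξ) : ℂ) * Complex.I_sq

/-- The zero set of a non-trivial affine function is empty or lies in a proper affine subspace,
hence is null. -/
theorem ae_boost_symbol_ne_zero {w : Space n} (hw : w ≠ 0) (ε : ℝ) :
    ∀ᵐ ξ : Space n, (1 + 2 * Real.pi * ε * inner ℝ ξ w : ℝ) ≠ 0 := by
  rw [ae_iff]
  simp only [not_not]
  set s : Set (Space n) := {ξ | (1 + 2 * Real.pi * ε * inner ℝ ξ w : ℝ) = 0} with hs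
  rcases s.eq_empty_or_nonempty with h | ⟨ξ₀, h₀⟩
  · rw [h]; simp
  have hε : 2 * Real.pi * ε ≠ 0 := fun h => by simp [hs, h] at h₀
  let A := AffineSubspace.mk' ξ₀ (LinearMap.ker (innerSL ℝ w).toLinearMap)
  have hsub : s ⊆ A := fun ξ hξ => by
    rw [SetLike.mem_coe, AffineSubspace.mem_mk', LinearMap.mem_ker]
    have h1 : 2 * Real.pi * ε * (inner ℝ ξ w - inner ℝ ξ₀ w) = 0 := by
      have h2 : (1 + 2 * Real.pi * ε * inner ℝ ξ w : ℝ) = 0 := hξ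
      have h3 : (1 + 2 * Real.pi * ε * inner ℝ ξ₀ w : ℝ) = 0 := h₀
      linarith
    have h2 := (mul_eq_zero.1 h1).resolve_left hε
    simpa [inner_sub_right, real_inner_comm] using h2
  refine measure_mono_null hsub (Measure.addHaar_affineSubspace _ _ fun h => ?_)
  have h1 : ξ₀ + w ∈ A := h ▸ AffineSubspace.mem_top ℝ _ _
  rw [AffineSubspace.mem_mk', LinearMap.mem_ker] at h1
  simp at h1
  exact hw h1

/-- If u is orthogonal to the range, testing with smooth compactly supported functions of the
frequency gives (1 + 2πε⟨ξ, w⟩)³ û = 0 almost everywhere, and the symbol vanishes only on a null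
set. -/
theorem denseRange_iterate_boost {w : Space n} (hw : w ≠ 0) (ε : ℝ) :
    DenseRange fun f : 𝓢(Space n, ℂ) => toL2 ((boost w ε)^[3] f) := by
  let T : 𝓢(Space n, ℂ) →ₗ[ℂ] L2 n :=
    { toFun := fun f => toL2 ((boost w ε)^[3] f)
      map_add' := fun f g => by rw [iterate_boost_add, map_add]
      map_smul' := fun c f => by rw [iterate_boost_smul, map_smul]; rfl }
  have hT : (LinearMap.range T).topologicalClosure = ⊤ := by
    rw [Submodule.topologicalClosure_eq_top_iff, Submodule.eq_bot_iff]
    intro u hu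
    have h1 : ∀ f : 𝓢(Space n, ℂ), inner ℂ (toL2 ((boost w ε)^[3] f)) u = (0 : ℂ) := fun f =>
      (Submodule.mem_orthogonal _ _).1 hu _ ⟨f, rfl⟩
    set m : Space n → ℂ := fun ξ => ((1 + 2 * Real.pi * ε * inner ℝ ξ w : ℝ) : ℂ) ^ 3 with hm
    have hmc : Continuous m := by fun_prop
    have h2 : ∀ᵐ ξ, m ξ * 𝓕 u ξ = 0 := by
      apply ae_eq_zero_of_integral_contDiff_smul_eq_zero
      · exact ((Lp.memLp (𝓕 u : L2 n)).locallyIntegrable (by norm_num)).continuous_smul hmc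
      · intro g hg hgc
        have hg' : ContDiff ℝ ∞ fun ξ => (g ξ : ℂ) := Complex.ofRealCLM.contDiff.comp hg
        have hgc' : HasCompactSupport fun ξ => (g ξ : ℂ) := hgc.comp_left Complex.ofReal_zero
        let φ : 𝓢(Space n, ℂ) := hgc'.toSchwartzMap hg'
        have e1 := h1 (𝓕⁻ φ)
        rw [← inner_fourier, fourier_toL2, L2.inner_def] at e1
        rw [← e1]
        apply integral_congr_ae
        filter_upwards [toL2_coeFn (𝓕 ((boost w ε)^[3] (𝓕⁻ φ : 𝓢(Space n, ℂ))))] with ξ e2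
        have e3 : 𝓕 ((boost w ε)^[3] (𝓕⁻ φ : 𝓢(Space n, ℂ))) ξ = m ξ * g ξ := by
          simp only [Function.iterate_succ, Function.comp_apply, Function.iterate_zero, id,
            fourier_boost, FourierTransform.fourier_fourierInv_eq, hm]
          have : φ ξ = g ξ := rfl
          rw [this]; ring
        rw [e2, e3, RCLike.inner_apply, map_mul, Complex.conj_ofReal, hm, map_pow,
          Complex.conj_ofReal, Complex.real_smul]
        ring
    have h3 : 𝓕 u = 0 := by
      apply Lp.ext
      filter_upwards [h2, ae_boost_symbol_ne_zero hw ε, Lp.coeFn_zero ℂ 2 (volume : Measure (Space n))]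
        with ξ e1 e2 e3
      rw [e3]
      exact (mul_eq_zero.1 e1).resolve_left (pow_ne_zero 3 (Complex.ofReal_ne_zero.2 e2))
    have h4 : ‖u‖ = 0 := by rw [← Lp.norm_fourier_eq, h3, norm_zero]
    exact norm_eq_zero.1 h4
  have h5 : (LinearMap.range T : Set (L2 n)) = Set.range fun f => toL2 ((boost w ε)^[3] f) := rfl
  rw [DenseRange, dense_iff_closure_eq, ← h5, ← Submodule.topologicalClosure_coe, hT,
    Submodule.top_coe]

end BoostedPackets

/-! ### The classical path of the packets in a periodic field. -/

section Kinematics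

variable {n : ℕ}

theorem exists_norm_le_of_periodic {F : Type*} [NormedAddCommGroup F] {g : ℝ → F}
    (hc : Continuous g) (hp : Function.Periodic g 1) : ∃ B, 0 ≤ B ∧ ∀ t, ‖g t‖ ≤ B := by
  have h : Bornology.IsBounded (Set.range g) := hp.isBounded_of_continuous one_ne_zero hc
  obtain ⟨B, hB⟩ := h.exists_norm_le
  exact ⟨B, (norm_nonneg _).trans (hB _ ⟨0, rfl⟩), fun t => hB _ ⟨t, rfl⟩⟩

theorem drift_add_one {E : ℝ → Space n} (hE : IsPeriodicField E) (t : ℝ) :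
    drift E (t + 1) = drift E t + meanField E := by
  have hi := intervalIntegrable_of_locallyIntegrable hE.locallyIntegrable
  have h1 : ∫ τ in (1 : ℝ)..t + 1, E τ = ∫ τ in (0 : ℝ)..t, E τ := by
    have h2 := intervalIntegral.integral_comp_add_right (a := 0) (b := t) E 1
    rw [zero_add] at h2
    rw [← h2]
    exact intervalIntegral.integral_congr_ae (hE.periodic.mono fun τ h _ => h)
  rw [drift, drift, meanField, ← h1,
    ← intervalIntegral.integral_add_adjacent_intervals (hi 0 1) (hi 1 (t + 1))]
  exact add_comm _ _

theorem exists_norm_drift_sub_le {E : ℝ → Space n} (hE : IsPeriodicField E) :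
    ∃ B, 0 ≤ B ∧ ∀ t, ‖drift E t - t • meanField E‖ ≤ B := by
  refine exists_norm_le_of_periodic ?_ fun t => ?_
  · have := continuous_drift hE.locallyIntegrable
    fun_prop
  · simp only [drift_add_one hE, add_smul, one_smul]; abel

/-- The velocity along the path differs from w + (τ - s)E₀ by a difference of two values of the
bounded function b(t) - tE₀, hence by at most 2B; integrate over time. -/
theorem norm_centre_sub_le {E : ℝ → Space n} (hE : LocallyIntegrable E volume) {E₀ : Space n}
    {B : ℝ} (hB : ∀ t, ‖drift E t - t • E₀‖ ≤ B) (s t : ℝ) (w : Space n) :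
    ‖centre E s w t - ((t - s) • w + ((t - s) ^ 2 / 2) • E₀)‖ ≤ 2 * B * |t - s| := by
  have hd := continuous_drift hE
  have h1 : ∫ τ in s..t, (drift E τ - drift E s - (τ - s) • E₀)
      = centre E s w t - ((t - s) • w + ((t - s) ^ 2 / 2) • E₀) := by
    rw [intervalIntegral.integral_sub, intervalIntegral.integral_sub, ← displacement_sub hE,
      intervalIntegral.integral_const, intervalIntegral.integral_smul_const, centre]
    · have : ∫ τ in s..t, (τ - s) = (t - s) ^ 2 / 2 := by
        rw [intervalIntegral.integral_comp_sub_right (fun τ => τ) s, integral_id]; ring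
      rw [this, smul_sub]; abel
    · exact hd.intervalIntegrable _ _
    · exact continuous_const.intervalIntegrable _ _
    · exact (hd.sub continuous_const).intervalIntegrable _ _
    · exact Continuous.intervalIntegrable (by fun_prop) _ _
  rw [← h1]
  refine intervalIntegral.norm_integral_le_of_norm_le_const fun τ _ => ?_
  have h2 : drift E τ - drift E s - (τ - s) • E₀
      = (drift E τ - τ • E₀) - (drift E s - s • E₀) := by rw [sub_smul]; abel
  rw [h2]
  exact (norm_sub_le _ _).trans (by linarith [hB τ, hB s])

/-- Linear independence forbids cancellation between the ballistic term lτw and the acceleration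
τ²E₀/2, so their sum is bounded below by l|τ| + τ² up to a constant. The deviation is only O(|τ|)
and is absorbed for large l. -/
theorem exists_mul_le_norm_centre {E : ℝ → Space n} (hE : IsPeriodicField E) (s : ℝ) {w : Space n}
    (hw : LinearIndependent ℝ ![w, meanField E]) :
    ∃ κ > 0, ∃ l₀ : ℝ, 1 ≤ l₀ ∧ ∀ l ≥ l₀, ∀ t,
      κ * (1 + l * |t - s| + (t - s) ^ 2) ≤ 1 + ‖centre E s (l • w) t‖ := by
  obtain ⟨B, hB0, hB⟩ := exists_norm_drift_sub_le hE
  let T : ℝ × ℝ →ₗ[ℝ] Space n :=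
    (LinearMap.toSpanSingleton ℝ _ w).coprod (LinearMap.toSpanSingleton ℝ _ (meanField E))
  have hT : ∀ p, T p = p.1 • w + p.2 • meanField E := fun p => by simp [T]
  have hker : LinearMap.ker T = ⊥ := by
    rw [LinearMap.ker_eq_bot']
    intro p hp
    rw [hT] at hp
    have := LinearIndependent.pair_iff.1 hw p.1 p.2 hp
    exact Prod.ext this.1 this.2
  obtain ⟨K, hK, hanti⟩ := T.exists_antilipschitzWith hker
  have hK' : (0 : ℝ) < K := hK
  have hlow : ∀ x y : ℝ, (|x| + |y|) / (2 * K) ≤ ‖x • w + y • meanField E‖ := fun x y => by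
    have h1 := hanti.le_mul_dist (x, y) 0
    rw [map_zero, dist_zero_right, dist_zero_right, hT] at h1
    have h2 : |x| ≤ ‖(x, y)‖ := norm_fst_le (x, y)
    have h3 : |y| ≤ ‖(x, y)‖ := norm_snd_le (x, y)
    rw [div_le_iff₀ (by positivity)]
    simp only at h1
    linarith
  set κ₀ : ℝ := 1 / (4 * K) with hκ₀
  have hκpos : 0 < κ₀ := by positivity
  -- The condition l ≥ 4B/κ₀ makes the deviation 2B|τ| at most half of κ₀ l|τ|.
  refine ⟨min 1 (κ₀ / 2), by positivity, max 1 (4 * B / κ₀), le_max_left _ _, fun l hl t => ?_⟩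
  have hl1 : 1 ≤ l := (le_max_left _ _).trans hl
  have hl2 : 4 * B ≤ l * κ₀ := (div_le_iff₀ hκpos).1 ((le_max_right _ _).trans hl)
  set τ := t - s with hτ
  have h1 := norm_centre_sub_le hE.locallyIntegrable hB s t (l • w)
  rw [← hτ, smul_smul] at h1
  have h2 := hlow (τ * l) (τ ^ 2 / 2)
  have h3 := norm_sub_norm_le ((τ * l) • w + (τ ^ 2 / 2) • meanField E)
    (centre E s (l • w) t)
  rw [norm_sub_rev] at h3
  have h4 : κ₀ * (l * |τ| + τ ^ 2) ≤ (|τ * l| + |τ ^ 2 / 2|) / (2 * K) := by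
    rw [abs_mul, abs_of_nonneg (by linarith : 0 ≤ l), abs_of_nonneg (by positivity : 0 ≤ τ ^ 2 / 2),
      le_div_iff₀ (by positivity), hκ₀]
    field_simp
    nlinarith [abs_nonneg τ, mul_nonneg (abs_nonneg τ) (by linarith : 0 ≤ l), sq_nonneg τ]
  have h5 : 2 * B * |τ| ≤ κ₀ / 2 * (l * |τ|) := by
    have := mul_le_mul_of_nonneg_right hl2 (abs_nonneg τ)
    linarith
  have h6 : 0 ≤ l * |τ| + τ ^ 2 := by positivity
  have h7 : min 1 (κ₀ / 2) * (l * |τ| + τ ^ 2) ≤ κ₀ / 2 * (l * |τ| + τ ^ 2) :=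
    mul_le_mul_of_nonneg_right (min_le_right _ _) h6
  have h8 : min 1 (κ₀ / 2) ≤ 1 := min_le_left _ _
  have h9 : 0 ≤ κ₀ / 2 * τ ^ 2 := by positivity
  linarith

/-- For zero mean the drift is periodic, so the displacement is t b plus a periodic function, b
being the mean drift. The shift β = b - drift E s in the momentum removes this uniform motion,
leaving a straight line up to a bounded error. -/
theorem exists_norm_centre_sub_le {E : ℝ → Space n} (hE : IsPeriodicField E)
    (h0 : meanField E = 0) (s : ℝ) :
    ∃ (β : Space n) (R : ℝ), 0 ≤ R ∧
      ∀ (w : Space n) t, ‖centre E s (w - β) t - (t - s) • w‖ ≤ R := by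
  have hd := continuous_drift hE.locallyIntegrable
  have hp : Function.Periodic (drift E) 1 := fun t => by rw [drift_add_one hE, h0, add_zero]
  set b := ∫ τ in (0 : ℝ)..1, drift E τ with hb
  obtain ⟨R, hR0, hR⟩ := exists_norm_le_of_periodic (g := fun t => displacement E t - t • b)
    (by have := continuous_displacement hE.locallyIntegrable; fun_prop) fun t => by
      have h1 : displacement E (t + 1) - displacement E t = b := by
        rw [displacement_sub hE.locallyIntegrable, hb, hp.intervalIntegral_add_eq t 0, zero_add]
      rw [← sub_eq_zero]
      simp only [add_smul, one_smul]
      rw [← h1]; abel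
  refine ⟨b - drift E s, 2 * R, by positivity, fun w t => ?_⟩
  have h2 : centre E s (w - (b - drift E s)) t - (t - s) • w
      = (displacement E t - t • b) - (displacement E s - s • b) := by
    rw [centre]; simp only [smul_sub, sub_smul]; abel
  rw [h2]
  exact (norm_sub_le _ _).trans (by linarith [hR t, hR s])

end Kinematics

/-! ### Integrable decay along packets in both field regimes. -/

section PacketEstimates

variable {n : ℕ}

/-- The wave packets of momentum `l w - β` move away from the potential, up to its value at
their centre. -/
structure PacketEstimate (E : ℝ → Space n) (s : ℝ) (w β : Space n) (v : ℝ → Space n →ᵇ ℂ)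
    (γ l₀ : ℝ) : Prop where
  bound : ∀ f : 𝓢(Space n, ℂ), ∃ K, 0 ≤ K ∧ ∀ l ≥ l₀, ∀ t a : ℝ,
    ‖boundedMul (v t - BoundedContinuousFunction.const (Space n) (v t (centre E s (l • w - β) t)))
      (multiplier (quadPhase (t - s) (centre E s (l • w - β) t) a)
        (toL2 ((boost w (l * ‖w‖ ^ 2)⁻¹)^[3] f)))‖ ≤ K * (1 + l * |t - s|) ^ (-γ)
  centre_bound : ∀ l ≥ l₀, ∃ K, 0 ≤ K ∧ ∀ t,
    ‖v t (centre E s (l • w - β) t)‖ ≤ K * (1 + |t - s|) ^ (-γ)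

theorem rpow_neg_le_mul_rpow_neg {m x y s : ℝ} (hm : 0 < m) (hy : 0 < y) (h : m * y ≤ x)
    (hs : 0 ≤ s) : x ^ (-s) ≤ m ^ (-s) * y ^ (-s) := by
  rw [← Real.mul_rpow hm.le hy.le]
  exact Real.rpow_le_rpow_of_nonpos (by positivity) h (by linarith)

theorem boost_parameter_le_one {w : Space n} (hw : w ≠ 0) {l : ℝ} (hl : 1 ≤ l)
    (hl' : (‖w‖ ^ 2)⁻¹ ≤ l) : 0 ≤ (l * ‖w‖ ^ 2)⁻¹ ∧ (l * ‖w‖ ^ 2)⁻¹ ≤ 1 := by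
  have hw2 : 0 < ‖w‖ ^ 2 := by have := norm_pos_iff.2 hw; positivity
  refine ⟨by positivity, inv_le_one_of_one_le₀ ?_⟩
  have := mul_le_mul_of_nonneg_right hl' hw2.le
  rwa [inv_mul_cancel₀ hw2.ne'] at this

/-- Put M = 1 + l|τ| + τ². Then 1 + ‖c‖ ≥ κM and 1 + |τ| ≤ 2M^{1/2}, so the gradient term is
M^{-(δ+1)} M^{1/2} = M^{-(δ+1/2)} and the far term M^{-4} M² = M^{-2}, which is no larger because δ
≤ 1. Hence γ = δ + 1/2, which exceeds 1 exactly when δ > 1/2. -/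
theorem PotentialBounds.exists_packetEstimate_of_linearIndependent {δ C : ℝ}
    {V : ℝ → Space n → ℝ} (h : PotentialBounds δ C V) (hδ0 : 0 ≤ δ) (hδ : 1 / 2 < δ) (hδ1 : δ ≤ 1)
    {E : ℝ → Space n} (hE : IsPeriodicField E) (s : ℝ) {w : Space n}
    (hw : LinearIndependent ℝ ![w, meanField E]) :
    ∃ γ > 1, ∃ l₀ : ℝ, 1 ≤ l₀ ∧ PacketEstimate E s w 0 (h.toBCF hδ0) γ l₀ := by
  obtain ⟨κ, hκ, l₁, hl₁, hlow⟩ := exists_mul_le_norm_centre hE s hw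
  have hw0 : w ≠ 0 := hw.ne_zero 0
  refine ⟨δ + 1 / 2, by linarith, max l₁ (‖w‖ ^ 2)⁻¹, hl₁.trans (le_max_left _ _), ?_, ?_⟩
  · intro f
    obtain ⟨K, hK, H⟩ := exists_norm_iterate_boost_le (I := ℝ × ℝ × Space n × ℝ)
      (T := fun i => boundedMul (h.centred hδ0 i.1 i.2.2.1) ∘L
        ((multiplier (quadPhase i.2.1 i.2.2.1 i.2.2.2)).toContinuousLinearEquiv : L2 n →L[ℂ] L2 n))
      (b := fun i => (1 + ‖i.2.2.1‖) ^ (-(δ + 1)) * (1 + |i.2.1|)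
        + (1 + ‖i.2.2.1‖) ^ (-4 : ℝ) * (1 + |i.2.1|) ^ 4)
      (fun f => by
        obtain ⟨K, hK, H⟩ := h.exists_norm_centred_le hδ0 f
        exact ⟨K, hK, fun i => H i.1 i.2.1 i.2.2.1 i.2.2.2⟩) w 3 f
    refine ⟨K * (κ ^ (-(δ + 1)) * 2 + κ ^ (-4 : ℝ) * 16), by positivity, fun l hl t a => ?_⟩
    have hl1 : l₁ ≤ l := (le_max_left _ _).trans hl
    have hε := boost_parameter_le_one hw0 (hl₁.trans hl1) ((le_max_right _ _).trans hl)
    rw [sub_zero]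
    set c := centre E s (l • w) t with hc
    refine (H (t, t - s, c, a) _ hε.1 hε.2).trans ?_
    rw [mul_assoc]
    refine mul_le_mul_of_nonneg_left ?_ hK
    simp only
    have hN := hlow l hl1 t
    rw [← hc] at hN
    set τ := t - s with hτ
    set M := 1 + l * |τ| + τ ^ 2 with hM
    have hlτ : 0 ≤ l * |τ| := mul_nonneg (by linarith) (abs_nonneg _)
    have hM1 : 1 ≤ M := by rw [hM]; nlinarith [sq_nonneg τ]
    have hM0 : 0 < M := by linarith
    have hx : 1 + |τ| ≤ 2 * M ^ (1 / 2 : ℝ) := by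
      have e1 : (M ^ (1 / 2 : ℝ)) ^ 2 = M := by
        rw [← Real.rpow_natCast, ← Real.rpow_mul hM0.le]; norm_num
      refine le_of_sq_le_sq ?_ (by positivity)
      rw [mul_pow, e1]
      nlinarith [sq_nonneg (|τ| - 1), sq_abs τ]
    have hMu : M ^ (-(δ + 1 / 2)) ≤ (1 + l * |τ|) ^ (-(δ + 1 / 2)) :=
      Real.rpow_le_rpow_of_nonpos (by linarith) (by rw [hM]; nlinarith [sq_nonneg τ]) (by linarith)
    have t1 : (1 + ‖c‖) ^ (-(δ + 1)) * (1 + |τ|) ≤ κ ^ (-(δ + 1)) * 2 * M ^ (-(δ + 1 / 2)) := by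
      have e1 := rpow_neg_le_mul_rpow_neg hκ hM0 hN (by linarith : 0 ≤ δ + 1)
      calc _ ≤ κ ^ (-(δ + 1)) * M ^ (-(δ + 1)) * (2 * M ^ (1 / 2 : ℝ)) :=
            mul_le_mul e1 hx (by positivity) (by positivity)
        _ = κ ^ (-(δ + 1)) * 2 * (M ^ (-(δ + 1)) * M ^ (1 / 2 : ℝ)) := by ring
        _ = _ := by rw [← Real.rpow_add hM0]; congr 2; ring
    have t2 : (1 + ‖c‖) ^ (-4 : ℝ) * (1 + |τ|) ^ 4 ≤ κ ^ (-4 : ℝ) * 16 * M ^ (-(δ + 1 / 2)) := by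
      have e1 := rpow_neg_le_mul_rpow_neg hκ hM0 hN (by norm_num : (0 : ℝ) ≤ 4)
      have e2 : (1 + |τ|) ^ 4 ≤ (2 * M ^ (1 / 2 : ℝ)) ^ 4 := pow_le_pow_left₀ (by positivity) hx 4
      have e3 : (M ^ (1 / 2 : ℝ)) ^ 4 = M ^ (2 : ℝ) := by
        rw [← Real.rpow_natCast, ← Real.rpow_mul hM0.le]; norm_num
      calc _ ≤ κ ^ (-4 : ℝ) * M ^ (-4 : ℝ) * (2 * M ^ (1 / 2 : ℝ)) ^ 4 :=
            mul_le_mul e1 e2 (by positivity) (by positivity)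
        _ = κ ^ (-4 : ℝ) * 16 * (M ^ (-4 : ℝ) * M ^ (2 : ℝ)) := by rw [mul_pow, e3]; ring
        _ = κ ^ (-4 : ℝ) * 16 * M ^ (-2 : ℝ) := by rw [← Real.rpow_add hM0]; norm_num
        _ ≤ _ := mul_le_mul_of_nonneg_left
            (Real.rpow_le_rpow_of_exponent_le hM1 (by linarith)) (by positivity)
    calc _ ≤ (κ ^ (-(δ + 1)) * 2 + κ ^ (-4 : ℝ) * 16) * M ^ (-(δ + 1 / 2)) := by
          rw [add_mul]; exact add_le_add t1 t2
      _ ≤ _ := mul_le_mul_of_nonneg_left hMu (by positivity)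
  · intro l hl
    have hl1 : l₁ ≤ l := (le_max_left _ _).trans hl
    have hC := h.nonneg
    refine ⟨C * (κ / 2) ^ (-δ), by positivity, fun t => ?_⟩
    rw [sub_zero, h.toBCF_apply, Complex.norm_real, Real.norm_eq_abs, mul_assoc]
    refine (h.decay t _).trans (mul_le_mul_of_nonneg_left ?_ hC)
    have hN := hlow l hl1 t
    set τ := t - s with hτ
    have hlτ : 0 ≤ l * |τ| := mul_nonneg (by linarith) (abs_nonneg _)
    -- For the value at the centre quadratic growth in τ is enough: it gives the exponent 2δ, and 2δ
    -- ≥ δ + 1/2.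
    have h1 : κ / 2 * (1 + |τ|) ^ 2 ≤ 1 + ‖centre E s (l • w) t‖ := by
      refine le_trans ?_ hN
      have : (1 + |τ|) ^ 2 ≤ 2 * (1 + l * |τ| + τ ^ 2) := by
        nlinarith [sq_nonneg (|τ| - 1), sq_abs τ]
      nlinarith
    have h2 := rpow_neg_le_mul_rpow_neg (by positivity) (by positivity) h1 hδ0
    refine h2.trans (mul_le_mul_of_nonneg_left ?_ (by positivity))
    have hb : (1 : ℝ) ≤ 1 + |τ| := by linarith [abs_nonneg τ]
    rw [← Real.rpow_natCast, ← Real.rpow_mul (by positivity)]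
    exact Real.rpow_le_rpow_of_exponent_le hb (by push_cast; linarith)

/-- Here nothing is gained from subtracting the central value. The potential on the boosted packet
and the potential at the centre are each O((1 + l|τ|)^{-δ}), the first by suppression of the slow
part and the second because the centre stays within R of the line τ l w. -/
theorem PotentialBounds.exists_packetEstimate_of_meanField_eq_zero {δ C : ℝ}
    {V : ℝ → Space n → ℝ} (h : PotentialBounds δ C V) (hδ0 : 0 ≤ δ) (hδ2 : δ ≤ 2)
    {E : ℝ → Space n} {β : Space n} {R s : ℝ} (hR : 0 ≤ R)
    (hβ : ∀ (w : Space n) t, ‖centre E s (w - β) t - (t - s) • w‖ ≤ R) {w : Space n} (hw : w ≠ 0) :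
    ∃ l₀ : ℝ, 1 ≤ l₀ ∧ PacketEstimate E s w β (h.toBCF hδ0) δ l₀ := by
  have hC := h.nonneg
  have hw0 : 0 < ‖w‖ := norm_pos_iff.2 hw
  set m : ℝ := min 1 ‖w‖ with hm
  have hm0 : 0 < m := by positivity
  have hm1 : m ≤ 1 := min_le_left _ _
  have hmw : m ≤ ‖w‖ := min_le_right _ _
  have hcen : ∀ l t, 1 ≤ l → |V t (centre E s (l • w - β) t)|
      ≤ C * (m / (1 + R)) ^ (-δ) * (1 + l * |t - s|) ^ (-δ) := fun l t hl => by
    rw [mul_assoc]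
    refine (h.decay t _).trans (mul_le_mul_of_nonneg_left ?_ hC)
    have hlτ : 0 ≤ l * |t - s| := mul_nonneg (by linarith) (abs_nonneg _)
    refine rpow_neg_le_mul_rpow_neg (by positivity) (by linarith) ?_ hδ0
    have h1 := norm_sub_norm_le ((t - s) • l • w) (centre E s (l • w - β) t)
    rw [norm_sub_rev, norm_smul, norm_smul, Real.norm_eq_abs, Real.norm_eq_abs,
      abs_of_nonneg (by linarith : 0 ≤ l)] at h1
    have h2 := hβ (l • w) t
    rw [div_mul_eq_mul_div, div_le_iff₀ (by positivity)]
    have h3 : m * (l * |t - s|) ≤ |t - s| * (l * ‖w‖) := by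
      have := mul_le_mul_of_nonneg_right hmw hlτ
      linarith
    have h4 := mul_nonneg hR (norm_nonneg (centre E s (l • w - β) t))
    nlinarith
  refine ⟨max 1 (‖w‖ ^ 2)⁻¹, le_max_left _ _, ?_, ?_⟩
  · intro f
    obtain ⟨K1, hK1, H1⟩ := h.exists_norm_boost_le hδ0 hδ2 w
      (mul_nonneg hR hw0.le) f
    obtain ⟨K2, hK2, H2⟩ := exists_norm_toL2_iterate_boost_le w 3 f
    refine ⟨K1 * (m ^ 2) ^ (-δ) + C * (m / (1 + R)) ^ (-δ) * K2, by positivity, fun l hl t a => ?_⟩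
    have hl1 : 1 ≤ l := (le_max_left _ _).trans hl
    have hε := boost_parameter_le_one hw hl1 ((le_max_right _ _).trans hl)
    have hl0 : 0 < l := by linarith
    set c := centre E s (l • w - β) t with hc
    have hlτ : 0 ≤ l * |t - s| := mul_nonneg (by linarith) (abs_nonneg _)
    rw [boundedMul_sub, boundedMul_const]
    refine (norm_sub_le _ _).trans ?_
    rw [norm_smul, LinearIsometryEquiv.norm_map, add_mul]
    refine add_le_add ?_ ?_
    -- With ε = (l‖w‖²)⁻¹ the scale σ is τ l‖w‖² = ⟨τ l w, w⟩, the component along w of the mean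
    -- path, and 1 + ε p_w is proportional to the full velocity component l‖w‖² + p_w.
    · have hσ : (t - s) * (l * ‖w‖ ^ 2) * (l * ‖w‖ ^ 2)⁻¹ = t - s := by field_simp
      have hσc : |(t - s) * (l * ‖w‖ ^ 2) - inner ℝ c w| ≤ R * ‖w‖ := by
        have e1 : (t - s) * (l * ‖w‖ ^ 2) - inner ℝ c w = -inner ℝ (c - (t - s) • l • w) w := by
          rw [inner_sub_left, inner_smul_left, inner_smul_left, real_inner_self_eq_norm_sq]
          simp
        rw [e1, abs_neg]
        exact (abs_real_inner_le_norm _ _).trans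
          (mul_le_mul_of_nonneg_right (hβ (l • w) t) hw0.le)
      refine (H1 t (t - s) _ _ c a hε.1 hε.2 hσ hσc).trans ?_
      rw [mul_assoc]
      refine mul_le_mul_of_nonneg_left (rpow_neg_le_mul_rpow_neg (by positivity) (by linarith) ?_
        hδ0) hK1
      rw [abs_mul, abs_of_nonneg (by positivity : 0 ≤ l * ‖w‖ ^ 2)]
      have e2 : m ^ 2 ≤ 1 := pow_le_one₀ hm0.le hm1
      have e3 : m ^ 2 ≤ ‖w‖ ^ 2 := pow_le_pow_left₀ hm0.le hmw 2
      have e4 := mul_le_mul_of_nonneg_right e3 hlτ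
      linarith
    · rw [h.toBCF_apply, Complex.norm_real, Real.norm_eq_abs]
      calc _ ≤ C * (m / (1 + R)) ^ (-δ) * (1 + l * |t - s|) ^ (-δ) * K2 :=
            mul_le_mul (hcen l t hl1) (H2 _ hε.1 hε.2) (norm_nonneg _) (by positivity)
        _ = _ := by ring
  · intro l hl
    have hl1 : 1 ≤ l := (le_max_left _ _).trans hl
    refine ⟨C * (m / (1 + R)) ^ (-δ), by positivity, fun t => ?_⟩
    rw [h.toBCF_apply, Complex.norm_real, Real.norm_eq_abs]
    refine (hcen l t hl1).trans (mul_le_mul_of_nonneg_left ?_ (by positivity))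
    refine Real.rpow_le_rpow_of_nonpos (by positivity) ?_ (by linarith)
    have := mul_le_mul_of_nonneg_right hl1 (abs_nonneg (t - s))
    linarith

end PacketEstimates

/-! ### Cook's method and a second-order expansion in Hilbert space. -/

section Cook

set_option linter.unusedSectionVars false

variable {H : Type*} [NormedAddCommGroup H] [InnerProductSpace ℂ H] [NormedSpace ℝ H]
  [IsScalarTower ℝ ℂ H] [CompleteSpace H]

/-- A path of integrable velocity has limits at both ends. -/
theorem exists_tendsto_of_integrable_velocity {z d : ℝ → H}
    (hz : ∀ t₀ t₁, z t₁ - z t₀ = ∫ t in t₀..t₁, d t) (hd : Integrable d) :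
    ∃ a b, Tendsto z atTop (𝓝 a) ∧ Tendsto z atBot (𝓝 b) ∧ a - b = ∫ t, d t ∧
      ∀ t, ‖a - z t‖ ≤ ∫ t, ‖d t‖ := by
  have h1 : ∀ t₀, Tendsto z atTop (𝓝 (z t₀ + ∫ t in Set.Ioi t₀, d t)) := fun t₀ => by
    have h := (intervalIntegral_tendsto_integral_Ioi t₀ hd.integrableOn tendsto_id).const_add (z t₀)
    refine h.congr fun t => ?_
    rw [id, ← hz, add_sub_cancel]
  have h2 : Tendsto z atBot (𝓝 (z 0 - ∫ t in Set.Iic 0, d t)) := by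
    have h := (intervalIntegral_tendsto_integral_Iic 0 hd.integrableOn tendsto_id).const_sub (z 0)
    refine h.congr fun t => ?_
    rw [id, ← hz, sub_sub_cancel]
  refine ⟨_, _, h1 0, h2, ?_, fun t => ?_⟩
  · rw [add_sub_sub_cancel, add_comm, intervalIntegral.integral_Iic_add_Ioi hd.integrableOn
      hd.integrableOn]
  · rw [tendsto_nhds_unique (h1 0) (h1 t), add_sub_cancel_left]
    refine (norm_integral_le_integral_norm _).trans ?_
    exact setIntegral_le_integral hd.norm (Eventually.of_forall fun _ => norm_nonneg _)

/-- The constant pairing p is also the limit at +∞, so ⟨a, b⟩ - p = -∫⟨a, dg⟩. Replacing the limit a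
by zh(t) costs ‖a - zh(t)‖ ≤ ∫‖dh‖ under the integral, whence a product of two first-order
quantities. -/
theorem norm_inner_limits_sub_le {zh zg dh dg : ℝ → H}
    (hzh : ∀ t₀ t₁, zh t₁ - zh t₀ = ∫ t in t₀..t₁, dh t)
    (hzg : ∀ t₀ t₁, zg t₁ - zg t₀ = ∫ t in t₀..t₁, dg t)
    (hdh : Integrable dh) (hdg : Integrable dg) (hzc : Continuous zh) {p : ℂ}
    (hp : ∀ t, inner ℂ (zh t) (zg t) = p) {a b : H} (ha : Tendsto zh atTop (𝓝 a))
    (hb : Tendsto zg atBot (𝓝 b)) :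
    ‖inner ℂ a b - p + ∫ t, (inner ℂ (zh t) (dg t) : ℂ)‖ ≤ (∫ t, ‖dh t‖) * ∫ t, ‖dg t‖ := by
  obtain ⟨a', -, ha', -, -, hle⟩ := exists_tendsto_of_integrable_velocity hzh hdh
  obtain ⟨b', b'', hb', hb'', hbb, -⟩ := exists_tendsto_of_integrable_velocity hzg hdg
  obtain rfl := tendsto_nhds_unique ha ha'
  obtain rfl := tendsto_nhds_unique hb hb''
  have h1 : inner ℂ a b' = p := by
    refine tendsto_nhds_unique (ha.inner hb') ?_
    simp only [hp]
    exact tendsto_const_nhds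
  have hi1 : Integrable fun t => (inner ℂ a (dg t) : ℂ) := hdg.const_inner a
  have hi2 : Integrable fun t => (inner ℂ (a - zh t) (dg t) : ℂ) := by
    refine Integrable.mono' (hdg.norm.const_mul (∫ t, ‖dh t‖)) ?_ (Eventually.of_forall fun t => ?_)
    · exact (continuous_const.sub hzc).aestronglyMeasurable.inner hdg.aestronglyMeasurable
    · exact (norm_inner_le_norm _ _).trans (mul_le_mul_of_nonneg_right (hle t) (norm_nonneg _))
  have h2 : inner ℂ a b - p = -∫ t, (inner ℂ a (dg t) : ℂ) := by
    rw [integral_inner hdg, ← hbb, inner_sub_right, h1]; ring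
  have h3 : inner ℂ a b - p + ∫ t, (inner ℂ (zh t) (dg t) : ℂ)
      = -∫ t, (inner ℂ (a - zh t) (dg t) : ℂ) := by
    have : ∀ t, (inner ℂ (zh t) (dg t) : ℂ) = inner ℂ a (dg t) - inner ℂ (a - zh t) (dg t) :=
      fun t => by rw [inner_sub_left]; ring
    simp only [this]
    rw [h2, integral_sub hi1 hi2]; ring
  rw [h3, norm_neg, ← integral_const_mul]
  refine norm_integral_le_of_norm_le (hdg.norm.const_mul _) (Eventually.of_forall fun t => ?_)
  exact (norm_inner_le_norm _ _).trans (mul_le_mul_of_nonneg_right (hle t) (norm_nonneg _))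

/-- Isometries which converge strongly on a dense set converge strongly. -/
theorem exists_strong_limit {A : ℝ → H ≃ₗᵢ[ℂ] H} {l : Filter ℝ} [l.NeBot] [l.IsCountablyGenerated]
    {ι : Type*} {φ : ι → H} (hφ : DenseRange φ)
    (h : ∀ i, ∃ a, Tendsto (fun t => A t (φ i)) l (𝓝 a)) :
    ∃ W : H →L[ℂ] H, ∀ f, Tendsto (fun t => A t f) l (𝓝 (W f)) := by
  have hlim : ∀ f, ∃ a, Tendsto (fun t => A t f) l (𝓝 a) := fun f => by
    rw [← cauchy_map_iff_exists_tendsto, Metric.cauchy_iff]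
    refine ⟨inferInstance, fun ε hε => ?_⟩
    obtain ⟨i, hi⟩ := hφ.exists_dist_lt f (by positivity : 0 < ε / 4)
    obtain ⟨a, ha⟩ := h i
    refine ⟨_, image_mem_map (ha (Metric.ball_mem_nhds a (by positivity : 0 < ε / 4))), ?_⟩
    have hclose : ∀ t, dist (A t (φ i)) a < ε / 4 → dist (A t f) a < ε / 2 := fun t ht => by
      have h1 := dist_triangle (A t f) (A t (φ i)) a
      rw [(A t).dist_map] at h1
      linarith
    rintro x ⟨t, ht, rfl⟩ y ⟨t', ht', rfl⟩
    have h1 := hclose t ht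
    have h2 := hclose t' ht'
    have h3 := dist_triangle_right (A t f) (A t' f) a
    linarith
  choose W hW using hlim
  let W' := continuousLinearMapOfTendsto (l := l)
    (fun t => ((A t).toContinuousLinearEquiv : H →L[ℂ] H)) (f := W)
    (tendsto_pi_nhds.2 hW)
  exact ⟨W', hW⟩

end Cook

/-! ### Wave operators and scattering amplitudes with a scalar phase removed. -/

section WaveOperators

variable {n : ℕ}

/-- The operators `U(s,t) U₀(t,s)`. -/
def waveFamily (E : ℝ → Space n) (D : ℝ → (L2 n ≃ₗᵢ[ℂ] L2 n)) (s t : ℝ) : L2 n ≃ₗᵢ[ℂ] L2 n :=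
  (((frame E s).symm.trans (D t).symm).trans (D s)).trans (frame E s)

theorem waveFamily_apply (E : ℝ → Space n) (D : ℝ → (L2 n ≃ₗᵢ[ℂ] L2 n)) (s t : ℝ) (f : L2 n) :
    waveFamily E D s t f = frame E s (D s ((D t).symm ((frame E s).symm f))) := rfl

theorem waveFamily_eq (E : ℝ → Space n) (D : ℝ → (L2 n ≃ₗᵢ[ℂ] L2 n)) (s t : ℝ) (f : L2 n) :
    waveFamily E D s t f = evolution E D s t (frame E t ((frame E s).symm f)) := by
  rw [waveFamily_apply, evolution_apply, LinearIsometryEquiv.symm_apply_apply]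

/-- The velocity of `e^{-iθ(t)} U(s,t) U₀(t,s) f` when `θ' = q`. -/
def waveVelocity (E : ℝ → Space n) (v : ℝ → Space n →ᵇ ℂ) (D : ℝ → (L2 n ≃ₗᵢ[ℂ] L2 n)) (s : ℝ)
    (θ q : ℝ → ℝ) (f : L2 n) (t : ℝ) : L2 n :=
  (Complex.exp (-Complex.I * θ t) * Complex.I) • evolution E D s t
    (boundedMul (v t - BoundedContinuousFunction.const (Space n) (q t : ℂ))
      (frame E t ((frame E s).symm f)))

theorem norm_exp_neg_I_mul (x : ℝ) : ‖Complex.exp (-Complex.I * x)‖ = 1 := by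
  rw [neg_mul, ← mul_neg, mul_comm, ← Complex.ofReal_neg, Complex.norm_exp_ofReal_mul_I]

theorem norm_waveVelocity (E : ℝ → Space n) (v : ℝ → Space n →ᵇ ℂ) (D : ℝ → (L2 n ≃ₗᵢ[ℂ] L2 n))
    (s : ℝ) (θ q : ℝ → ℝ) (f : L2 n) (t : ℝ) :
    ‖waveVelocity E v D s θ q f t‖
      = ‖boundedMul (v t - BoundedContinuousFunction.const (Space n) (q t : ℂ))
        (frame E t ((frame E s).symm f))‖ := by
  rw [waveVelocity, norm_smul, norm_mul, Complex.norm_I, norm_exp_neg_I_mul,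
    LinearIsometryEquiv.norm_map, one_mul, one_mul]

section

variable {E : ℝ → Space n} (hE : LocallyIntegrable E volume)
  {v : ℝ → Space n →ᵇ ℂ} (hr : ∀ t x, starRingEnd ℂ (v t x) = v t x) {C : ℝ} (hC : ∀ t, ‖v t‖ ≤ C)
  (hc : ∀ x, Continuous fun t => v t x) {D : ℝ → (L2 n ≃ₗᵢ[ℂ] L2 n)}
  (hD : IsInteractionEvolution E v D)

include hE hr hC hc hD

/-- D is unitary, so its inverse is differentiated weakly by moving it to the other side of the
inner product, where symmetry of the interaction applies. The integrand is strongly continuous, so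
the weak identity is a strong one. -/
theorem symm_sub_eq_integral (φ : L2 n) (t₀ t₁ : ℝ) :
    (D t₁).symm φ - (D t₀).symm φ
      = ∫ t in t₀..t₁, Complex.I • (D t).symm (interaction E v t φ) := by
  have hcont : Continuous fun t => Complex.I • (D t).symm (interaction E v t φ) :=
    (continuous_isometry_apply (A := fun t => (D t).symm)
      (continuous_isometry_symm hD.continuous)
      (continuous_interaction hE hC hc continuous_const)).const_smul Complex.I
  refine ext_inner_left ℂ fun g => ?_
  rw [inner_sub_right, inner_symm_apply, inner_symm_apply,
    inner_intervalIntegral (hcont.intervalIntegrable _ _)]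
  have h1 : ∀ t, HasDerivAt (fun t => (inner ℂ (D t g) φ : ℂ))
      (inner ℂ g (Complex.I • (D t).symm (interaction E v t φ))) t := fun t => by
    refine ((hD g t).inner ℂ (hasDerivAt_const t φ)).congr_deriv ?_
    rw [inner_zero_right, zero_add, inner_smul_left, inner_smul_right, inner_symm_apply,
      interaction_symmetric E hr]
    simp
  exact (intervalIntegral.integral_eq_sub_of_hasDerivAt (fun t _ => h1 t)
    ((continuous_const.inner hcont).intervalIntegrable _ _)).symm

/-- The free motion has cancelled in U(s,t)U₀(t,s), so only the bounded potential is differentiated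
and the derivative exists for every f in L². -/
theorem hasDerivAt_waveFamily (s : ℝ) (f : L2 n) (t : ℝ) :
    HasDerivAt (fun t => waveFamily E D s t f)
      (Complex.I • evolution E D s t (boundedMul (v t) (frame E t ((frame E s).symm f)))) t := by
  set φ := (frame E s).symm f with hφ
  have hcont : Continuous fun t => Complex.I • (D t).symm (interaction E v t φ) :=
    (continuous_isometry_apply (A := fun t => (D t).symm)
      (continuous_isometry_symm hD.continuous)
      (continuous_interaction hE hC hc continuous_const)).const_smul Complex.I
  have h1 : HasDerivAt (fun t => (D t).symm φ) (Complex.I • (D t).symm (interaction E v t φ)) t := by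
    have h := (intervalIntegral.integral_hasDerivAt_right (hcont.intervalIntegrable 0 t)
      hcont.stronglyMeasurable.stronglyMeasurableAtFilter hcont.continuousAt).const_add
        ((D 0).symm φ)
    refine h.congr_of_eventuallyEq (Eventually.of_forall fun t => ?_)
    beta_reduce
    rw [← symm_sub_eq_integral hE hr hC hc hD φ 0 t, add_sub_cancel]
  have h2 := (((D s).trans (frame E s)).toContinuousLinearEquiv :
    L2 n →L[ℂ] L2 n).hasFDerivAt.restrictScalars ℝ |>.comp_hasDerivAt t h1
  refine h2.congr_deriv ?_
  change frame E s (D s (Complex.I • (D t).symm (interaction E v t φ))) = _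
  rw [map_smul, map_smul, evolution_apply, interaction_apply]

theorem hasDerivAt_modified_waveFamily (s : ℝ) {θ q : ℝ → ℝ} (hθ : ∀ t, HasDerivAt θ (q t) t)
    (f : L2 n) (t : ℝ) :
    HasDerivAt (fun t => Complex.exp (-Complex.I * θ t) • waveFamily E D s t f)
      (waveVelocity E v D s θ q f t) t := by
  have h1 : HasDerivAt (fun t => Complex.exp (-Complex.I * θ t))
      (Complex.exp (-Complex.I * θ t) * (-Complex.I * q t)) t :=
    ((hθ t).ofReal_comp.const_mul (-Complex.I)).cexp
  have h2 := hasDerivAt_waveFamily hE hr hC hc hD s f t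
  have h3 := HasDerivAt.fun_smul (c := fun t : ℝ => Complex.exp (-Complex.I * θ t)) h1 h2
  refine h3.congr_deriv ?_
  have h4 : boundedMul (v t - BoundedContinuousFunction.const (Space n) (q t : ℂ))
      (frame E t ((frame E s).symm f))
      = boundedMul (v t) (frame E t ((frame E s).symm f))
        - (q t : ℂ) • frame E t ((frame E s).symm f) := by
    rw [boundedMul_sub, boundedMul_const]
  rw [waveVelocity, h4, LinearIsometryEquiv.map_sub, LinearIsometryEquiv.map_smul, ← waveFamily_eq]
  module

theorem continuous_waveVelocity (s : ℝ) {θ q : ℝ → ℝ} (hθ : Continuous θ) (hq : Continuous q)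
    (f : L2 n) : Continuous (waveVelocity E v D s θ q f) := by
  have h1 : Continuous fun t => frame E t ((frame E s).symm f) := continuous_frame hE continuous_const
  have h2 : Continuous fun t => boundedMul (v t - BoundedContinuousFunction.const (Space n) (q t : ℂ))
      (frame E t ((frame E s).symm f)) := by
    simp only [boundedMul_sub, boundedMul_const]
    have h3 := continuous_boundedMul_apply hC hc h1
    fun_prop
  have h3 : Continuous fun t => evolution E D s t (boundedMul (v t -
      BoundedContinuousFunction.const (Space n) (q t : ℂ)) (frame E t ((frame E s).symm f))) :=
    continuous_isometry_apply (A := fun t => evolution E D s t)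
      (fun g => Continuous.comp (g := fun z : ℝ × ℝ => evolution E D z.1 z.2 g)
        (f := fun t => (s, t)) (continuous_evolution hE hD.continuous g)
        (Continuous.prodMk_right s)) h2
  have h4 : Continuous fun t => Complex.exp (-Complex.I * θ t) * Complex.I := by fun_prop
  exact h4.smul h3

theorem modified_waveFamily_sub (s : ℝ) {θ q : ℝ → ℝ} (hθ : ∀ t, HasDerivAt θ (q t) t)
    (hq : Continuous q) (f : L2 n) (t₀ t₁ : ℝ) :
    Complex.exp (-Complex.I * θ t₁) • waveFamily E D s t₁ f
      - Complex.exp (-Complex.I * θ t₀) • waveFamily E D s t₀ f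
      = ∫ t in t₀..t₁, waveVelocity E v D s θ q f t :=
  (intervalIntegral.integral_eq_sub_of_hasDerivAt
    (fun t _ => hasDerivAt_modified_waveFamily hE hr hC hc hD s hθ f t)
    ((continuous_waveVelocity hE hr hC hc hD s
      (continuous_iff_continuousAt.2 fun t => (hθ t).continuousAt) hq f).intervalIntegrable _ _)).symm

theorem integrable_waveVelocity (s : ℝ) {θ q : ℝ → ℝ} (hθ : Continuous θ) (hq : Continuous q)
    {f : L2 n} {k : ℝ → ℝ} (hk : Integrable k)
    (hf : ∀ t, ‖boundedMul (v t - BoundedContinuousFunction.const (Space n) (q t : ℂ))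
        (frame E t ((frame E s).symm f))‖ ≤ k t) :
    Integrable (waveVelocity E v D s θ q f) :=
  hk.mono' (continuous_waveVelocity hE hr hC hc hD s hθ hq f).aestronglyMeasurable
    (Eventually.of_forall fun t => by rw [norm_waveVelocity]; exact hf t)

/-- The estimates control V minus the scalar q. As q is integrable, adding it back keeps the
velocity integrable, and the unmodified family (phase θ = 0) converges. -/
theorem exists_tendsto_waveFamily (s : ℝ) {q : ℝ → ℝ} (hqi : Integrable q)
    {f : L2 n} {k : ℝ → ℝ} (hk : Integrable k)
    (hf : ∀ t, ‖boundedMul (v t - BoundedContinuousFunction.const (Space n) (q t : ℂ))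
        (frame E t ((frame E s).symm f))‖ ≤ k t) :
    (∃ a, Tendsto (fun t => waveFamily E D s t f) atTop (𝓝 a)) ∧
      ∃ b, Tendsto (fun t => waveFamily E D s t f) atBot (𝓝 b) := by
  let k' : ℝ → ℝ := fun t => k t + |q t| * ‖f‖
  have hk' : Integrable k' := hk.add (hqi.abs.mul_const _)
  have hf' : ∀ t, ‖boundedMul (v t - BoundedContinuousFunction.const (Space n) ((0 : ℝ) : ℂ))
        (frame E t ((frame E s).symm f))‖ ≤ k' t := fun t => by
    have h1 := hf t
    rw [boundedMul_sub, boundedMul_const] at h1 ⊢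
    have h2 : boundedMul (v t) (frame E t ((frame E s).symm f))
        - ((0 : ℝ) : ℂ) • frame E t ((frame E s).symm f)
        = (boundedMul (v t) (frame E t ((frame E s).symm f))
          - (q t : ℂ) • frame E t ((frame E s).symm f))
          + (q t : ℂ) • frame E t ((frame E s).symm f) := by simp
    rw [h2]
    refine (norm_add_le _ _).trans (add_le_add h1 ?_)
    rw [norm_smul, LinearIsometryEquiv.norm_map, LinearIsometryEquiv.norm_map, Complex.norm_real,
      Real.norm_eq_abs]
  have hz := modified_waveFamily_sub hE hr hC hc hD s (θ := fun _ => 0) (q := fun _ => 0)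
    (fun t => hasDerivAt_const t 0) continuous_const f
  have hi := integrable_waveVelocity hE hr hC hc hD s (θ := fun _ => 0) (q := fun _ => 0)
    continuous_const continuous_const hk' hf'
  obtain ⟨a, b, ha, hb, -, -⟩ := exists_tendsto_of_integrable_velocity hz hi
  simp only [Complex.ofReal_zero, mul_zero, Complex.exp_zero, one_smul] at ha hb
  exact ⟨⟨a, ha⟩, ⟨b, hb⟩⟩

/-- The first order expansion of the scattering amplitude, with an error of second order. -/
theorem norm_inner_wave_limits_sub_le (s : ℝ) {q : ℝ → ℝ} (hq : Continuous q) (hqi : Integrable q)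
    {g h : L2 n} {kg kh : ℝ → ℝ} (hkg : Integrable kg) (hkh : Integrable kh)
    (hg : ∀ t, ‖boundedMul (v t - BoundedContinuousFunction.const (Space n) (q t : ℂ))
        (frame E t ((frame E s).symm g))‖ ≤ kg t)
    (hh : ∀ t, ‖boundedMul (v t - BoundedContinuousFunction.const (Space n) (q t : ℂ))
        (frame E t ((frame E s).symm h))‖ ≤ kh t) {a b : L2 n}
    (ha : Tendsto (fun t => waveFamily E D s t h) atTop (𝓝 a))
    (hb : Tendsto (fun t => waveFamily E D s t g) atBot (𝓝 b)) :
    ‖Complex.exp (Complex.I * (∫ t, q t : ℝ)) * inner ℂ a b - inner ℂ h g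
      + Complex.I * ∫ t, (inner ℂ (frame E t ((frame E s).symm h))
        (boundedMul (v t - BoundedContinuousFunction.const (Space n) (q t : ℂ))
          (frame E t ((frame E s).symm g))) : ℂ)‖ ≤ (∫ t, kh t) * ∫ t, kg t := by
  let θ : ℝ → ℝ := fun t => ∫ τ in (0 : ℝ)..t, q τ
  have hθ : ∀ t, HasDerivAt θ (q t) t := fun t =>
    intervalIntegral.integral_hasDerivAt_right (hq.intervalIntegrable _ _)
      hq.stronglyMeasurable.stronglyMeasurableAtFilter hq.continuousAt
  have hθc : Continuous θ := continuous_iff_continuousAt.2 fun t => (hθ t).continuousAt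
  have ht : Tendsto θ atTop (𝓝 (∫ t in Set.Ioi 0, q t)) :=
    intervalIntegral_tendsto_integral_Ioi 0 hqi.integrableOn tendsto_id
  have hbot : Tendsto θ atBot (𝓝 (-∫ t in Set.Iic 0, q t)) := by
    refine (intervalIntegral_tendsto_integral_Iic 0 hqi.integrableOn tendsto_id).neg.congr fun t => ?_
    rw [id, ← intervalIntegral.integral_symm]
  have hexp : Continuous fun x : ℝ => Complex.exp (-Complex.I * x) := by fun_prop
  have hzh := modified_waveFamily_sub hE hr hC hc hD s hθ hq h
  have hzg := modified_waveFamily_sub hE hr hC hc hD s hθ hq g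
  have hih := integrable_waveVelocity hE hr hC hc hD s hθc hq hkh hh
  have hig := integrable_waveVelocity hE hr hC hc hD s hθc hq hkg hg
  have hzc : Continuous fun t => Complex.exp (-Complex.I * θ t) • waveFamily E D s t h :=
    continuous_iff_continuousAt.2 fun t =>
      (hasDerivAt_modified_waveFamily hE hr hC hc hD s hθ h t).continuousAt
  have hconj : ∀ x : ℝ, starRingEnd ℂ (Complex.exp (-Complex.I * x)) = Complex.exp (Complex.I * x) :=
    fun x => by rw [← Complex.exp_conj]; simp
  have hunit : ∀ x : ℝ, Complex.exp (-Complex.I * x) * Complex.exp (Complex.I * x) = 1 := fun x => by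
    rw [← Complex.exp_add]; simp
  -- The pairing along the two paths is constant: both carry the same unitary and the same scalar
  -- phase.
  have key := norm_inner_limits_sub_le hzh hzg hih hig hzc (p := inner ℂ h g)
    (fun t => by
      rw [inner_smul_left, inner_smul_right, LinearIsometryEquiv.inner_map_map, hconj, ← mul_assoc,
        mul_comm (Complex.exp (Complex.I * θ t)), hunit, one_mul])
    (((hexp.tendsto _).comp ht).smul ha) (((hexp.tendsto _).comp hbot).smul hb)
  -- The phases at +∞ and -∞ combine to θ(+∞) - θ(-∞) = ∫ q.
  have e1 : inner ℂ (Complex.exp (-Complex.I * (∫ t in Set.Ioi 0, q t : ℝ)) • a)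
      (Complex.exp (-Complex.I * (-∫ t in Set.Iic 0, q t : ℝ)) • b)
      = Complex.exp (Complex.I * (∫ t, q t : ℝ)) * inner ℂ a b := by
    rw [inner_smul_left, inner_smul_right, hconj, ← mul_assoc, ← Complex.exp_add,
      ← intervalIntegral.integral_Iic_add_Ioi hqi.integrableOn hqi.integrableOn (b := (0 : ℝ))]
    congr 2
    push_cast; ring
  have e2 : ∀ t, inner ℂ (Complex.exp (-Complex.I * θ t) • waveFamily E D s t h)
      (waveVelocity E v D s θ q g t) = Complex.I * inner ℂ (frame E t ((frame E s).symm h))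
        (boundedMul (v t - BoundedContinuousFunction.const (Space n) (q t : ℂ))
          (frame E t ((frame E s).symm g))) := fun t => by
    rw [waveVelocity, inner_smul_left, inner_smul_right, waveFamily_eq,
      LinearIsometryEquiv.inner_map_map, hconj]
    linear_combination (Complex.I * inner ℂ (frame E t ((frame E s).symm h))
        (boundedMul (v t - BoundedContinuousFunction.const (Space n) (q t : ℂ))
          (frame E t ((frame E s).symm g)))) * hunit (θ t)
  rw [e1] at key
  simp only [e2] at key
  rw [integral_const_mul] at key
  refine key.trans ?_
  simp only [norm_waveVelocity]
  have n1 : ∫ t, ‖boundedMul (v t - BoundedContinuousFunction.const (Space n) (q t : ℂ))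
      (frame E t ((frame E s).symm h))‖ ≤ ∫ t, kh t :=
    integral_mono_of_nonneg (Eventually.of_forall fun t => norm_nonneg _) hkh
      (Eventually.of_forall hh)
  have n2 : ∫ t, ‖boundedMul (v t - BoundedContinuousFunction.const (Space n) (q t : ℂ))
      (frame E t ((frame E s).symm g))‖ ≤ ∫ t, kg t :=
    integral_mono_of_nonneg (Eventually.of_forall fun t => norm_nonneg _) hkg
      (Eventually.of_forall hg)
  exact mul_le_mul n1 n2 (integral_nonneg fun t => norm_nonneg _)
    ((integral_nonneg fun t => norm_nonneg _).trans n1)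

end

end WaveOperators

/-! ### The limit l → ∞ of the scattering amplitude. -/

section HighVelocity

variable {n : ℕ}

/-- The matrix element of the oscillation of the potential between freely moving packets. -/
def amplitude (v : ℝ → Space n →ᵇ ℂ) (τ t : ℝ) (c : Space n) (ψ φ : L2 n) : ℂ :=
  inner ℂ (multiplier (quadPhase τ c 0) ψ)
    (boundedMul (v t - BoundedContinuousFunction.const (Space n) (v t c))
      (multiplier (quadPhase τ c 0) φ))

theorem inner_multiplier_quadPhase_eq_amplitude (v : ℝ → Space n →ᵇ ℂ) (τ t a : ℝ) (c : Space n)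
    (ψ φ : L2 n) :
    inner ℂ (multiplier (quadPhase τ c a) ψ)
      (boundedMul (v t - BoundedContinuousFunction.const (Space n) (v t c))
        (multiplier (quadPhase τ c a) φ)) = amplitude v τ t c ψ φ := by
  rw [multiplier_quadPhase_action, multiplier_quadPhase_action τ c a φ, map_smul, inner_smul_left,
    inner_smul_right, ← mul_assoc, ← Complex.exp_conj, ← Complex.exp_add, amplitude]
  simp

theorem PotentialBounds.continuous_amplitude {δ C : ℝ} {V : ℝ → Space n → ℝ}
    (h : PotentialBounds δ C V) (hδ : 0 ≤ δ) :
    Continuous fun p : ℝ × ℝ × Space n × L2 n × L2 n =>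
      amplitude (h.toBCF hδ) p.1 p.2.1 p.2.2.1 p.2.2.2.1 p.2.2.2.2 := by
  have hm : ∀ g : L2 n, Continuous fun p : ℝ × ℝ × Space n × L2 n × L2 n =>
      multiplier (quadPhase p.1 p.2.2.1 0) g :=
    continuous_multiplier (θ := fun p : ℝ × ℝ × Space n × L2 n × L2 n => quadPhase p.1 p.2.2.1 0)
      fun x => by simp only [quadPhase_apply]; fun_prop
  have hb : ∀ g : L2 n, Continuous fun p : ℝ × ℝ × Space n × L2 n × L2 n =>
      boundedMul (h.toBCF hδ p.2.1) g := fun g =>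
    Continuous.comp (g := fun t => boundedMul (h.toBCF hδ t) g)
      (f := fun p : ℝ × ℝ × Space n × L2 n × L2 n => p.2.1)
      (continuous_boundedMul (h.norm_toBCF_le hδ) (h.continuous_toBCF hδ) g) (by fun_prop)
  have h1 : Continuous fun p : ℝ × ℝ × Space n × L2 n × L2 n =>
      multiplier (quadPhase p.1 p.2.2.1 0) p.2.2.2.1 :=
    continuous_isometry_apply (A := fun p : ℝ × ℝ × Space n × L2 n × L2 n =>
      multiplier (quadPhase p.1 p.2.2.1 0)) hm (by fun_prop)
  have h2 : Continuous fun p : ℝ × ℝ × Space n × L2 n × L2 n =>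
      multiplier (quadPhase p.1 p.2.2.1 0) p.2.2.2.2 :=
    continuous_isometry_apply (A := fun p : ℝ × ℝ × Space n × L2 n × L2 n =>
      multiplier (quadPhase p.1 p.2.2.1 0)) hm (by fun_prop)
  have h3 : Continuous fun p : ℝ × ℝ × Space n × L2 n × L2 n =>
      boundedMul (h.toBCF hδ p.2.1) (multiplier (quadPhase p.1 p.2.2.1 0) p.2.2.2.2) :=
    continuous_clm_apply_of_bounded (A := fun p : ℝ × ℝ × Space n × L2 n × L2 n =>
      boundedMul (h.toBCF hδ p.2.1))
      (fun p => (norm_boundedMul_le _).trans (h.norm_toBCF_le hδ p.2.1)) hb h2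
  have h4 : Continuous fun p : ℝ × ℝ × Space n × L2 n × L2 n => h.toBCF hδ p.2.1 p.2.2.1 := by
    simp only [h.toBCF_apply]
    exact Complex.continuous_ofReal.comp (h.continuous.comp (by fun_prop :
      Continuous fun p : ℝ × ℝ × Space n × L2 n × L2 n => (p.2.1, p.2.2.1)))
  simp only [amplitude, boundedMul_sub, boundedMul_const]
  exact h1.inner (h3.sub (h4.smul h2))

/-- On the time scale 1/l neither the field nor the shift β contributes: the path becomes the
straight line u w with the time frozen at s. -/
theorem tendsto_centre {E : ℝ → Space n} (hE : LocallyIntegrable E volume) (s : ℝ) (w β : Space n)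
    (u : ℝ) : Tendsto (fun l : ℝ => centre E s (l • w - β) (s + u / l)) atTop (𝓝 (u • w)) := by
  have h0 : Tendsto (fun l : ℝ => u / l) atTop (𝓝 0) := tendsto_const_nhds.div_atTop tendsto_id
  have h1 : Tendsto (fun l : ℝ => displacement E (s + u / l)) atTop (𝓝 (displacement E s)) := by
    have h2 : Tendsto (fun l : ℝ => s + u / l) atTop (𝓝 s) := by simpa using h0.const_add s
    exact ((continuous_displacement hE).tendsto s).comp h2
  have h3 := ((h1.sub_const (displacement E s)).add_const (u • w)).sub
    (h0.smul_const (β + drift E s))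
  simp only [sub_self, zero_add, zero_smul, sub_zero] at h3
  refine h3.congr' ?_
  filter_upwards [eventually_gt_atTop 0] with l hl
  have h4 : (u / l) • l • w = u • w := by rw [smul_smul, div_mul_cancel₀ _ hl.ne']
  rw [centre, add_sub_cancel_left, smul_sub, smul_sub, h4, smul_add]
  abel

theorem integral_scale {F : Type*} [NormedAddCommGroup F] [NormedSpace ℝ F] (g : ℝ → F) (s : ℝ)
    {l : ℝ} (hl : 0 < l) : ∫ u, g (s + u / l) = l • ∫ t, g t := by
  have h1 := Measure.integral_comp_mul_left (fun t => g (s + t)) l⁻¹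
  simp only [inv_mul_eq_div] at h1
  rw [h1, integral_add_left_eq_self g s, inv_inv, abs_of_pos hl]

theorem integrable_one_add_abs_rpow {γ : ℝ} (hγ : 1 < γ) :
    Integrable fun u : ℝ => (1 + |u|) ^ (-γ) := by
  have := integrable_one_add_norm (E := ℝ) (μ := volume) (r := γ) (by simpa using hγ)
  simpa only [Real.norm_eq_abs] using this

theorem integrable_one_add_mul_abs_rpow {γ : ℝ} (hγ : 1 < γ) (s : ℝ) {l : ℝ} (hl : 0 < l) :
    Integrable fun t : ℝ => (1 + l * |t - s|) ^ (-γ) := by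
  have h1 := ((integrable_one_add_abs_rpow hγ).comp_mul_left' hl.ne').comp_sub_right s
  simpa only [abs_mul, abs_of_pos hl] using h1

theorem integral_one_add_mul_abs_rpow (γ s : ℝ) {l : ℝ} (hl : 0 < l) :
    ∫ t : ℝ, (1 + l * |t - s|) ^ (-γ) = l⁻¹ * ∫ u : ℝ, (1 + |u|) ^ (-γ) := by
  have h1 := integral_scale (fun t : ℝ => (1 + l * |t - s|) ^ (-γ)) s hl
  have h2 : ∀ u : ℝ, l * |s + u / l - s| = |u| := fun u => by
    rw [add_sub_cancel_left, abs_div, abs_of_pos hl]; field_simp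
  simp only [h2, smul_eq_mul] at h1
  rw [h1]; field_simp

/-- The wave packets used as test states. -/
def packet (w β : Space n) (l : ℝ) (f : 𝓢(Space n, ℂ)) : L2 n :=
  phase (linPhase (l • w - β)) (toL2 ((boost w (l * ‖w‖ ^ 2)⁻¹)^[3] f))

theorem tendsto_toL2_boost {w : Space n} (hw : w ≠ 0) (f : 𝓢(Space n, ℂ)) :
    Tendsto (fun l : ℝ => toL2 ((boost w (l * ‖w‖ ^ 2)⁻¹)^[3] f)) atTop (𝓝 (toL2 f)) := by
  have hw2 : 0 < ‖w‖ ^ 2 := by have := norm_pos_iff.2 hw; positivity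
  have h1 : Tendsto (fun l : ℝ => (l * ‖w‖ ^ 2)⁻¹) atTop (𝓝 0) :=
    (tendsto_id.atTop_mul_const hw2).inv_tendsto_atTop
  have h2 := (continuous_toL2_iterate_boost w 3 f).tendsto 0
  rw [iterate_boost_zero] at h2
  exact h2.comp h1

theorem inner_packet (w β : Space n) (l : ℝ) (f g : 𝓢(Space n, ℂ)) :
    inner ℂ (packet w β l f) (packet w β l g)
      = (inner ℂ (toL2 ((boost w (l * ‖w‖ ^ 2)⁻¹)^[3] f))
        (toL2 ((boost w (l * ‖w‖ ^ 2)⁻¹)^[3] g)) : ℂ) := by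
  rw [packet, packet, LinearIsometryEquiv.inner_map_map]

theorem denseRange_packet {w : Space n} (hw : w ≠ 0) (β : Space n) (l : ℝ) :
    DenseRange (packet w β l) :=
  (phase (linPhase (l • w - β))).surjective.denseRange.comp (denseRange_iterate_boost hw _)
    (phase (linPhase (l • w - β))).continuous

theorem PotentialBounds.continuous_centre_value {E : ℝ → Space n}
    (hE : LocallyIntegrable E volume) {δ C : ℝ} {V : ℝ → Space n → ℝ}
    (h : PotentialBounds δ C V) (s : ℝ) (w : Space n) :
    Continuous fun t => V t (centre E s w t) :=
  h.continuous.comp (continuous_id.prodMk (continuous_centre hE s w))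

theorem PacketEstimate.integrable_centre_value {E : ℝ → Space n}
    (hE : LocallyIntegrable E volume) {δ C : ℝ} {V : ℝ → Space n → ℝ}
    (h : PotentialBounds δ C V) (hδ : 0 ≤ δ) {s : ℝ} {w β : Space n} {γ l₀ : ℝ} (hγ : 1 < γ)
    (hP : PacketEstimate E s w β (h.toBCF hδ) γ l₀) {l : ℝ} (hl : l₀ ≤ l) :
    Integrable fun t => V t (centre E s (l • w - β) t) := by
  obtain ⟨K, hK, H⟩ := hP.centre_bound l hl
  have h1 := (integrable_one_add_mul_abs_rpow hγ s one_pos).const_mul K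
  refine h1.mono' (h.continuous_centre_value hE s _).aestronglyMeasurable
    (Eventually.of_forall fun t => ?_)
  have := H t
  rw [h.toBCF_apply, Complex.norm_real] at this
  simpa using this

theorem PacketEstimate.exists_norm_packet_le {E : ℝ → Space n} {δ C : ℝ} {V : ℝ → Space n → ℝ}
    (h : PotentialBounds δ C V) (hδ : 0 ≤ δ) {s : ℝ} {w β : Space n} {γ l₀ : ℝ}
    (hP : PacketEstimate E s w β (h.toBCF hδ) γ l₀) (f : 𝓢(Space n, ℂ)) :
    ∃ K, 0 ≤ K ∧ ∀ l ≥ l₀, ∀ t,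
      ‖boundedMul (h.toBCF hδ t - BoundedContinuousFunction.const (Space n)
          ((V t (centre E s (l • w - β) t) : ℝ) : ℂ))
        (frame E t ((frame E s).symm (packet w β l f)))‖ ≤ K * (1 + l * |t - s|) ^ (-γ) := by
  obtain ⟨K, hK, H⟩ := hP.bound f
  refine ⟨K, hK, fun l hl t => ?_⟩
  obtain ⟨a, ha⟩ := exists_free_evolution_eq E s (l • w - β) t
  rw [packet, ha, boundedMul_phase, LinearIsometryEquiv.norm_map]
  exact H l hl t a

theorem PacketEstimate.exists_waveOperators {E : ℝ → Space n}
    (hE : LocallyIntegrable E volume) {δ C : ℝ} {V : ℝ → Space n → ℝ}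
    (h : PotentialBounds δ C V) (hδ : 0 ≤ δ) {s : ℝ} {w β : Space n} {γ l₀ : ℝ} (hγ : 1 < γ)
    (hl₀ : 1 ≤ l₀) (hP : PacketEstimate E s w β (h.toBCF hδ) γ l₀)
    {D : ℝ → (L2 n ≃ₗᵢ[ℂ] L2 n)}
    (hD : IsInteractionEvolution E (h.toBCF hδ) D) (hw : w ≠ 0) :
    (∃ W : L2 n →L[ℂ] L2 n, ∀ f, Tendsto (fun t => waveFamily E D s t f) atTop (𝓝 (W f))) ∧
      ∃ W : L2 n →L[ℂ] L2 n, ∀ f, Tendsto (fun t => waveFamily E D s t f) atBot (𝓝 (W f)) := by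
  have hr : ∀ t x, starRingEnd ℂ (h.toBCF hδ t x) = h.toBCF hδ t x := fun t x => by
    rw [h.toBCF_apply, Complex.conj_ofReal]
  have key : ∀ f : 𝓢(Space n, ℂ),
      (∃ a, Tendsto (fun t => waveFamily E D s t (packet w β l₀ f)) atTop (𝓝 a)) ∧
        ∃ b, Tendsto (fun t => waveFamily E D s t (packet w β l₀ f)) atBot (𝓝 b) := fun f => by
    obtain ⟨K, hK, H⟩ := hP.exists_norm_packet_le h hδ f
    exact exists_tendsto_waveFamily hE hr (h.norm_toBCF_le hδ) (h.continuous_toBCF hδ) hD s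
      (hP.integrable_centre_value hE h hδ hγ le_rfl)
      ((integrable_one_add_mul_abs_rpow hγ s (by linarith : 0 < l₀)).const_mul K) (H l₀ le_rfl)
  exact ⟨exists_strong_limit (denseRange_packet hw β l₀) fun f => (key f).1,
    exists_strong_limit (denseRange_packet hw β l₀) fun f => (key f).2⟩

theorem inner_free_packet (E : ℝ → Space n) (v : ℝ → Space n →ᵇ ℂ) (s : ℝ) (w β : Space n)
    (ψ φ : 𝓢(Space n, ℂ)) (l t : ℝ) :
    inner ℂ (frame E t ((frame E s).symm (packet w β l ψ)))
      (boundedMul (v t - BoundedContinuousFunction.const (Space n)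
          (v t (centre E s (l • w - β) t)))
        (frame E t ((frame E s).symm (packet w β l φ))))
      = amplitude v (t - s) t (centre E s (l • w - β) t)
        (toL2 ((boost w (l * ‖w‖ ^ 2)⁻¹)^[3] ψ)) (toL2 ((boost w (l * ‖w‖ ^ 2)⁻¹)^[3] φ)) := by
  obtain ⟨a, ha⟩ := exists_free_evolution_eq E s (l • w - β) t
  rw [packet, packet, ha, ha, boundedMul_phase, LinearIsometryEquiv.inner_map_map,
    ← inner_multiplier_quadPhase_eq_amplitude v (t - s) t a]

theorem PotentialBounds.tendsto_amplitude {δ C : ℝ} {V : ℝ → Space n → ℝ}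
    (h : PotentialBounds δ C V) (hδ : 0 ≤ δ) {L : Filter ℝ} {τ t : ℝ → ℝ} {c : ℝ → Space n}
    {ψ φ : ℝ → L2 n} {τ₀ t₀ : ℝ} {c₀ : Space n} {ψ₀ φ₀ : L2 n} (hτ : Tendsto τ L (𝓝 τ₀))
    (ht : Tendsto t L (𝓝 t₀)) (hc : Tendsto c L (𝓝 c₀)) (hψ : Tendsto ψ L (𝓝 ψ₀))
    (hφ : Tendsto φ L (𝓝 φ₀)) :
    Tendsto (fun l => amplitude (h.toBCF hδ) (τ l) (t l) (c l) (ψ l) (φ l)) L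
      (𝓝 (amplitude (h.toBCF hδ) τ₀ t₀ c₀ ψ₀ φ₀)) := by
  have hA := h.continuous_amplitude hδ
  generalize amplitude (h.toBCF hδ) = A at hA ⊢
  exact (hA.tendsto (τ₀, t₀, c₀, ψ₀, φ₀)).comp
    (hτ.prodMk_nhds (ht.prodMk_nhds (hc.prodMk_nhds (hψ.prodMk_nhds hφ))))

theorem PotentialBounds.continuous_amplitude_comp {δ C : ℝ} {V : ℝ → Space n → ℝ}
    (h : PotentialBounds δ C V) (hδ : 0 ≤ δ) {τ t : ℝ → ℝ} {c : ℝ → Space n} (ψ φ : L2 n)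
    (hτ : Continuous τ) (ht : Continuous t) (hc : Continuous c) :
    Continuous fun u => amplitude (h.toBCF hδ) (τ u) (t u) (c u) ψ φ :=
  continuous_iff_continuousAt.2 fun u => h.tendsto_amplitude hδ (hτ.tendsto u) (ht.tendsto u)
    (hc.tendsto u) tendsto_const_nhds tendsto_const_nhds

/-- The substitution t = s + u/l absorbs the factor l and turns the packet estimate into the
majorant (1 + |u|)^{-γ}, uniform in l and integrable since γ > 1. Pointwise, the free spreading over
time u/l disappears and the boosts tend to the identity. -/
theorem PacketEstimate.tendsto_integral_amplitude {E : ℝ → Space n}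
    (hE : LocallyIntegrable E volume) {δ C : ℝ} {V : ℝ → Space n → ℝ}
    (h : PotentialBounds δ C V) (hδ : 0 ≤ δ) {s : ℝ} {w β : Space n} {γ l₀ : ℝ} (hγ : 1 < γ)
    (hl₀ : 1 ≤ l₀) (hP : PacketEstimate E s w β (h.toBCF hδ) γ l₀) (hw : w ≠ 0)
    (ψ φ : 𝓢(Space n, ℂ)) :
    Tendsto (fun l : ℝ => (l : ℂ) * ∫ t, amplitude (h.toBCF hδ) (t - s) t
        (centre E s (l • w - β) t) (toL2 ((boost w (l * ‖w‖ ^ 2)⁻¹)^[3] ψ))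
        (toL2 ((boost w (l * ‖w‖ ^ 2)⁻¹)^[3] φ))) atTop
      (𝓝 (∫ u : ℝ, amplitude (h.toBCF hδ) 0 s (u • w) (toL2 ψ) (toL2 φ))) := by
  obtain ⟨K2, hK2, H2⟩ := hP.exists_norm_packet_le h hδ φ
  obtain ⟨K3, hK3, H3⟩ := exists_norm_toL2_iterate_boost_le w 3 ψ
  have h1 : ∀ᶠ l : ℝ in atTop, (∫ u : ℝ, amplitude (h.toBCF hδ) (u / l) (s + u / l)
        (centre E s (l • w - β) (s + u / l))
        (toL2 ((boost w (l * ‖w‖ ^ 2)⁻¹)^[3] ψ)) (toL2 ((boost w (l * ‖w‖ ^ 2)⁻¹)^[3] φ)))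
        = (l : ℂ) * ∫ t, amplitude (h.toBCF hδ) (t - s) t (centre E s (l • w - β) t)
        (toL2 ((boost w (l * ‖w‖ ^ 2)⁻¹)^[3] ψ)) (toL2 ((boost w (l * ‖w‖ ^ 2)⁻¹)^[3] φ)) := by
    filter_upwards [eventually_gt_atTop 0] with l hl
    have h2 := integral_scale (fun t => amplitude (h.toBCF hδ) (t - s) t
        (centre E s (l • w - β) t)
        (toL2 ((boost w (l * ‖w‖ ^ 2)⁻¹)^[3] ψ)) (toL2 ((boost w (l * ‖w‖ ^ 2)⁻¹)^[3] φ))) s hl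
    simp only [add_sub_cancel_left] at h2
    rw [h2, Complex.real_smul]
  refine Tendsto.congr' h1 ?_
  refine tendsto_integral_filter_of_dominated_convergence
    (fun u => K3 * (K2 * (1 + |u|) ^ (-γ))) ?_ ?_ ?_ ?_
  · refine Eventually.of_forall fun l => Continuous.aestronglyMeasurable ?_
    have hu : Continuous fun u : ℝ => s + u / l := by fun_prop
    exact h.continuous_amplitude_comp hδ _ _ (by fun_prop) hu
      ((continuous_centre hE s (l • w - β)).comp hu)
  · filter_upwards [eventually_ge_atTop l₀, eventually_ge_atTop (‖w‖ ^ 2)⁻¹] with l hl hl'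
    refine Eventually.of_forall fun u => ?_
    have hl0 : 0 < l := by linarith
    have hε := boost_parameter_le_one hw (hl₀.trans hl) hl'
    have h3 := inner_free_packet E (h.toBCF hδ) s w β ψ φ l (s + u / l)
    rw [add_sub_cancel_left] at h3
    rw [← h3]
    refine (norm_inner_le_norm _ _).trans (mul_le_mul ?_ ?_ (norm_nonneg _) hK3)
    · rw [LinearIsometryEquiv.norm_map, LinearIsometryEquiv.norm_map, packet,
        LinearIsometryEquiv.norm_map]
      exact H3 _ hε.1 hε.2
    · rw [h.toBCF_apply]
      refine (H2 l hl (s + u / l)).trans (le_of_eq ?_)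
      rw [add_sub_cancel_left, abs_div, abs_of_pos hl0, mul_div_cancel₀ _ hl0.ne']
  · exact ((integrable_one_add_abs_rpow hγ).const_mul K2).const_mul K3
  · refine Eventually.of_forall fun u => ?_
    have h0 : Tendsto (fun l : ℝ => u / l) atTop (𝓝 0) := tendsto_const_nhds.div_atTop tendsto_id
    have h2 : Tendsto (fun l : ℝ => s + u / l) atTop (𝓝 s) := by simpa using h0.const_add s
    exact h.tendsto_amplitude hδ h0 h2 (tendsto_centre hE s w β u) (tendsto_toL2_boost hw ψ)
      (tendsto_toL2_boost hw φ)

/-- The high velocity limit of the scattering amplitude. -/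
theorem PacketEstimate.tendsto_scattering_amplitude {E : ℝ → Space n}
    (hE : LocallyIntegrable E volume) {δ C : ℝ} {V : ℝ → Space n → ℝ}
    (h : PotentialBounds δ C V) (hδ : 0 ≤ δ) {s : ℝ} {w β : Space n} {γ l₀ : ℝ} (hγ : 1 < γ)
    (hl₀ : 1 ≤ l₀) (hP : PacketEstimate E s w β (h.toBCF hδ) γ l₀)
    {D : ℝ → (L2 n ≃ₗᵢ[ℂ] L2 n)}
    (hD : IsInteractionEvolution E (h.toBCF hδ) D) (hw : w ≠ 0) {Wp Wm : L2 n → L2 n}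
    (hWp : ∀ f, Tendsto (fun t => waveFamily E D s t f) atTop (𝓝 (Wp f)))
    (hWm : ∀ f, Tendsto (fun t => waveFamily E D s t f) atBot (𝓝 (Wm f))) (ψ φ : 𝓢(Space n, ℂ)) :
    Tendsto (fun l : ℝ => (l : ℂ) *
      (Complex.exp (Complex.I * (∫ t, V t (centre E s (l • w - β) t) : ℝ))
          * inner ℂ (Wp (packet w β l ψ)) (Wm (packet w β l φ))
        - inner ℂ (packet w β l ψ) (packet w β l φ))) atTop
      (𝓝 (-Complex.I * ∫ u : ℝ, amplitude (h.toBCF hδ) 0 s (u • w) (toL2 ψ) (toL2 φ))) := by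
  have hr : ∀ t x, starRingEnd ℂ (h.toBCF hδ t x) = h.toBCF hδ t x := fun t x => by
    rw [h.toBCF_apply, Complex.conj_ofReal]
  obtain ⟨K1, hK1, H1⟩ := hP.exists_norm_packet_le h hδ ψ
  obtain ⟨K2, hK2, H2⟩ := hP.exists_norm_packet_le h hδ φ
  have hlim := hP.tendsto_integral_amplitude hE h hδ hγ hl₀ hw ψ φ
  obtain ⟨I, hI⟩ : ∃ I : ℝ → ℂ, ∀ l, I l = ∫ t, amplitude (h.toBCF hδ) (t - s) t
        (centre E s (l • w - β) t) (toL2 ((boost w (l * ‖w‖ ^ 2)⁻¹)^[3] ψ))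
        (toL2 ((boost w (l * ‖w‖ ^ 2)⁻¹)^[3] φ)) := ⟨_, fun _ => rfl⟩
  simp only [← hI] at hlim
  obtain ⟨c₁, hc₁⟩ : ∃ c₁ : ℝ, c₁ = ∫ u : ℝ, (1 + |u|) ^ (-γ) := ⟨_, rfl⟩
  -- Each time integral is O(1/l), so the second-order error is O(l⁻²) and still vanishes after
  -- multiplication by l.
  have herr : ∀ l ≥ l₀, ‖Complex.exp (Complex.I * (∫ t, V t (centre E s (l • w - β) t) : ℝ))
          * inner ℂ (Wp (packet w β l ψ)) (Wm (packet w β l φ))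
        - inner ℂ (packet w β l ψ) (packet w β l φ) + Complex.I * I l‖
        ≤ K1 * (l⁻¹ * c₁) * (K2 * (l⁻¹ * c₁)) := fun l hl => by
    have hl0 : 0 < l := by linarith
    have h1 := norm_inner_wave_limits_sub_le hE hr (h.norm_toBCF_le hδ) (h.continuous_toBCF hδ) hD s
      (h.continuous_centre_value hE s _) (hP.integrable_centre_value hE h hδ hγ hl)
      ((integrable_one_add_mul_abs_rpow hγ s hl0).const_mul K2)
      ((integrable_one_add_mul_abs_rpow hγ s hl0).const_mul K1) (H2 l hl) (H1 l hl)
      (hWp _) (hWm _)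
    rw [integral_const_mul, integral_const_mul, integral_one_add_mul_abs_rpow γ s hl0, ← hc₁] at h1
    have h2 := inner_free_packet E (h.toBCF hδ) s w β ψ φ l
    simp only [h.toBCF_apply] at h2
    simp only [h2, ← hI] at h1
    exact h1
  have herr0 : Tendsto (fun l : ℝ => (l : ℂ) *
      (Complex.exp (Complex.I * (∫ t, V t (centre E s (l • w - β) t) : ℝ))
          * inner ℂ (Wp (packet w β l ψ)) (Wm (packet w β l φ))
        - inner ℂ (packet w β l ψ) (packet w β l φ) + Complex.I * I l)) atTop (𝓝 0) := by
    have h1 : Tendsto (fun l : ℝ => K1 * c₁ * (K2 * c₁) * l⁻¹) atTop (𝓝 0) := by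
      simpa using tendsto_inv_atTop_zero.const_mul (K1 * c₁ * (K2 * c₁))
    refine squeeze_zero_norm' ?_ h1
    filter_upwards [eventually_ge_atTop l₀] with l hl
    have hl0 : 0 < l := by linarith
    rw [norm_mul, Complex.norm_real, Real.norm_eq_abs, abs_of_pos hl0]
    refine (mul_le_mul_of_nonneg_left (herr l hl) hl0.le).trans (le_of_eq ?_)
    field_simp
  have h5 := herr0.sub (hlim.const_mul Complex.I)
  rw [zero_sub, ← neg_mul] at h5
  refine h5.congr fun l => ?_
  ring

end HighVelocity

/-! ### From scattering amplitudes to integrals along lines. -/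

section LineIntegrals

variable {n : ℕ}

theorem amplitude_zero_toL2 (v : ℝ → Space n →ᵇ ℂ) (t : ℝ) (c : Space n) (ψ φ : 𝓢(Space n, ℂ)) :
    amplitude v 0 t c (toL2 ψ) (toL2 φ)
      = ∫ x, starRingEnd ℂ (ψ x) * φ x * (v t (x + c) - v t c) := by
  have hθ := quadPhase_hasTemperateGrowth (n := n) 0 c 0
  have hm : ∀ f : 𝓢(Space n, ℂ), multiplier (quadPhase 0 c 0) (toL2 f) =ᵐ[volume]
      fun x => f (x - c) := fun f => by
    rw [← toL2_schwartzMultiplier hθ, toL2_apply]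
    filter_upwards [(schwartzMultiplier (quadPhase 0 c 0) f).coeFn_toLp 2
      (volume : Measure (Space n))] with x hx
    rw [hx, schwartzMultiplier_quadPhase_zero_apply]
  rw [amplitude, L2.inner_def]
  rw [← integral_sub_right_eq_self
    (fun x => starRingEnd ℂ (ψ x) * φ x * (v t (x + c) - v t c)) c]
  refine integral_congr_ae ?_
  filter_upwards [hm ψ, hm φ, boundedMul_coeFn
    (v t - BoundedContinuousFunction.const (Space n) (v t c))
    (multiplier (quadPhase 0 c 0) (toL2 φ))] with x h1 h2 h3
  rw [h3, h1, h2, sub_add_cancel, RCLike.inner_apply]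
  simp only [BoundedContinuousFunction.coe_sub, Pi.sub_apply,
    BoundedContinuousFunction.const_apply]
  ring

/-- With ρ = e₂/e₁ the common quantity X drops out of l(e₂X - p) - ρ l(e₁X - p) = l(ρ - 1)p. One
index with nonzero P forces first ρ → 1 and then the convergence of l(ρ - 1); this limit κ does not
depend on the index. -/
theorem exists_limit_phase_ratio {ι : Type*} {e₁ e₂ : ℝ → ℂ} (he₁ : ∀ l, ‖e₁ l‖ = 1)
    (he₂ : ∀ l, ‖e₂ l‖ = 1) {X p : ι → ℝ → ℂ} {L₁ L₂ P : ι → ℂ} (i₀ : ι) (hP : P i₀ ≠ 0)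
    (hp : ∀ i, Tendsto (p i) atTop (𝓝 (P i)))
    (h₁ : ∀ i, Tendsto (fun l : ℝ => (l : ℂ) * (e₁ l * X i l - p i l)) atTop (𝓝 (L₁ i)))
    (h₂ : ∀ i, Tendsto (fun l : ℝ => (l : ℂ) * (e₂ l * X i l - p i l)) atTop (𝓝 (L₂ i))) :
    ∃ κ : ℂ, ∀ i, L₂ i - L₁ i = κ * P i := by
  have hne : ∀ l, e₁ l ≠ 0 := fun l => norm_pos_iff.1 (by rw [he₁]; exact one_pos)
  have hρ : ∀ l, ‖e₂ l / e₁ l‖ = 1 := fun l => by rw [norm_div, he₁, he₂, div_one]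
  have hid : ∀ i (l : ℝ), (l : ℂ) * (e₂ l * X i l - p i l)
      - e₂ l / e₁ l * ((l : ℂ) * (e₁ l * X i l - p i l)) = (l : ℂ) * (e₂ l / e₁ l - 1) * p i l :=
    fun i l => by
      have := hne l
      field_simp
      ring
  have hb : Tendsto (fun l : ℝ => e₂ l / e₁ l - 1) atTop (𝓝 0) := by
    have h3 : Tendsto (fun l : ℝ => (‖(l : ℂ) * (e₂ l * X i₀ l - p i₀ l)‖
        + ‖(l : ℂ) * (e₁ l * X i₀ l - p i₀ l)‖) * ‖p i₀ l‖⁻¹ * l⁻¹) atTop (𝓝 0) := by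
      simpa using (((h₂ i₀).norm.add (h₁ i₀).norm).mul
        ((hp i₀).norm.inv₀ (norm_ne_zero_iff.2 hP))).mul tendsto_inv_atTop_zero
    refine squeeze_zero_norm' ?_ h3
    filter_upwards [eventually_gt_atTop 0, (hp i₀).eventually_ne hP] with l hl hpl
    have h4 := norm_sub_le ((l : ℂ) * (e₂ l * X i₀ l - p i₀ l))
      (e₂ l / e₁ l * ((l : ℂ) * (e₁ l * X i₀ l - p i₀ l)))
    rw [hid, norm_mul (e₂ l / e₁ l), hρ, one_mul, norm_mul, norm_mul, Complex.norm_real,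
      Real.norm_eq_abs, abs_of_pos hl] at h4
    have h5 : 0 < ‖p i₀ l‖ := norm_pos_iff.2 hpl
    rw [← div_eq_mul_inv, ← div_eq_mul_inv, div_div, le_div_iff₀ (mul_pos h5 hl)]
    linarith
  have hρ1 : Tendsto (fun l : ℝ => e₂ l / e₁ l) atTop (𝓝 1) := by
    simpa using hb.add_const 1
  have hlim : ∀ i, Tendsto (fun l : ℝ => (l : ℂ) * (e₂ l / e₁ l - 1) * p i l) atTop
      (𝓝 (L₂ i - L₁ i)) := fun i => by
    have := (h₂ i).sub (hρ1.mul (h₁ i))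
    rw [one_mul] at this
    exact this.congr (hid i)
  have hκ : Tendsto (fun l : ℝ => (l : ℂ) * (e₂ l / e₁ l - 1)) atTop
      (𝓝 ((L₂ i₀ - L₁ i₀) / P i₀)) := by
    refine ((hlim i₀).div (hp i₀) hP).congr' ?_
    filter_upwards [(hp i₀).eventually_ne hP] with l hl
    exact mul_div_cancel_right₀ _ hl
  exact ⟨(L₂ i₀ - L₁ i₀) / P i₀, fun i => tendsto_nhds_unique (hlim i) (hκ.mul (hp i))⟩

theorem exists_schwartz_ne_zero (x₀ : Space n) : ∃ f : 𝓢(Space n, ℂ), f x₀ ≠ 0 := by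
  let b : ContDiffBump x₀ := default
  have h1 : HasCompactSupport fun x => ((b x : ℝ) : ℂ) :=
    b.hasCompactSupport.comp_left Complex.ofReal_zero
  have h2 : ContDiff ℝ ∞ fun x => ((b x : ℝ) : ℂ) :=
    Complex.ofRealCLM.contDiff.comp b.contDiff
  refine ⟨h1.toSchwartzMap h2, ?_⟩
  have h3 : b x₀ = 1 := b.one_of_mem_closedBall (Metric.mem_closedBall_self b.rIn_pos.le)
  change ((b x₀ : ℝ) : ℂ) ≠ 0
  simp [h3]

theorem exists_toL2_ne_zero : ∃ f : 𝓢(Space n, ℂ), toL2 f ≠ 0 := by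
  obtain ⟨f, hf⟩ := exists_schwartz_ne_zero (0 : Space n)
  refine ⟨f, fun h => hf ?_⟩
  have h1 : f = 0 := by
    apply SchwartzMap.injective_toLp 2 (volume : Measure (Space n))
    have h0 := map_zero (toL2 (n := n))
    rw [toL2_apply] at h h0
    exact h.trans h0.symm
  rw [h1]; rfl

theorem eq_zero_of_forall_integral_eq_zero {F : Space n → ℂ} (hF : Continuous F)
    (h : ∀ ψ φ : 𝓢(Space n, ℂ), ∫ x, starRingEnd ℂ (ψ x) * φ x * F x = 0) (x₀ : Space n) :
    F x₀ = 0 := by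
  obtain ⟨φ, hφ⟩ := exists_schwartz_ne_zero x₀
  have hc : Continuous fun x => φ x * F x := φ.continuous.mul hF
  have h1 : (fun x => φ x * F x) =ᵐ[volume] 0 := by
    refine ae_eq_zero_of_integral_contDiff_smul_eq_zero hc.locallyIntegrable fun g hg hgs => ?_
    have h2 : HasCompactSupport fun x => ((g x : ℝ) : ℂ) := hgs.comp_left Complex.ofReal_zero
    have h3 : ContDiff ℝ ∞ fun x => ((g x : ℝ) : ℂ) := Complex.ofRealCLM.contDiff.comp hg
    rw [← h (h2.toSchwartzMap h3) φ]
    refine integral_congr_ae (Eventually.of_forall fun x => ?_)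
    change g x • (φ x * F x) = starRingEnd ℂ ((g x : ℝ) : ℂ) * φ x * F x
    rw [Complex.conj_ofReal, Complex.real_smul, mul_assoc]
  have h4 := congrFun (hc.ae_eq_iff_eq volume continuous_const |>.1 h1) x₀
  exact (mul_eq_zero.1 h4).resolve_left hφ

/-- The integral along a line of the difference of a potential and its translate. -/
def lineOscillation (V : Space n → ℝ) (w x : Space n) : ℝ :=
  ∫ u : ℝ, (V (x + u • w) - V (u • w))

theorem lineOscillation_zero (V : Space n → ℝ) (w : Space n) : lineOscillation V w 0 = 0 := by
  simp [lineOscillation]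

/-- The oscillation bound centred on the line itself. The difference decays with exponent δ + 1 > 1
for positive δ, so line oscillations converge even when V is not integrable along lines; the factor
(1 + ‖x‖)^4 is harmless against Schwartz functions. -/
theorem PotentialBounds.abs_sub_line_le {δ C : ℝ} {V : ℝ → Space n → ℝ}
    (h : PotentialBounds δ C V) (hδ2 : δ ≤ 2) (t : ℝ) (w x : Space n) (u : ℝ) :
    |V t (x + u • w) - V t (u • w)|
      ≤ 2 * C * (1 + ‖w‖ * |u|) ^ (-(δ + 1)) * (1 + ‖x‖) ^ 4 := by
  have h1 := h.oscillation t (x + u • w) (u • w)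
  rw [add_sub_cancel_right, norm_smul, Real.norm_eq_abs, mul_comm |u|] at h1
  have hu : 0 ≤ ‖w‖ * |u| := by positivity
  have h2 : (1 + ‖w‖ * |u|) ^ (-4 : ℝ) ≤ (1 + ‖w‖ * |u|) ^ (-(δ + 1)) :=
    rpow_neg_le_rpow_neg_of_le (by linarith) le_rfl (by linarith) (by norm_num)
  have hp : 0 ≤ (1 + ‖w‖ * |u|) ^ (-(δ + 1)) := by positivity
  have hx := norm_nonneg x
  have h3 : ‖x‖ ≤ (1 + ‖x‖) ^ 4 := by nlinarith [sq_nonneg ‖x‖, pow_nonneg hx 3, pow_nonneg hx 4]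
  have h4 : ‖x‖ ^ 4 ≤ (1 + ‖x‖) ^ 4 := by gcongr; linarith
  have hC := h.nonneg
  calc _ ≤ _ := h1
    _ ≤ C * (1 + ‖w‖ * |u|) ^ (-(δ + 1)) * (1 + ‖x‖) ^ 4
        + C * (1 + ‖w‖ * |u|) ^ (-(δ + 1)) * (1 + ‖x‖) ^ 4 := by gcongr
    _ = _ := by ring

theorem integrable_one_add_norm_mul_abs_rpow {γ : ℝ} (hγ : 1 < γ) {w : Space n} (hw : w ≠ 0) :
    Integrable fun u : ℝ => (1 + ‖w‖ * |u|) ^ (-γ) := by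
  simpa using integrable_one_add_mul_abs_rpow hγ 0 (norm_pos_iff.2 hw)

theorem PotentialBounds.continuous_line {δ C : ℝ} {V : ℝ → Space n → ℝ}
    (h : PotentialBounds δ C V) (t : ℝ) (w : Space n) :
    Continuous fun p : Space n × ℝ => V t (p.1 + p.2 • w) - V t (p.2 • w) := by
  have hV : Continuous (V t) := h.continuous.comp (Continuous.prodMk_right t)
  exact (hV.comp (by fun_prop)).sub (hV.comp (by fun_prop))

theorem PotentialBounds.continuous_lineOscillation {δ C : ℝ} {V : ℝ → Space n → ℝ}
    (h : PotentialBounds δ C V) (hδ : 0 < δ) (hδ2 : δ ≤ 2) (t : ℝ) {w : Space n} (hw : w ≠ 0) :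
    Continuous (lineOscillation (V t) w) := by
  have hV := h.continuous_line t w
  refine continuous_iff_continuousAt.2 fun x₀ => ?_
  refine continuousAt_of_dominated
    (bound := fun u => 2 * C * (1 + ‖w‖ * |u|) ^ (-(δ + 1)) * (1 + (‖x₀‖ + 1)) ^ 4) ?_ ?_ ?_ ?_
  · exact Eventually.of_forall fun x =>
      (hV.comp (Continuous.prodMk_right x)).aestronglyMeasurable
  · filter_upwards [Metric.ball_mem_nhds x₀ one_pos] with x hx
    refine Eventually.of_forall fun u => ?_
    rw [Real.norm_eq_abs]
    refine (h.abs_sub_line_le hδ2 t w x u).trans ?_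
    have h1 : ‖x‖ ≤ ‖x₀‖ + 1 := by
      have := norm_sub_norm_le x x₀
      rw [mem_ball_iff_norm] at hx
      linarith
    have hC := h.nonneg
    gcongr
  · exact ((integrable_one_add_norm_mul_abs_rpow (by linarith) hw).const_mul _).mul_const _
  · exact Eventually.of_forall fun u =>
      (hV.comp (Continuous.prodMk_left u)).continuousAt

theorem integrable_schwartz_mul_weight (ψ φ : 𝓢(Space n, ℂ)) :
    Integrable fun x => ‖ψ x‖ * ‖φ x‖ * (1 + ‖x‖) ^ 4 := by
  have h1 : Integrable fun x => ‖φ x‖ * (1 + ‖x‖) ^ 4 := by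
    refine ((φ.integrable.norm.add (φ.integrable_pow_mul volume 4)).const_mul 8).mono'
      (by have := φ.continuous; fun_prop) (Eventually.of_forall fun x => ?_)
    have hx := norm_nonneg x
    have h2 : (1 + ‖x‖) ^ 4 ≤ 8 * (1 + ‖x‖ ^ 4) := by
      have := add_pow_le zero_le_one hx 4
      norm_num at this
      linarith
    rw [Real.norm_eq_abs, abs_of_nonneg (by positivity)]
    calc ‖φ x‖ * (1 + ‖x‖) ^ 4 ≤ ‖φ x‖ * (8 * (1 + ‖x‖ ^ 4)) := by gcongr
      _ = 8 * (‖φ x‖ + ‖x‖ ^ 4 * ‖φ x‖) := by ring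
  obtain ⟨M, hM⟩ : ∃ M, ∀ x, ‖ψ x‖ ≤ M := ⟨_, fun x => ψ.norm_le_seminorm ℝ x⟩
  have h3 : Integrable fun x => ‖ψ x‖ * (‖φ x‖ * (1 + ‖x‖) ^ 4) :=
    h1.bdd_mul (c := M) (by have := ψ.continuous; fun_prop)
      (Eventually.of_forall fun x => by rw [norm_norm]; exact hM x)
  simpa only [mul_assoc] using h3

theorem PotentialBounds.integrable_amplitude_density {δ C : ℝ} {V : ℝ → Space n → ℝ}
    (h : PotentialBounds δ C V) (hδ : 0 < δ) (hδ2 : δ ≤ 2) (t : ℝ) {w : Space n} (hw : w ≠ 0)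
    (ψ φ : 𝓢(Space n, ℂ)) :
    Integrable (fun p : Space n × ℝ => starRingEnd ℂ (ψ p.1) * φ p.1
      * ((V t (p.1 + p.2 • w) - V t (p.2 • w) : ℝ) : ℂ)) (volume.prod volume) := by
  have h1 : Integrable (fun p : Space n × ℝ => (‖ψ p.1‖ * ‖φ p.1‖ * (1 + ‖p.1‖) ^ 4)
      * (2 * C * (1 + ‖w‖ * |p.2|) ^ (-(δ + 1)))) (volume.prod volume) :=
    (integrable_schwartz_mul_weight ψ φ).mul_prod
      ((integrable_one_add_norm_mul_abs_rpow (by linarith : 1 < δ + 1) hw).const_mul (2 * C))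
  refine h1.mono' ?_ (Eventually.of_forall fun p => ?_)
  · have h2 := ψ.continuous
    have h3 := φ.continuous
    have h4 := Complex.continuous_ofReal.comp (h.continuous_line t w)
    exact (((Complex.continuous_conj.comp (h2.comp continuous_fst)).mul
      (h3.comp continuous_fst)).mul h4).aestronglyMeasurable
  · rw [norm_mul, norm_mul, RCLike.norm_conj, Complex.norm_real, Real.norm_eq_abs]
    refine (mul_le_mul_of_nonneg_left (h.abs_sub_line_le hδ2 t w p.1 p.2)
      (by positivity)).trans (le_of_eq (by ring))

theorem PotentialBounds.integral_amplitude {δ C : ℝ} {V : ℝ → Space n → ℝ}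
    (h : PotentialBounds δ C V) (hδ : 0 < δ) (hδ2 : δ ≤ 2) (hδ0 : 0 ≤ δ) (t : ℝ) {w : Space n}
    (hw : w ≠ 0) (ψ φ : 𝓢(Space n, ℂ)) :
    ∫ u : ℝ, amplitude (h.toBCF hδ0) 0 t (u • w) (toL2 ψ) (toL2 φ)
      = ∫ x, starRingEnd ℂ (ψ x) * φ x * (lineOscillation (V t) w x : ℂ) := by
  simp only [amplitude_zero_toL2, h.toBCF_apply, ← Complex.ofReal_sub]
  rw [← integral_integral_swap (h.integrable_amplitude_density hδ hδ2 t hw ψ φ)]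
  refine integral_congr_ae (Eventually.of_forall fun x => ?_)
  beta_reduce
  rw [integral_const_mul, lineOscillation, integral_complex_ofReal]

theorem PotentialBounds.integrable_mul_lineOscillation {δ C : ℝ} {V : ℝ → Space n → ℝ}
    (h : PotentialBounds δ C V) (hδ : 0 < δ) (hδ2 : δ ≤ 2) (t : ℝ) {w : Space n}
    (hw : w ≠ 0) (ψ φ : 𝓢(Space n, ℂ)) :
    Integrable fun x => starRingEnd ℂ (ψ x) * φ x * (lineOscillation (V t) w x : ℂ) := by
  have h1 := (h.integrable_amplitude_density hδ hδ2 t hw ψ φ).integral_prod_left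
  refine h1.congr (Eventually.of_forall fun x => ?_)
  dsimp only
  rw [integral_const_mul, lineOscillation, integral_complex_ofReal]

theorem integrable_conj_mul (ψ φ : 𝓢(Space n, ℂ)) :
    Integrable fun x => starRingEnd ℂ (ψ x) * φ x := by
  refine (integrable_schwartz_mul_weight ψ φ).mono' ?_ (Eventually.of_forall fun x => ?_)
  · exact ((Complex.continuous_conj.comp ψ.continuous).mul φ.continuous).aestronglyMeasurable
  · rw [norm_mul, RCLike.norm_conj]
    exact le_mul_of_one_le_right (by positivity) (one_le_pow₀ (by linarith [norm_nonneg x]))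

/-- As ψ and φ are arbitrary, the difference of the oscillations times -i equals κ at every point.
At x = 0 both oscillations vanish, so κ = 0. -/
theorem lineOscillation_eq_of_forall {δ C₁ C₂ : ℝ} {V₁ V₂ : ℝ → Space n → ℝ}
    (h₁ : PotentialBounds δ C₁ V₁) (h₂ : PotentialBounds δ C₂ V₂) (hδ : 0 < δ) (hδ2 : δ ≤ 2)
    (hδ0 : 0 ≤ δ) (t : ℝ) {w : Space n} (hw : w ≠ 0) {κ : ℂ}
    (H : ∀ ψ φ : 𝓢(Space n, ℂ),
      -Complex.I * (∫ u : ℝ, amplitude (h₂.toBCF hδ0) 0 t (u • w) (toL2 ψ) (toL2 φ))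
        - -Complex.I * (∫ u : ℝ, amplitude (h₁.toBCF hδ0) 0 t (u • w) (toL2 ψ) (toL2 φ))
        = κ * inner ℂ (toL2 ψ) (toL2 φ)) (x : Space n) :
    lineOscillation (V₁ t) w x = lineOscillation (V₂ t) w x := by
  have hF : Continuous fun x => -Complex.I * (lineOscillation (V₂ t) w x : ℂ)
      - -Complex.I * (lineOscillation (V₁ t) w x : ℂ) - κ := by
    have h3 := Complex.continuous_ofReal.comp (h₁.continuous_lineOscillation hδ hδ2 t hw)
    have h4 := Complex.continuous_ofReal.comp (h₂.continuous_lineOscillation hδ hδ2 t hw)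
    exact ((continuous_const.mul h4).sub (continuous_const.mul h3)).sub continuous_const
  have h0 := eq_zero_of_forall_integral_eq_zero hF fun ψ φ => by
    have i₁ := (h₁.integrable_mul_lineOscillation hδ hδ2 t hw ψ φ).const_mul (-Complex.I)
    have i₂ := (h₂.integrable_mul_lineOscillation hδ hδ2 t hw ψ φ).const_mul (-Complex.I)
    have i₃ := (integrable_conj_mul ψ φ).const_mul κ
    have h5 := H ψ φ
    rw [h₁.integral_amplitude hδ hδ2 hδ0 t hw, h₂.integral_amplitude hδ hδ2 hδ0 t hw,
      inner_toL2, ← integral_const_mul, ← integral_const_mul, ← integral_const_mul,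
      ← sub_eq_zero] at h5
    rw [← h5, ← integral_sub i₂ i₁]
    refine Eq.trans ?_ (integral_sub (i₂.sub i₁) i₃)
    refine integral_congr_ae (Eventually.of_forall fun x => ?_)
    ring
  have hκ : κ = 0 := by
    have := h0 0
    simpa [lineOscillation_zero] using this
  have h6 := h0 x
  rw [hκ, sub_zero, ← mul_sub, mul_eq_zero, sub_eq_zero] at h6
  exact (Complex.ofReal_inj.1 (h6.resolve_left (by simp))).symm

/-- Equality of the scattering pairings determines the oscillations along lines. -/
theorem lineOscillation_eq_of_inner_eq {E : ℝ → Space n} (hE : LocallyIntegrable E volume)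
    {δ C₁ C₂ : ℝ} {V₁ V₂ : ℝ → Space n → ℝ} (h₁ : PotentialBounds δ C₁ V₁)
    (h₂ : PotentialBounds δ C₂ V₂) (hδ : 0 < δ) (hδ2 : δ ≤ 2) (hδ0 : 0 ≤ δ) {s : ℝ}
    {w β : Space n} (hw : w ≠ 0) {γ₁ γ₂ l₁ l₂ : ℝ} (hγ₁ : 1 < γ₁) (hγ₂ : 1 < γ₂)
    (hl₁ : 1 ≤ l₁) (hl₂ : 1 ≤ l₂) (hP₁ : PacketEstimate E s w β (h₁.toBCF hδ0) γ₁ l₁)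
    (hP₂ : PacketEstimate E s w β (h₂.toBCF hδ0) γ₂ l₂) {D₁ D₂ : ℝ → (L2 n ≃ₗᵢ[ℂ] L2 n)}
    (hD₁ : IsInteractionEvolution E (h₁.toBCF hδ0) D₁)
    (hD₂ : IsInteractionEvolution E (h₂.toBCF hδ0) D₂) {Wp₁ Wm₁ Wp₂ Wm₂ : L2 n → L2 n}
    (hWp₁ : ∀ f, Tendsto (fun t => waveFamily E D₁ s t f) atTop (𝓝 (Wp₁ f)))
    (hWm₁ : ∀ f, Tendsto (fun t => waveFamily E D₁ s t f) atBot (𝓝 (Wm₁ f)))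
    (hWp₂ : ∀ f, Tendsto (fun t => waveFamily E D₂ s t f) atTop (𝓝 (Wp₂ f)))
    (hWm₂ : ∀ f, Tendsto (fun t => waveFamily E D₂ s t f) atBot (𝓝 (Wm₂ f)))
    (hS : ∀ f g, inner ℂ (Wp₁ f) (Wm₁ g) = (inner ℂ (Wp₂ f) (Wm₂ g) : ℂ)) (x : Space n) :
    lineOscillation (V₁ s) w x = lineOscillation (V₂ s) w x := by
  obtain ⟨f₀, hf₀⟩ := exists_toL2_ne_zero (n := n)
  have hexp : ∀ r : ℝ, ‖Complex.exp (Complex.I * (r : ℂ))‖ = 1 := fun r => by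
    rw [mul_comm, Complex.norm_exp_ofReal_mul_I]
  have T₁ := hP₁.tendsto_scattering_amplitude hE h₁ hδ0 hγ₁ hl₁ hD₁ hw hWp₁ hWm₁
  have T₂ := hP₂.tendsto_scattering_amplitude hE h₂ hδ0 hγ₂ hl₂ hD₂ hw hWp₂ hWm₂
  simp only [hS] at T₁
  obtain ⟨κ, hκ⟩ := exists_limit_phase_ratio (ι := 𝓢(Space n, ℂ) × 𝓢(Space n, ℂ))
    (X := fun i l => inner ℂ (Wp₂ (packet w β l i.1)) (Wm₂ (packet w β l i.2)))
    (p := fun i l => inner ℂ (packet w β l i.1) (packet w β l i.2))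
    (P := fun i => inner ℂ (toL2 i.1) (toL2 i.2)) (fun l => hexp _) (fun l => hexp _)
    (f₀, f₀) (inner_self_ne_zero.2 hf₀)
    (fun i => by
      simp only [inner_packet]
      exact (tendsto_toL2_boost hw i.1).inner (tendsto_toL2_boost hw i.2))
    (fun i => T₁ i.1 i.2) (fun i => T₂ i.1 i.2)
  exact lineOscillation_eq_of_forall h₁ h₂ hδ hδ2 hδ0 s hw (fun ψ φ => hκ (ψ, φ)) x

end LineIntegrals

/-! ### Injectivity of the line transform from a pencil of directions in a plane. -/

section XRay

variable {n : ℕ}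

/-- The kernel whose integrals along pencils of lines are products of Poisson kernels. -/
def pencilKernel (m ζ : ℝ) : ℂ := ((((1 + |m| : ℝ) : ℂ) - ζ * Complex.I) ^ 2)⁻¹

theorem norm_pencilKernel (m ζ : ℝ) : ‖pencilKernel m ζ‖ = ((1 + |m|) ^ 2 + ζ ^ 2)⁻¹ := by
  rw [pencilKernel, norm_inv, norm_pow, Complex.sq_norm, Complex.normSq_apply]
  simp [sq]

theorem sub_mul_I_ne_zero {a : ℝ} (ha : 0 < a) (ζ : ℝ) : (a : ℂ) - ζ * Complex.I ≠ 0 := fun h => by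
  have := congrArg Complex.re h
  simp at this
  linarith

theorem continuous_pencilKernel : Continuous fun p : ℝ × ℝ => pencilKernel p.1 p.2 := by
  unfold pencilKernel
  refine Continuous.inv₀ (by fun_prop) fun p => pow_ne_zero 2 (sub_mul_I_ne_zero ?_ _)
  positivity

theorem norm_pencilKernel_le_sq (m ζ : ℝ) : ‖pencilKernel m ζ‖ ≤ (1 + |m|) ^ (-2 : ℝ) := by
  have h : (0 : ℝ) < 1 + |m| := by positivity
  rw [norm_pencilKernel, Real.rpow_neg h.le, Real.rpow_two]
  refine inv_anti₀ (by positivity) ?_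
  nlinarith [sq_nonneg ζ]

/-- Majorant for Fubini. The factor (1 + |m|)⁻¹ will come from integrating along lines of slope m,
and a^{1/2} b^{3/2} ≤ a² + b² then splits the decay into two integrable powers, one in each
variable. -/
theorem norm_pencilKernel_mul_le (m ζ : ℝ) : ‖pencilKernel m ζ‖ * (1 + |m|)⁻¹
    ≤ 3 * ((1 + |m|) ^ (-(3 / 2) : ℝ) * (1 + |ζ|) ^ (-(3 / 2) : ℝ)) := by
  set a := 1 + |m| with ha
  set b := 1 + |ζ| with hb
  have ha1 : 1 ≤ a := by simp [ha]
  have hb1 : 1 ≤ b := by simp [hb]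
  have ha0 : 0 < a := by linarith
  have hb0 : 0 < b := by linarith
  have h1 : a ^ (1 / 2 : ℝ) * b ^ (3 / 2 : ℝ) ≤ a ^ 2 + b ^ 2 := by
    have hM : 0 < max a b := lt_max_of_lt_left ha0
    calc a ^ (1 / 2 : ℝ) * b ^ (3 / 2 : ℝ) ≤ (max a b) ^ (1 / 2 : ℝ) * (max a b) ^ (3 / 2 : ℝ) := by
          gcongr
          · exact le_max_left _ _
          · exact le_max_right _ _
      _ = (max a b) ^ 2 := by
          rw [← Real.rpow_add hM, ← Real.rpow_two]; norm_num
      _ ≤ a ^ 2 + b ^ 2 := by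
          rcases max_choice a b with h | h <;> rw [h] <;> nlinarith [sq_nonneg a, sq_nonneg b]
  have h2 : a ^ 2 + b ^ 2 ≤ 3 * (a ^ 2 + ζ ^ 2) := by
    have : b ^ 2 ≤ 2 + 2 * ζ ^ 2 := by
      rw [hb, ← sq_abs ζ]
      nlinarith [sq_nonneg (1 - |ζ|)]
    nlinarith
  have h3 : a ^ (3 / 2 : ℝ) = a ^ (1 / 2 : ℝ) * a := by
    rw [← Real.rpow_add_one ha0.ne']; norm_num
  rw [norm_pencilKernel, ← ha, Real.rpow_neg ha0.le, Real.rpow_neg hb0.le, ← mul_inv, ← mul_inv,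
    h3, ← div_eq_mul_inv, inv_eq_one_div, div_le_div_iff₀ (by positivity) (by positivity)]
  nlinarith

theorem norm_add_mul_ge {A B : ℂ} (hA : A.re = 1) (hB : B.re = 1) (m : ℝ) :
    1 + m ≤ ‖A + m * B‖ := by
  have := Complex.re_le_norm (A + m * B)
  simpa [hA, hB] using this

/-- An antiderivative is -1/(B(A + mB)). The positive real parts keep the denominator away from zero
and send it to infinity. -/
theorem integral_Ioi_inv_sq {A B : ℂ} (hA : A.re = 1) (hB : B.re = 1) :
    ∫ m in Set.Ioi (0 : ℝ), ((A + m * B) ^ 2)⁻¹ = (A * B)⁻¹ := by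
  have hB0 : B ≠ 0 := fun h => by simp [h] at hB
  have hne : ∀ m : ℝ, 0 ≤ m → A + m * B ≠ 0 := fun m hm => norm_pos_iff.1
    (lt_of_lt_of_le (by linarith) (norm_add_mul_ge hA hB m))
  have hd : ∀ m ∈ Set.Ici (0 : ℝ),
      HasDerivAt (fun m : ℝ => -(B * (A + m * B))⁻¹) ((A + m * B) ^ 2)⁻¹ m := fun m hm => by
    have h1 : HasDerivAt (fun m : ℝ => B * (A + m * B)) (B * B) m := by
      have := (((hasDerivAt_id m).ofReal_comp.mul_const B).const_add A).const_mul B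
      simpa using this
    have h2 := (h1.inv (mul_ne_zero hB0 (hne m hm))).neg
    refine h2.congr_deriv ?_
    have := hne m hm
    field_simp
  have hint : IntegrableOn (fun m : ℝ => ((A + m * B) ^ 2)⁻¹) (Set.Ioi 0) := by
    have h1 : IntegrableOn (fun m : ℝ => (1 + |m|) ^ (-2 : ℝ)) (Set.Ioi 0) :=
      (integrable_one_add_abs_rpow (by norm_num)).integrableOn
    refine h1.mono' ?_ ?_
    · refine ContinuousOn.aestronglyMeasurable (fun m hm => ?_) measurableSet_Ioi
      refine (ContinuousAt.inv₀ (by fun_prop) ?_).continuousWithinAt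
      exact pow_ne_zero 2 (hne m (le_of_lt hm))
    · refine (ae_restrict_iff' measurableSet_Ioi).2 (Eventually.of_forall fun m hm => ?_)
      have hm0 : 0 < m := hm
      have := norm_add_mul_ge hA hB m
      rw [norm_inv, norm_pow, abs_of_pos hm0, Real.rpow_neg (by linarith), Real.rpow_two]
      gcongr
  have hlim : Tendsto (fun m : ℝ => -(B * (A + m * B))⁻¹) atTop (𝓝 0) := by
    rw [← neg_zero]
    refine Tendsto.neg (tendsto_inv₀_cobounded.comp (tendsto_norm_atTop_iff_cobounded.1 ?_))
    simp only [norm_mul]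
    refine Tendsto.const_mul_atTop (norm_pos_iff.2 hB0) ?_
    exact tendsto_atTop_mono (fun m => norm_add_mul_ge hA hB m)
      (tendsto_atTop_add_const_left _ _ tendsto_id)
  rw [integral_Ioi_of_hasDerivAt_of_tendsto' hd hint hlim]
  simp [mul_comm]

theorem integrable_pencilKernel_line (y z : ℝ) :
    Integrable fun m : ℝ => pencilKernel m (z - m * y) := by
  refine (integrable_one_add_abs_rpow (γ := 2) (by norm_num)).mono' ?_
    (Eventually.of_forall fun m => norm_pencilKernel_le_sq _ _)
  exact (continuous_pencilKernel.comp (by fun_prop :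
    Continuous fun m : ℝ => (m, z - m * y))).aestronglyMeasurable

/-- For m > 0 the base 1 + |m| - i(z - my) is (1 - iz) + m(1 + iy), and for m < 0 the second factor
becomes 1 - iy; each half line is a case of `integral_Ioi_inv_sq`. -/
theorem integral_pencilKernel (y z : ℝ) : ∫ m : ℝ, pencilKernel m (z - m * y)
    = ((1 - z * Complex.I) * (1 + y * Complex.I))⁻¹
      + ((1 - z * Complex.I) * (1 - y * Complex.I))⁻¹ := by
  have h := integrable_pencilKernel_line y z
  rw [← integral_add_compl (measurableSet_Ioi (a := (0 : ℝ))) h]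
  congr 1
  · rw [← integral_Ioi_inv_sq (by simp) (by simp)]
    refine setIntegral_congr_fun measurableSet_Ioi fun m hm => ?_
    have hm0 : 0 < m := hm
    simp only [pencilKernel, abs_of_pos hm0]
    congr 2
    push_cast
    ring
  · rw [Set.compl_Ioi, ← neg_zero, ← integral_comp_neg_Ioi,
      ← integral_Ioi_inv_sq (by simp) (by simp)]
    refine setIntegral_congr_fun measurableSet_Ioi fun m hm => ?_
    have hm0 : 0 < m := hm
    simp only [pencilKernel, abs_neg, abs_of_pos hm0]
    congr 2
    push_cast
    ring

/-- The two half-line contributions add up to 2(1 + iz)/((1 + y²)(1 + z²)), whose real part is a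
product of Poisson kernels. -/
theorem integral_re_pencilKernel (y z : ℝ) : ∫ m : ℝ, (pencilKernel m (z - m * y)).re
    = 2 * ((1 + y ^ 2)⁻¹ * (1 + z ^ 2)⁻¹) := by
  have h : ∫ m : ℝ, (pencilKernel m (z - m * y)).re
      = (∫ m : ℝ, pencilKernel m (z - m * y)).re :=
    integral_re (𝕜 := ℂ) (integrable_pencilKernel_line y z)
  rw [h, integral_pencilKernel]
  have h1 := sub_mul_I_ne_zero one_pos z
  have h2 := sub_mul_I_ne_zero one_pos y
  have h3 := sub_mul_I_ne_zero one_pos (-y)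
  push_cast at h1 h2 h3
  rw [neg_mul, sub_neg_eq_add] at h3
  have h4 : ((1 - z * Complex.I) * (1 + y * Complex.I))⁻¹
      + ((1 - z * Complex.I) * (1 - y * Complex.I))⁻¹
      = (((2 * ((1 + y ^ 2)⁻¹ * (1 + z ^ 2)⁻¹) : ℝ) : ℂ)) * (1 + z * Complex.I) := by
    have h5 : (1 + (y : ℂ) ^ 2) = (1 + y * Complex.I) * (1 - y * Complex.I) := by
      linear_combination (y : ℂ) ^ 2 * Complex.I_sq
    have h6 : (1 + (z : ℂ) ^ 2) = (1 + z * Complex.I) * (1 - z * Complex.I) := by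
      linear_combination (z : ℂ) ^ 2 * Complex.I_sq
    have h7 := sub_mul_I_ne_zero one_pos (-z)
    push_cast at h7
    rw [neg_mul, sub_neg_eq_add] at h7
    have h8 : (1 + (y : ℂ) * Complex.I) + (1 - y * Complex.I) = 2 := by ring
    push_cast
    rw [h5, h6, ← h8]
    generalize (1 + (y : ℂ) * Complex.I) = P at h3 ⊢
    generalize (1 - (y : ℂ) * Complex.I) = Q at h2 ⊢
    generalize (1 + (z : ℂ) * Complex.I) = R at h7 ⊢
    generalize (1 - (z : ℂ) * Complex.I) = S at h1 ⊢
    field_simp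
    ring
  rw [h4, Complex.re_ofReal_mul]
  simp

/-- Flat lines use the decay in y. Steep lines use the decay in the second coordinate, and the
change of variable y ↦ z + my yields 1/|m|. -/
theorem integral_one_add_abs_affine_le {γ : ℝ} {g : ℝ × ℝ → ℝ} {K : ℝ} (hγ : 1 < γ) (hK : 0 ≤ K)
    (hg : Continuous g) (h1 : ∀ y z, |g (y, z)| ≤ K * (1 + |y|) ^ (-γ))
    (h2 : ∀ y z, |g (y, z)| ≤ K * (1 + |z|) ^ (-γ)) (m z : ℝ) :
    ∫ y, |g (y, z + m * y)| ≤ 2 * (K * ∫ u : ℝ, (1 + |u|) ^ (-γ)) * (1 + |m|)⁻¹ := by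
  have hc : Continuous fun y => g (y, z + m * y) := hg.comp (by fun_prop)
  have hI : 0 ≤ ∫ u : ℝ, (1 + |u|) ^ (-γ) := integral_nonneg fun u => by positivity
  have hint : Integrable fun y => |g (y, z + m * y)| :=
    ((integrable_one_add_abs_rpow hγ).const_mul K).mono' hc.abs.aestronglyMeasurable
      (Eventually.of_forall fun y => by rw [Real.norm_eq_abs, abs_abs]; exact h1 _ _)
  rcases le_or_gt |m| 1 with hm | hm
  · have h3 := integral_mono hint ((integrable_one_add_abs_rpow hγ).const_mul K) fun y => h1 y _
    rw [integral_const_mul] at h3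
    refine h3.trans ?_
    rw [← div_eq_mul_inv, le_div_iff₀ (by positivity)]
    nlinarith [mul_nonneg hK hI]
  · have hm0 : m ≠ 0 := fun h => by simp [h] at hm; linarith
    have hi : Integrable fun y => K * (1 + |z + m * y|) ^ (-γ) :=
      (((integrable_one_add_abs_rpow hγ).comp_add_left z).comp_mul_left' hm0).const_mul K
    have h3 := integral_mono hint hi fun y => h2 y _
    have h4 := Measure.integral_comp_mul_left (fun t : ℝ => (1 + |z + t|) ^ (-γ)) m
    rw [integral_add_left_eq_self (fun t : ℝ => (1 + |t|) ^ (-γ)) z] at h4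
    rw [integral_const_mul, h4, smul_eq_mul, abs_inv] at h3
    refine h3.trans ?_
    have h5 : |m|⁻¹ ≤ 2 * (1 + |m|)⁻¹ := by
      rw [← div_eq_mul_inv, inv_eq_one_div, div_le_div_iff₀ (by linarith) (by linarith)]
      linarith
    calc K * (|m|⁻¹ * ∫ u : ℝ, (1 + |u|) ^ (-γ))
        = |m|⁻¹ * (K * ∫ u : ℝ, (1 + |u|) ^ (-γ)) := by ring
      _ ≤ 2 * (1 + |m|)⁻¹ * (K * ∫ u : ℝ, (1 + |u|) ^ (-γ)) := by gcongr
      _ = _ := by ring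

theorem integrable_pencilKernel_mul {γ : ℝ} {g : ℝ × ℝ → ℝ} {K : ℝ} (hγ : 1 < γ) (hK : 0 ≤ K)
    (hg : Continuous g) (h1 : ∀ y z, |g (y, z)| ≤ K * (1 + |y|) ^ (-γ))
    (h2 : ∀ y z, |g (y, z)| ≤ K * (1 + |z|) ^ (-γ)) :
    Integrable (fun p : (ℝ × ℝ) × ℝ => (pencilKernel p.1.1 p.1.2).re
      * g (p.2, p.1.2 + p.1.1 * p.2)) ((volume.prod volume).prod volume) := by
  have hk : Continuous fun q : ℝ × ℝ => (pencilKernel q.1 q.2).re :=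
    Complex.continuous_re.comp continuous_pencilKernel
  have hgc : ∀ q : ℝ × ℝ, Continuous fun y => g (y, q.2 + q.1 * y) := fun q =>
    hg.comp (by fun_prop)
  have hcont : Continuous fun p : (ℝ × ℝ) × ℝ => (pencilKernel p.1.1 p.1.2).re
      * g (p.2, p.1.2 + p.1.1 * p.2) :=
    (hk.comp continuous_fst).mul (hg.comp (by fun_prop))
  refine (integrable_prod_iff hcont.aestronglyMeasurable).2 ⟨Eventually.of_forall fun q => ?_, ?_⟩
  · have h3 : Integrable fun y => g (y, q.2 + q.1 * y) :=
      ((integrable_one_add_abs_rpow hγ).const_mul K).mono' (hgc q).aestronglyMeasurable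
        (Eventually.of_forall fun y => h1 _ _)
    exact h3.const_mul (pencilKernel q.1 q.2).re
  · have h3 : Integrable (fun q : ℝ × ℝ => 6 * (K * ∫ u : ℝ, (1 + |u|) ^ (-γ))
        * ((1 + |q.1|) ^ (-(3 / 2) : ℝ) * (1 + |q.2|) ^ (-(3 / 2) : ℝ))) (volume.prod volume) :=
      ((integrable_one_add_abs_rpow (by norm_num)).mul_prod
        (integrable_one_add_abs_rpow (by norm_num))).const_mul _
    refine h3.mono' (hcont.norm.aestronglyMeasurable.integral_prod_right')
      (Eventually.of_forall fun q => ?_)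
    have hI : 0 ≤ ∫ u : ℝ, (1 + |u|) ^ (-γ) := integral_nonneg fun u => by positivity
    rw [Real.norm_eq_abs, abs_of_nonneg (integral_nonneg fun _ => norm_nonneg _)]
    simp only [norm_mul, integral_const_mul, Real.norm_eq_abs]
    calc |(pencilKernel q.1 q.2).re| * ∫ y, |g (y, q.2 + q.1 * y)|
        ≤ ‖pencilKernel q.1 q.2‖ * (2 * (K * ∫ u : ℝ, (1 + |u|) ^ (-γ)) * (1 + |q.1|)⁻¹) :=
          mul_le_mul (Complex.abs_re_le_norm _)
            (integral_one_add_abs_affine_le hγ hK hg h1 h2 _ _)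
            (integral_nonneg fun _ => abs_nonneg _) (norm_nonneg _)
      _ = 2 * (K * ∫ u : ℝ, (1 + |u|) ^ (-γ)) * (‖pencilKernel q.1 q.2‖ * (1 + |q.1|)⁻¹) := by ring
      _ ≤ 2 * (K * ∫ u : ℝ, (1 + |u|) ^ (-γ))
          * (3 * ((1 + |q.1|) ^ (-(3 / 2) : ℝ) * (1 + |q.2|) ^ (-(3 / 2) : ℝ))) := by
          exact mul_le_mul_of_nonneg_left (norm_pencilKernel_mul_le _ _) (by positivity)
      _ = _ := by ring

/-- If the integrals of a function along almost all lines of the plane vanish, so do its Poisson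
integrals. -/
theorem integral_poisson_eq_zero {γ : ℝ} {g : ℝ × ℝ → ℝ} {K : ℝ} (hγ : 1 < γ) (hK : 0 ≤ K)
    (hg : Continuous g) (h1 : ∀ y z, |g (y, z)| ≤ K * (1 + |y|) ^ (-γ))
    (h2 : ∀ y z, |g (y, z)| ≤ K * (1 + |z|) ^ (-γ))
    (h0 : ∀ᵐ m : ℝ, ∀ z : ℝ, ∫ y, g (y, z + m * y) = 0) :
    ∫ y, ∫ z, (1 + y ^ 2)⁻¹ * (1 + z ^ 2)⁻¹ * g (y, z) = 0 := by
  have hT := integrable_pencilKernel_mul hγ hK hg h1 h2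
  have hk : Continuous fun q : ℝ × ℝ => (pencilKernel q.1 q.2).re :=
    Complex.continuous_re.comp continuous_pencilKernel
  have hz : ∫ q : ℝ × ℝ, ∫ y, (pencilKernel q.1 q.2).re * g (y, q.2 + q.1 * y)
      ∂volume ∂(volume.prod volume) = 0 := by
    have h3 : ∀ᵐ q : ℝ × ℝ ∂(volume.prod volume), ∀ z : ℝ, ∫ y, g (y, z + q.1 * y) = 0 :=
      Measure.quasiMeasurePreserving_fst.ae h0
    rw [← integral_zero (ℝ × ℝ) ℝ (μ := volume.prod volume)]
    refine integral_congr_ae ?_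
    filter_upwards [h3] with q hq
    rw [integral_const_mul, hq, mul_zero]
  -- After the exchange y is fixed: shifting z by my and integrating over the slopes m first leaves
  -- only the product Poisson kernel.
  rw [integral_integral_swap hT] at hz
  have hy : ∀ᵐ y : ℝ, ∫ q : ℝ × ℝ, (pencilKernel q.1 q.2).re * g (y, q.2 + q.1 * y)
      ∂(volume.prod volume) = 2 * ∫ z, (1 + y ^ 2)⁻¹ * (1 + z ^ 2)⁻¹ * g (y, z) := by
    filter_upwards [hT.prod_left_ae] with y hi
    rw [integral_prod _ hi]
    have h4 : ∀ m : ℝ, ∫ z, (pencilKernel m z).re * g (y, z + m * y)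
        = ∫ z, (pencilKernel m (z - m * y)).re * g (y, z) := fun m => by
      have := integral_sub_right_eq_self (μ := (volume : Measure ℝ))
        (fun z => (pencilKernel m z).re * g (y, z + m * y)) (m * y)
      simpa only [sub_add_cancel] using this.symm
    simp only [h4]
    have h5 : Integrable (fun q : ℝ × ℝ => (pencilKernel q.1 (q.2 - q.1 * y)).re * g (y, q.2))
        (volume.prod volume) := by
      have h6 := (integrable_one_add_abs_rpow (γ := 2) (by norm_num)).mul_prod
        ((integrable_one_add_abs_rpow hγ).const_mul K)
      refine h6.mono' ?_ (Eventually.of_forall fun q => ?_)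
      · exact ((hk.comp (by fun_prop : Continuous fun q : ℝ × ℝ => (q.1, q.2 - q.1 * y))).mul
          (hg.comp (by fun_prop))).aestronglyMeasurable
      · rw [norm_mul]
        exact mul_le_mul ((Complex.abs_re_le_norm _).trans (norm_pencilKernel_le_sq _ _))
          (h2 _ _) (norm_nonneg _) (by positivity)
    rw [integral_integral_swap h5, ← integral_const_mul]
    refine integral_congr_ae (Eventually.of_forall fun z => ?_)
    beta_reduce
    rw [integral_mul_const, integral_re_pencilKernel]
    ring
  rw [integral_congr_ae hy, integral_const_mul] at hz
  linarith

/-- Dilations preserve slopes and hence the hypotheses. Applying the Poisson identity to g(ε ·) and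
letting ε → 0 by dominated convergence gives π² g(0, 0) = 0. -/
theorem apply_zero_eq_zero_of_integral_lines {γ : ℝ} {g : ℝ × ℝ → ℝ} {K : ℝ} (hγ : 1 < γ)
    (hK : 0 ≤ K) (hg : Continuous g) (h1 : ∀ y z, |g (y, z)| ≤ K * (1 + |y|) ^ (-γ))
    (h2 : ∀ y z, |g (y, z)| ≤ K * (1 + |z|) ^ (-γ))
    (h0 : ∀ᵐ m : ℝ, ∀ z : ℝ, ∫ y, g (y, z + m * y) = 0) : g (0, 0) = 0 := by
  have hscale : ∀ ε : ℝ, 0 < ε → ε ≤ 1 → ∀ r : ℝ,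
      K * (1 + |ε * r|) ^ (-γ) ≤ K * ε ^ (-γ) * (1 + |r|) ^ (-γ) := fun ε hε hε1 r => by
    rw [mul_assoc, ← Real.mul_rpow hε.le (by positivity)]
    refine mul_le_mul_of_nonneg_left (Real.rpow_le_rpow_of_nonpos (by positivity) ?_ (by linarith)) hK
    rw [abs_mul, abs_of_pos hε]
    linarith
  have hP : Integrable (fun p : ℝ × ℝ => (1 + p.1 ^ 2)⁻¹ * (1 + p.2 ^ 2)⁻¹)
      (volume.prod volume) := integrable_inv_one_add_sq.mul_prod integrable_inv_one_add_sq
  have hb : ∀ p, |g p| ≤ K := fun p => by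
    refine (h1 p.1 p.2).trans (mul_le_of_le_one_right hK ?_)
    exact Real.rpow_le_one_of_one_le_of_nonpos (by simp) (by linarith)
  have hcP : Continuous fun p : ℝ × ℝ => (1 + p.1 ^ 2)⁻¹ * (1 + p.2 ^ 2)⁻¹ :=
    ((continuous_const.add (continuous_fst.pow 2)).inv₀ fun p =>
      (by positivity : (1 + p.1 ^ 2 : ℝ) ≠ 0)).mul
        ((continuous_const.add (continuous_snd.pow 2)).inv₀ fun p =>
          (by positivity : (1 + p.2 ^ 2 : ℝ) ≠ 0))
  have hcε : ∀ ε : ℝ, Continuous fun p : ℝ × ℝ => g (ε * p.1, ε * p.2) := fun ε =>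
    hg.comp (by fun_prop)
  have hdom : ∀ (ε : ℝ) (p : ℝ × ℝ), ‖(1 + p.1 ^ 2)⁻¹ * (1 + p.2 ^ 2)⁻¹ * g (ε * p.1, ε * p.2)‖
      ≤ (1 + p.1 ^ 2)⁻¹ * (1 + p.2 ^ 2)⁻¹ * K := fun ε p => by
    rw [norm_mul, Real.norm_of_nonneg (by positivity)]
    exact mul_le_mul_of_nonneg_left (hb _) (by positivity)
  have hzero : ∀ ε : ℝ, 0 < ε → ε ≤ 1 → ∫ p : ℝ × ℝ, (1 + p.1 ^ 2)⁻¹ * (1 + p.2 ^ 2)⁻¹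
      * g (ε * p.1, ε * p.2) ∂(volume.prod volume) = 0 := fun ε hε hε1 => by
    have hi : Integrable (fun p : ℝ × ℝ => (1 + p.1 ^ 2)⁻¹ * (1 + p.2 ^ 2)⁻¹
        * g (ε * p.1, ε * p.2)) (volume.prod volume) :=
      (hP.mul_const K).mono' (hcP.mul (hcε ε)).aestronglyMeasurable
        (Eventually.of_forall (hdom ε))
    rw [integral_prod _ hi]
    refine integral_poisson_eq_zero (g := fun p => g (ε * p.1, ε * p.2)) hγ
      (K := K * ε ^ (-γ)) (by positivity) (hcε ε)
      (fun y z => (h1 _ _).trans (hscale ε hε hε1 y))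
      (fun y z => (h2 _ _).trans (hscale ε hε hε1 z)) ?_
    filter_upwards [h0] with m hm z
    have h3 := Measure.integral_comp_mul_left (fun y => g (y, ε * z + m * y)) ε
    rw [hm, smul_zero] at h3
    rw [← h3]
    refine integral_congr_ae (Eventually.of_forall fun y => ?_)
    beta_reduce
    congr 2
    ring
  have hlim : Tendsto (fun ε : ℝ => ∫ p : ℝ × ℝ, (1 + p.1 ^ 2)⁻¹ * (1 + p.2 ^ 2)⁻¹
      * g (ε * p.1, ε * p.2) ∂(volume.prod volume)) (𝓝[>] 0)
      (𝓝 (∫ p : ℝ × ℝ, (1 + p.1 ^ 2)⁻¹ * (1 + p.2 ^ 2)⁻¹ * g (0, 0) ∂(volume.prod volume))) := by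
    refine tendsto_integral_filter_of_dominated_convergence _
      (Eventually.of_forall fun ε => (hcP.mul (hcε ε)).aestronglyMeasurable)
      (Eventually.of_forall fun ε => Eventually.of_forall (hdom ε)) (hP.mul_const K)
      (Eventually.of_forall fun p => ?_)
    have h4 : Continuous fun ε : ℝ => (1 + p.1 ^ 2)⁻¹ * (1 + p.2 ^ 2)⁻¹ * g (ε * p.1, ε * p.2) :=
      continuous_const.mul (hg.comp (by fun_prop))
    have h5 := h4.tendsto 0
    simp only [zero_mul] at h5
    exact h5.mono_left nhdsWithin_le_nhds
  have h6 : Tendsto (fun ε : ℝ => ∫ p : ℝ × ℝ, (1 + p.1 ^ 2)⁻¹ * (1 + p.2 ^ 2)⁻¹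
      * g (ε * p.1, ε * p.2) ∂(volume.prod volume)) (𝓝[>] 0) (𝓝 0) := by
    refine tendsto_const_nhds.congr' ?_
    filter_upwards [Ioc_mem_nhdsGT one_pos] with ε hε
    exact (hzero ε hε.1 hε.2).symm
  have h7 := tendsto_nhds_unique hlim h6
  rw [integral_mul_const, integral_prod_mul (fun y : ℝ => (1 + y ^ 2)⁻¹)
    (fun z : ℝ => (1 + z ^ 2)⁻¹), integral_univ_inv_one_add_sq] at h7
  exact (mul_eq_zero.1 h7).resolve_left (by positivity)

/-- Restriction to the plane through x₀ spanned by a and b reduces to the origin of ℝ².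
Orthonormality bounds both coordinates by the norm, and moving the base point to x₀ costs a factor
(1 + ‖x₀‖)^γ. -/
theorem eq_zero_of_integral_lines {γ K : ℝ} (hγ : 1 < γ) (hK : 0 ≤ K) {f : Space n → ℝ}
    (hf : Continuous f) (hb : ∀ x, |f x| ≤ K * (1 + ‖x‖) ^ (-γ)) {a b : Space n}
    (ha : ‖a‖ = 1) (hb1 : ‖b‖ = 1) (hab : inner ℝ a b = (0 : ℝ))
    (h0 : ∀ᵐ m : ℝ, ∀ x, ∫ u : ℝ, f (x + u • (a + m • b)) = 0) (x₀ : Space n) : f x₀ = 0 := by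
  have hy : ∀ y z : ℝ, |y| ≤ ‖y • a + z • b‖ := fun y z => by
    have := abs_real_inner_le_norm a (y • a + z • b)
    rwa [inner_add_right, inner_smul_right, inner_smul_right, hab, real_inner_self_eq_norm_sq, ha,
      one_pow, mul_one, mul_zero, add_zero, one_mul] at this
  have hz : ∀ y z : ℝ, |z| ≤ ‖y • a + z • b‖ := fun y z => by
    have := abs_real_inner_le_norm b (y • a + z • b)
    rwa [inner_add_right, inner_smul_right, inner_smul_right, real_inner_comm, hab,
      real_inner_self_eq_norm_sq, hb1, one_pow, mul_one, mul_zero, zero_add, one_mul] at this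
  have hw : ∀ (v : Space n) (r : ℝ), |r| ≤ ‖v‖ →
      |f (x₀ + v)| ≤ K * (1 + ‖x₀‖) ^ γ * (1 + |r|) ^ (-γ) := fun v r hr => by
    refine (hb _).trans ?_
    rw [mul_assoc]
    refine mul_le_mul_of_nonneg_left ?_ hK
    have h1 : 1 + |r| ≤ (1 + ‖x₀‖) * (1 + ‖x₀ + v‖) := by
      have := norm_sub_le (x₀ + v) x₀
      rw [add_sub_cancel_left] at this
      nlinarith [norm_nonneg x₀, norm_nonneg (x₀ + v)]
    rw [Real.rpow_neg (by positivity), Real.rpow_neg (by positivity), ← div_eq_mul_inv,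
      inv_eq_one_div, div_le_div_iff₀ (by positivity) (by positivity), one_mul,
      ← Real.mul_rpow (by positivity) (by positivity)]
    exact Real.rpow_le_rpow (by positivity) h1 (by linarith)
  have h3 := apply_zero_eq_zero_of_integral_lines (g := fun p => f (x₀ + (p.1 • a + p.2 • b))) hγ
    (K := K * (1 + ‖x₀‖) ^ γ) (by positivity) (hf.comp (by fun_prop))
    (fun y z => hw _ _ (hy y z)) (fun y z => hw _ _ (hz y z)) (by
      filter_upwards [h0] with m hm z
      rw [← hm (x₀ + z • b)]
      refine integral_congr_ae (Eventually.of_forall fun y => ?_)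
      beta_reduce
      congr 1
      module)
  simpa using h3

/-- V₂ - V₁ need not be integrable along lines, so the line transform is inverted for its
differences under translation. These vanish, hence V₂ - V₁ is constant, and its limit along a is
zero. -/
theorem PotentialBounds.eq_of_lineOscillation_eq {δ C₁ C₂ : ℝ} {V₁ V₂ : ℝ → Space n → ℝ}
    (h₁ : PotentialBounds δ C₁ V₁) (h₂ : PotentialBounds δ C₂ V₂) (hδ : 0 < δ) (hδ2 : δ ≤ 2)
    (t : ℝ) {a b : Space n} (ha : ‖a‖ = 1) (hb : ‖b‖ = 1) (hab : inner ℝ a b = (0 : ℝ))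
    (H : ∀ᵐ m : ℝ, ∀ x,
      lineOscillation (V₁ t) (a + m • b) x = lineOscillation (V₂ t) (a + m • b) x) :
    V₁ t = V₂ t := by
  have hc₁ : Continuous (V₁ t) := h₁.continuous.comp (Continuous.prodMk_right t)
  have hc₂ : Continuous (V₂ t) := h₂.continuous.comp (Continuous.prodMk_right t)
  have hw : ∀ m : ℝ, a + m • b ≠ 0 := fun m h => by
    have := congrArg (inner ℝ a) h
    rw [inner_add_right, inner_smul_right, hab, real_inner_self_eq_norm_sq, ha] at this
    simp at this
  have hint : ∀ {C : ℝ} {V : ℝ → Space n → ℝ}, PotentialBounds δ C V → ∀ {w : Space n}, w ≠ 0 →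
      ∀ x, Integrable fun u : ℝ => V t (x + u • w) - V t (u • w) := fun {C V} h {w} hw x => by
    refine (((integrable_one_add_norm_mul_abs_rpow (by linarith : 1 < δ + 1) hw).const_mul
      (2 * C)).mul_const ((1 + ‖x‖) ^ 4)).mono'
      ((h.continuous_line t w).comp (Continuous.prodMk_right x)).aestronglyMeasurable
      (Eventually.of_forall fun u => h.abs_sub_line_le hδ2 t w x u)
  -- The translate by d has decay exponent δ + 1 > 1. Its line integral is the oscillation at x + d
  -- minus the oscillation at x, for V₂ - V₁, because the reference values on the line u w cancel.
  have hconst : ∀ d x, (V₂ t (x + d) - V₁ t (x + d)) - (V₂ t x - V₁ t x) = 0 := fun d => by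
    have hosc : ∀ {C : ℝ} {V : ℝ → Space n → ℝ}, PotentialBounds δ C V → ∀ x,
        |V t (x + d) - V t x| ≤ 2 * C * (1 + ‖d‖) ^ 4 * (1 + ‖x‖) ^ (-(δ + 1)) :=
      fun {C V} h x => by
        have := h.abs_sub_line_le hδ2 t x d 1
        rw [one_smul, abs_one, mul_one, add_comm d] at this
        linarith
    have hC₁ := h₁.nonneg
    have hC₂ := h₂.nonneg
    refine eq_zero_of_integral_lines (γ := δ + 1) (K := 2 * (C₁ + C₂) * (1 + ‖d‖) ^ 4)
      (by linarith) (by positivity) (by fun_prop) (fun x => ?_) ha hb hab ?_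
    · have := abs_sub (V₂ t (x + d) - V₂ t x) (V₁ t (x + d) - V₁ t x)
      have e : (V₂ t (x + d) - V₁ t (x + d)) - (V₂ t x - V₁ t x)
        = (V₂ t (x + d) - V₂ t x) - (V₁ t (x + d) - V₁ t x) := by ring
      rw [e]
      linarith [hosc h₁ x, hosc h₂ x]
    · filter_upwards [H] with m hm x
      have i₁ := hint h₁ (hw m)
      have i₂ := hint h₂ (hw m)
      have h3 := hm (x + d)
      have h4 := hm x
      simp only [lineOscillation] at h3 h4
      have e : ∀ u : ℝ, (V₂ t (x + u • (a + m • b) + d) - V₁ t (x + u • (a + m • b) + d))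
          - (V₂ t (x + u • (a + m • b)) - V₁ t (x + u • (a + m • b)))
          = ((V₂ t (x + d + u • (a + m • b)) - V₂ t (u • (a + m • b)))
            - (V₁ t (x + d + u • (a + m • b)) - V₁ t (u • (a + m • b))))
          - ((V₂ t (x + u • (a + m • b)) - V₂ t (u • (a + m • b)))
            - (V₁ t (x + u • (a + m • b)) - V₁ t (u • (a + m • b)))) := fun u => by
        rw [add_right_comm x]
        ring
      simp only [e]
      refine (integral_sub ((i₂ (x + d)).sub (i₁ (x + d))) ((i₂ x).sub (i₁ x))).trans ?_
      rw [integral_sub' (i₂ (x + d)) (i₁ (x + d)), integral_sub' (i₂ x) (i₁ x), h3, h4, sub_self,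
        sub_self, sub_self]
  have hd : ∀ x, V₂ t x - V₁ t x = V₂ t 0 - V₁ t 0 := fun x => by
    have := hconst x 0
    rw [zero_add] at this
    linarith
  have hlim : Tendsto (fun k : ℝ => V₂ t (k • a) - V₁ t (k • a)) atTop (𝓝 0) := by
    have h3 : Tendsto (fun k : ℝ => (C₂ + C₁) * (1 + k) ^ (-δ)) atTop (𝓝 0) := by
      have := ((tendsto_rpow_neg_atTop hδ).comp
        (tendsto_atTop_add_const_left atTop (1 : ℝ) tendsto_id)).const_mul (C₂ + C₁)
      rwa [mul_zero] at this
    refine squeeze_zero_norm' ?_ h3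
    filter_upwards [eventually_ge_atTop 0] with k hk
    have h4 : ‖k • a‖ = k := by rw [norm_smul, ha, mul_one, Real.norm_of_nonneg hk]
    have h5 := h₁.decay t (k • a)
    have h6 := h₂.decay t (k • a)
    rw [h4] at h5 h6
    have := abs_sub (V₂ t (k • a)) (V₁ t (k • a))
    rw [Real.norm_eq_abs]
    linarith
  simp only [hd] at hlim
  have h7 := tendsto_nhds_unique hlim tendsto_const_nhds
  funext x
  have := hd x
  linarith

end XRay

/-! ### Assembly: admissible directions, wave operators and recovery of V. -/

section Reconstruction

variable {n : ℕ}

theorem PotentialBounds.propagator_eq {E : ℝ → Space n} (hE : LocallyIntegrable E volume)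
    {δ C : ℝ} {V : ℝ → Space n → ℝ} (h : PotentialBounds δ C V) (hδ : 0 ≤ δ)
    {D : ℝ → (L2 n ≃ₗᵢ[ℂ] L2 n)} (hD : IsInteractionEvolution E (h.toBCF hδ) D) :
    propagator E V = evolution E D :=
  propagator_eq_evolution hE (h.toBCF_apply hδ) (h.norm_toBCF_le hδ) (h.continuous_toBCF hδ) hD

theorem PotentialBounds.isWaveOperator_iff {E : ℝ → Space n} (hE : LocallyIntegrable E volume)
    {δ C : ℝ} {V : ℝ → Space n → ℝ} (h : PotentialBounds δ C V) (hδ : 0 ≤ δ)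
    {D : ℝ → (L2 n ≃ₗᵢ[ℂ] L2 n)} (hD : IsInteractionEvolution E (h.toBCF hδ) D) {L : Filter ℝ}
    {s : ℝ} {W : L2 n →L[ℂ] L2 n} :
    IsWaveOperator E V L s W ↔ ∀ f, Tendsto (fun t => waveFamily E D s t f) L (𝓝 (W f)) := by
  unfold IsWaveOperator
  simp only [h.propagator_eq hE hδ hD, freePropagator_apply hE, waveFamily_eq]

theorem isWaveOperator_waveOperator {E : ℝ → Space n} {V : ℝ → Space n → ℝ} {L : Filter ℝ} {s : ℝ}
    (h : ∃ W, IsWaveOperator E V L s W) : IsWaveOperator E V L s (waveOperator E V L s) := by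
  rw [waveOperator, dif_pos h]
  exact h.choose_spec

/-- Packets along `w` disperse fast enough at time `s` for every potential of order `δ`. -/
def PacketsDisperse (E : ℝ → Space n) (δ s : ℝ) (w β : Space n) : Prop :=
  ∀ (C : ℝ) (V : ℝ → Space n → ℝ) (h : PotentialBounds δ C V) (hδ : 0 ≤ δ),
    ∃ γ > 1, ∃ l₀ : ℝ, 1 ≤ l₀ ∧ PacketEstimate E s w β (h.toBCF hδ) γ l₀

theorem add_smul_ne_zero_of_inner_eq_zero {a b : Space n} (ha : ‖a‖ = 1)
    (hab : inner ℝ a b = (0 : ℝ)) (m : ℝ) : a + m • b ≠ 0 := fun h => by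
  have := congrArg (inner ℝ a) h
  rw [inner_add_right, inner_smul_right, hab, real_inner_self_eq_norm_sq, ha] at this
  simp at this

/-- Pairing a relation with a and with b shows that only the slope ⟨b, e⟩/⟨a, e⟩ can be parallel to
e. If ⟨a, e⟩ = 0 no slope is bad; the quotient then has the default value 0 and excluding it does no
harm. -/
theorem linearIndependent_add_smul {a b e : Space n} (ha : ‖a‖ = 1) (hb : ‖b‖ = 1)
    (hab : inner ℝ a b = (0 : ℝ)) (he : e ≠ 0) {m : ℝ} (hm : m ≠ inner ℝ b e / inner ℝ a e) :
    LinearIndependent ℝ ![a + m • b, e] := by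
  rw [LinearIndependent.pair_iff]
  intro r t h
  have h1 := congrArg (inner ℝ a) h
  have h2 := congrArg (inner ℝ b) h
  simp only [inner_add_right, inner_smul_right, hab,
    real_inner_self_eq_norm_sq, ha, hb, inner_zero_right] at h1 h2
  have hba : inner ℝ b a = (0 : ℝ) := by rw [real_inner_comm, hab]
  simp only [hba] at h2
  have h3 : t = 0 := by
    by_contra ht
    have h4 : inner ℝ b e = m * inner ℝ a e := by
      apply mul_left_cancel₀ ht
      linear_combination h2 - m * h1
    by_cases h5 : (inner ℝ a e : ℝ) = 0
    · have h6 : r = 0 := by simpa [h5] using h1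
      rw [h6, zero_smul, zero_add, smul_eq_zero] at h
      exact h.elim ht he
    · exact hm (by rw [h4, mul_div_cancel_right₀ _ h5])
  exact ⟨by simpa [h3] using h1, h3⟩

/-- For E₀ ≠ 0 only one slope is lost, a null set. The line inversion asks for almost every
direction, so a single plane suffices in every dimension n ≥ 2. -/
theorem ae_exists_packetsDisperse {E : ℝ → Space n} (hE : IsPeriodicField E) {δ : ℝ}
    (hδ_zero : meanField E = 0 → 1 < δ ∧ δ ≤ 2)
    (hδ_ne : meanField E ≠ 0 → 1 / 2 < δ ∧ δ ≤ 1) (s : ℝ) {a b : Space n} (ha : ‖a‖ = 1)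
    (hb : ‖b‖ = 1) (hab : inner ℝ a b = (0 : ℝ)) :
    ∀ᵐ m : ℝ, ∃ β, PacketsDisperse E δ s (a + m • b) β := by
  by_cases h0 : meanField E = 0
  · obtain ⟨β, R, hR, hβ⟩ := exists_norm_centre_sub_le hE h0 s
    obtain ⟨h1, h2⟩ := hδ_zero h0
    exact Eventually.of_forall fun m => ⟨β, fun C V h hδ => ⟨δ, h1,
      h.exists_packetEstimate_of_meanField_eq_zero hδ h2 hR hβ
        (add_smul_ne_zero_of_inner_eq_zero ha hab m)⟩⟩
  · obtain ⟨h1, h2⟩ := hδ_ne h0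
    filter_upwards [measure_eq_zero_iff_ae_notMem.1
      (measure_singleton (μ := (volume : Measure ℝ))
        (inner ℝ b (meanField E) / inner ℝ a (meanField E)))] with m hm
    exact ⟨0, fun C V h hδ => h.exists_packetEstimate_of_linearIndependent hδ h1 h2 hE s
      (linearIndependent_add_smul ha hb hab h0 hm)⟩

theorem exists_orthonormal_pair (hn : 2 ≤ n) :
    ∃ a b : Space n, ‖a‖ = 1 ∧ ‖b‖ = 1 ∧ inner ℝ a b = (0 : ℝ) := by
  refine ⟨EuclideanSpace.single ⟨0, by omega⟩ 1, EuclideanSpace.single ⟨1, by omega⟩ 1,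
    by simp, by simp, ?_⟩
  rw [EuclideanSpace.inner_single_left]
  simp

theorem PotentialBounds.exists_isWaveOperator {E : ℝ → Space n} (hE : LocallyIntegrable E volume)
    {δ C : ℝ} {V : ℝ → Space n → ℝ} (h : PotentialBounds δ C V) (hδ : 0 ≤ δ) {s : ℝ}
    {w β : Space n} (hw : w ≠ 0) (hP : PacketsDisperse E δ s w β) :
    (∃ W, IsWaveOperator E V atTop s W) ∧ ∃ W, IsWaveOperator E V atBot s W := by
  obtain ⟨D, hD⟩ := exists_isInteractionEvolution hE (h.toBCF_apply hδ) (h.norm_toBCF_le hδ)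
    (h.continuous_toBCF hδ)
  obtain ⟨γ, hγ, l₀, hl₀, hP⟩ := hP C V h hδ
  simp only [h.isWaveOperator_iff hE hδ hD]
  exact hP.exists_waveOperators hE h hδ hγ hl₀ hD hw

theorem PotentialBounds.lineOscillation_eq_of_scatteringOperator_eq {E : ℝ → Space n}
    (hE : LocallyIntegrable E volume) {δ C₁ C₂ : ℝ} {V₁ V₂ : ℝ → Space n → ℝ}
    (h₁ : PotentialBounds δ C₁ V₁) (h₂ : PotentialBounds δ C₂ V₂) (hδ : 0 < δ) (hδ2 : δ ≤ 2)
    {s : ℝ} {w β : Space n} (hw : w ≠ 0) (hP : PacketsDisperse E δ s w β)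
    (hS : scatteringOperator E V₁ s = scatteringOperator E V₂ s) (x : Space n) :
    lineOscillation (V₁ s) w x = lineOscillation (V₂ s) w x := by
  obtain ⟨D₁, hD₁⟩ := exists_isInteractionEvolution hE (h₁.toBCF_apply hδ.le)
    (h₁.norm_toBCF_le hδ.le) (h₁.continuous_toBCF hδ.le)
  obtain ⟨D₂, hD₂⟩ := exists_isInteractionEvolution hE (h₂.toBCF_apply hδ.le)
    (h₂.norm_toBCF_le hδ.le) (h₂.continuous_toBCF hδ.le)
  obtain ⟨γ₁, hγ₁, l₁, hl₁, hP₁⟩ := hP C₁ V₁ h₁ hδ.le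
  obtain ⟨γ₂, hγ₂, l₂, hl₂, hP₂⟩ := hP C₂ V₂ h₂ hδ.le
  obtain ⟨p₁, m₁⟩ := h₁.exists_isWaveOperator hE hδ.le hw hP
  obtain ⟨p₂, m₂⟩ := h₂.exists_isWaveOperator hE hδ.le hw hP
  refine lineOscillation_eq_of_inner_eq hE h₁ h₂ hδ hδ2 hδ.le hw hγ₁ hγ₂ hl₁ hl₂ hP₁ hP₂ hD₁ hD₂
    ((h₁.isWaveOperator_iff hE hδ.le hD₁).1 (isWaveOperator_waveOperator p₁))
    ((h₁.isWaveOperator_iff hE hδ.le hD₁).1 (isWaveOperator_waveOperator m₁))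
    ((h₂.isWaveOperator_iff hE hδ.le hD₂).1 (isWaveOperator_waveOperator p₂))
    ((h₂.isWaveOperator_iff hE hδ.le hD₂).1 (isWaveOperator_waveOperator m₂)) (fun f g => ?_) x
  have h3 := congrArg (fun S : L2 n →L[ℂ] L2 n => (inner ℂ f (S g) : ℂ)) hS
  simpa only [scatteringOperator, ContinuousLinearMap.comp_apply,
    ContinuousLinearMap.adjoint_inner_right] using h3

theorem eq_of_periodic_of_eqOn_Icc {X : Type*} {V₁ V₂ : ℝ → X} (h₁ : Function.Periodic V₁ 1)
    (h₂ : Function.Periodic V₂ 1) (h : ∀ s ∈ Set.Icc (0 : ℝ) 1, V₁ s = V₂ s) : V₁ = V₂ := by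
  funext t
  have hp : Function.Periodic (fun t => (V₁ t, V₂ t)) 1 := fun t => by
    beta_reduce
    rw [h₁, h₂]
  obtain ⟨y, hy, e⟩ := hp.exists_mem_Ico₀ one_pos t
  rw [Prod.mk.injEq] at e
  rw [e.1, e.2, h y ⟨hy.1, hy.2.le⟩]

theorem scatteringDefined_and_scatteringOperator_eq_iff (n : ℕ) (hn : 2 ≤ n) (E : ℝ → Space n)
    (hE : IsPeriodicField E) (δ : ℝ)
    (hδ_zero : meanField E = 0 → 1 < δ)
    (hδ_three : meanField E ≠ 0 → 3 ≤ n → 1 / 2 < δ)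
    (hδ_two : meanField E ≠ 0 → n = 2 → 3 / 4 < δ)
    (V₁ V₂ : ℝ → Space n → ℝ)
    (hV₁ : IsPeriodicPotential δ V₁)
    (hV₂ : IsPeriodicPotential δ V₂) :
    ScatteringDefined E V₁ ∧ ScatteringDefined E V₂ ∧
      ((∀ s ∈ Set.Icc (0 : ℝ) 1, scatteringOperator E V₁ s
          = scatteringOperator E V₂ s) ↔ V₁ = V₂) := by
  have hLI := hE.locallyIntegrable
  -- The decay exponent is lowered to at most 2, or at most 1 when E₀ ≠ 0, where the packet
  -- estimates apply; `PotentialBounds.mono` allows this. For E₀ ≠ 0 both dimension cases supply δ >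
  -- 1/2.
  obtain ⟨δ', hδ'δ, h0, h2, hz, hne⟩ : ∃ δ' ≤ δ, 0 < δ' ∧ δ' ≤ 2 ∧
      (meanField E = 0 → 1 < δ' ∧ δ' ≤ 2) ∧ (meanField E ≠ 0 → 1 / 2 < δ' ∧ δ' ≤ 1) := by
    by_cases hm : meanField E = 0
    · have h1 := hδ_zero hm
      exact ⟨min δ 2, min_le_left _ _, lt_min (by linarith) two_pos, min_le_right _ _,
        fun _ => ⟨lt_min h1 one_lt_two, min_le_right _ _⟩, fun h => absurd hm h⟩
    · have h1 : 1 / 2 < δ := by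
        rcases hn.eq_or_lt with h | h
        · linarith [hδ_two hm h.symm]
        · exact hδ_three hm h
      exact ⟨min δ 1, min_le_left _ _, lt_min (by linarith) one_pos,
        (min_le_right _ _).trans one_le_two, fun h => absurd h hm,
        fun _ => ⟨lt_min h1 (by norm_num), min_le_right _ _⟩⟩
  have hδ0 : 0 ≤ δ := h0.le.trans hδ'δ
  obtain ⟨a, b, ha, hb, hab⟩ := exists_orthonormal_pair hn
  have hpack := fun s => ae_exists_packetsDisperse hE hz hne s ha hb hab
  have hdef : ∀ V, IsPeriodicPotential δ V → ScatteringDefined E V := fun V hV => by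
    obtain ⟨C, hC⟩ := hV.exists_potentialBounds hδ0
    have hW : ∀ s, (∃ W, IsWaveOperator E V atTop s W) ∧ ∃ W, IsWaveOperator E V atBot s W :=
      fun s => by
        obtain ⟨m, β, hβ⟩ := (hpack s).exists
        exact (hC.mono hδ'δ hδ0).exists_isWaveOperator hLI h0.le
          (add_smul_ne_zero_of_inner_eq_zero ha hab m) hβ
    exact ⟨existsUnique_isPropagator_free hLI,
      existsUnique_isPropagator hLI (hC.toBCF_apply hδ0) (hC.norm_toBCF_le hδ0)
        (hC.continuous_toBCF hδ0), fun s => (hW s).1, fun s => (hW s).2⟩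
  refine ⟨hdef V₁ hV₁, hdef V₂ hV₂, fun hS => ?_, fun h s _ => by rw [h]⟩
  obtain ⟨C₁, hC₁⟩ := hV₁.exists_potentialBounds hδ0
  obtain ⟨C₂, hC₂⟩ := hV₂.exists_potentialBounds hδ0
  have hB₁ := hC₁.mono hδ'δ hδ0
  have hB₂ := hC₂.mono hδ'δ hδ0
  -- Each s in [0, 1] is treated separately: the scattering operator at time s determines the
  -- potential at the same time s.
  refine eq_of_periodic_of_eqOn_Icc (fun t => funext (hV₁.periodic t))
    (fun t => funext (hV₂.periodic t)) fun s hs => ?_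
  refine hB₁.eq_of_lineOscillation_eq hB₂ h0 h2 s ha hb hab ?_
  filter_upwards [hpack s] with m ⟨β, hβ⟩ x
  exact hB₁.lineOscillation_eq_of_scatteringOperator_eq hLI hB₂ h0 h2
    (add_smul_ne_zero_of_inner_eq_zero ha hab m) hβ (hS s hs) x

end Reconstruction

end PeriodicField

end

theorem theorem3 (n : ℕ) (hn : 2 ≤ n) (E : ℝ → PeriodicField.Space n)
    (hE : PeriodicField.IsPeriodicField E) (δ : ℝ)
    (hδ_zero : PeriodicField.meanField E = 0 → 1 < δ)
    (hδ_three : PeriodicField.meanField E ≠ 0 → 3 ≤ n → 1 / 2 < δ)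
    (hδ_two : PeriodicField.meanField E ≠ 0 → n = 2 → 3 / 4 < δ)
    (V₁ V₂ : ℝ → PeriodicField.Space n → ℝ)
    (hV₁ : PeriodicField.IsPeriodicPotential δ V₁)
    (hV₂ : PeriodicField.IsPeriodicPotential δ V₂) :
    PeriodicField.ScatteringDefined E V₁ ∧ PeriodicField.ScatteringDefined E V₂ ∧
      ((∀ s ∈ Set.Icc (0 : ℝ) 1, PeriodicField.scatteringOperator E V₁ s
          = PeriodicField.scatteringOperator E V₂ s) ↔ V₁ = V₂) := by
  exact PeriodicField.scatteringDefined_and_scatteringOperator_eq_iff n hn E hE δ hδ_zero hδ_three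
    hδ_two V₁ V₂ hV₁ hV₂
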